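/- Let $m\ge 2$ and $a\ge 2$ be integers, $\gamma=1/a$, $r\in(0,1)$ and $\rho\in(0,1]$. Let $p$ range over the (infinitely many) primes with $a\mid p-1$, put $n=n(p)=p^{m(m+1)}\cdot\gamma(p^{m+1}-1)$, and let integers $0\le D=D(p)\le n$ satisfy $D/n\to\rho$ as $p\to\infty$. All asymptotics are for $p\to\infty$ along these primes, with $m,a,r,\rho$ and the function $D$ fixed. **Construction.** Let $\mathbb F$ be any finite extension of $\mathbb F_p$ containing $\mathbb F_{p^{m(m+1)}}$ with $|\mathbb F|\ge n$. Let $G=\mathbb F_{p^m}$ act on $\mathbb F$ by translations $x\mapsto x+u$, let $H$ be the subgroup of $\mathbb F_{p^{m+1}}^\times$ of order $\gamma(p^{m+1}-1)$, acting by scalings $x\mapsto vx$, and let $A=\langle G,H\rangle\le \mathrm{AGL}(1,\mathbb F)$. Choose $\alpha\in\mathbb F$ with trivial stabilizer in $A$ and let $\Omega=A\alpha$. Put $g(X)=\prod_{u\in G}(X-u)$ and $h(X)=X^{|H|}$. For a nonconstant $u\in\mathbb F[X]$ and $f=\sum_i c_iu^i$ with $\deg c_i<\deg u$, let $\deg_u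 f=\max_i\deg c_i$ (where $\deg 0=-\infty$). The code is $$\mathcal C=\{(f(\beta))_{\beta\in\Omega}: f\in\mathbb F[X],\ \deg f<D,\ \deg_g f<r|G|,\ \deg_h f<r|H|\}.$$ Let $\mathsf B$ be the bipartite graph with edge set $A$ whose left vertices are the right cosets $G\phi$, whose right vertices are the right cosets $H\phi$ ($\phi\in A$), and in which the edge $\phi$ joins $G\phi$ to $H\phi$. Identify the edge $\phi$ with the coordinate $\phi(\alpha)\in\Omega$. The local code at a left (right) vertex consists of the evaluations, at the points $\phi(\alpha)$ of its incident edges $\phi$, of all polynomials of degree less than $r|G|$ (respectively $r|H|$). **Theorem.** One has $|G|=p^m$, $|H|=\gamma(p^{m+1}-1)$ and $|A|=n=\gamma p^{(m+1)^2}(1+o(1))$, and an $\alpha$ with trivial stabilizer exists. For every choice of $\mathbb F$ and $\alpha$, and with all $o(1)$ terms uniform in these choices, $\mathcal C$ is an expander code of length $|\Omega|=n$: the map $\phi\mapsto\phi(\alpha)$ is a bijection $A\to\Omega$; $\mathsf B$ is biregular with left degree $|G|$ and right degree $|H|$; the second largest singular value of its bi-adjacency matrix divided by $\sqrt{|G||H|}$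 is at most $(1+o(1))/\sqrt p$; and $\mathcal C$ is contained in the Tanner code on $\mathsf B$ with the above Reed–Solomon local codes, with equality if $D=n$. (These exact statements hold for all sufficiently large $p$.) Moreover: 1. The local code lengths are $|G|=p^m=\Theta\big(n^{m/(m+1)^2}\big)$ on the left and $|H|=\gamma(p^{m+1}-1)=\Theta\big(n^{1/(m+1)}\big)$ on the right, and every local code has rate at most $r+o(1)$ and relative distance at least $1-r-o(1)$. 2. The relative distance of $\mathcal C$ is at least $\max\big(1-\rho,(1-r)^2\big)-o(1)$. 3. The rate of $\mathcal C$ is at least $$\frac{\gamma^{2m}\,r}{(2m+1)!}\Big(r^{2m+1}-\max(0,r-\rho)^{2m+1}\Big)-o(1).$$ -/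

import Mathlib

open Polynomial Filter Topology Asymptotics

namespace AlgExpander

noncomputable section

/-! ### Base-`u` expansion of a polynomial -/

section BaseDegree

variable {F : Type*} [Field F]

/-- The `i`-th digit `c_i` of the base-`u` expansion `f = ∑ c_i u^i`, `deg c_i < deg u`
(repeated division with remainder by `u`). -/
def baseCoeff (u : F[X]) : ℕ → F[X] → F[X]
  | 0, f => f % u
  | i + 1, f => baseCoeff u i (f / u)

/-- The `u`-base degree: the largest degree of a digit of `f` in base `u`
(with `deg 0 = ⊥`, that is, `-∞`). For `u` nonconstant all digits of index larger
than `deg f` vanish. -/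
def baseDegree (u f : F[X]) : WithBot ℕ :=
  (Finset.range (f.natDegree + 1)).sup fun i => (baseCoeff u i f).degree

theorem add_div_base {u : F[X]} (hu : u ≠ 0) (f g : F[X]) : (f + g) / u = f / u + g / u := by
  have h1 := EuclideanDomain.div_add_mod f u
  have h2 := EuclideanDomain.div_add_mod g u
  have h3 := EuclideanDomain.div_add_mod (f + g) u
  rw [Polynomial.add_mod] at h3
  exact mul_left_cancel₀ hu (by linear_combination h3 - h1 - h2)

theorem baseCoeff_add {u : F[X]} (hu : u ≠ 0) (i : ℕ) (f g : F[X]) :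
    baseCoeff u i (f + g) = baseCoeff u i f + baseCoeff u i g := by
  induction i generalizing f g with
  | zero => exact Polynomial.add_mod f g u
  | succ i ih => simp only [baseCoeff]; rw [add_div_base hu, ih]

theorem C_mul_mod_base {u : F[X]} (hu : u ≠ 0) (a : F) (f : F[X]) :
    (C a * f) % u = C a * (f % u) := by
  have h : u ∣ C a * f - C a * (f % u) :=
    ⟨C a * (f / u), by linear_combination (-(C a)) * EuclideanDomain.div_add_mod f u⟩
  rw [Polynomial.mod_eq_of_dvd_sub h, (Polynomial.mod_eq_self_iff hu).2]
  refine lt_of_le_of_lt ?_ (Polynomial.degree_mod_lt f hu)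
  rw [← Polynomial.smul_eq_C_mul]
  exact Polynomial.degree_smul_le _ _

theorem C_mul_div_base {u : F[X]} (hu : u ≠ 0) (a : F) (f : F[X]) :
    (C a * f) / u = C a * (f / u) := by
  have h1 := EuclideanDomain.div_add_mod f u
  have h3 := EuclideanDomain.div_add_mod (C a * f) u
  rw [C_mul_mod_base hu] at h3
  exact mul_left_cancel₀ hu (by linear_combination h3 - C a * h1)

theorem baseCoeff_C_mul {u : F[X]} (hu : u ≠ 0) (i : ℕ) (a : F) (f : F[X]) :
    baseCoeff u i (C a * f) = C a * baseCoeff u i f := by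
  induction i generalizing f with
  | zero => exact C_mul_mod_base hu a f
  | succ i ih => simp only [baseCoeff]; rw [C_mul_div_base hu, ih]

theorem baseCoeff_zero_right (u : F[X]) (i : ℕ) : baseCoeff u i 0 = 0 := by
  induction i with
  | zero => simp [baseCoeff]
  | succ i ih => simpa [baseCoeff] using ih

theorem degree_baseCoeff_lt {u : F[X]} (hu : u ≠ 0) (i : ℕ) (f : F[X]) :
    (baseCoeff u i f).degree < u.degree := by
  induction i generalizing f with
  | zero => exact Polynomial.degree_mod_lt f hu
  | succ i ih => exact ih _

theorem baseCoeff_eq_zero {u : F[X]} (hu : 0 < u.degree) (i : ℕ) (f : F[X])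
    (hf : f.degree < (i : ℕ)) : baseCoeff u i f = 0 := by
  induction i generalizing f with
  | zero =>
    have : f = 0 := by
      by_contra h
      exact absurd hf (not_lt.2 (by simpa using Polynomial.zero_le_degree_iff.2 h))
    subst this
    exact baseCoeff_zero_right u 0
  | succ i ih =>
    simp only [baseCoeff]
    apply ih
    by_cases h : f = 0
    · subst h; simp [bot_lt_iff_ne_bot]
    · have h1 := Polynomial.degree_div_lt h hu
      rw [Polynomial.degree_eq_natDegree h] at h1 hf
      have h2 : f.natDegree < i + 1 := by exact_mod_cast hf
      exact lt_of_lt_of_le h1 (by exact_mod_cast Nat.le_of_lt_succ h2)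

/-- The base-`u` expansion recovers `f`. -/
theorem sum_baseCoeff {u : F[X]} (hu : 0 < u.degree) (f : F[X]) (n : ℕ)
    (hf : f.degree < (n : ℕ)) :
    ∑ i ∈ Finset.range n, baseCoeff u i f * u ^ i = f := by
  induction n generalizing f with
  | zero =>
    by_contra h
    exact absurd hf (not_lt.2 (by simpa using Polynomial.zero_le_degree_iff.2 (Ne.symm h)))
  | succ n ih =>
    rw [Finset.sum_range_succ']
    have h1 : (f / u).degree < (n : ℕ) := by
      by_cases h : f = 0
      · subst h; simp [bot_lt_iff_ne_bot]
      · have h1 := Polynomial.degree_div_lt h hu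
        rw [Polynomial.degree_eq_natDegree h] at h1 hf
        have h2 : f.natDegree < n + 1 := by exact_mod_cast hf
        exact lt_of_lt_of_le h1 (by exact_mod_cast Nat.le_of_lt_succ h2)
    have h2 : ∑ i ∈ Finset.range n, baseCoeff u (i + 1) f * u ^ (i + 1) = u * (f / u) := by
      conv_rhs => rw [← ih (f / u) h1]
      rw [Finset.mul_sum]
      refine Finset.sum_congr rfl fun i _ => ?_
      simp only [baseCoeff]; ring
    rw [h2]
    simpa [baseCoeff] using EuclideanDomain.div_add_mod f u

/-- The base-`u` expansion is unique. -/
theorem baseCoeff_sum {u : F[X]} (hu : 0 < u.degree) (n : ℕ) (c : ℕ → F[X])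
    (hc : ∀ i, (c i).degree < u.degree) (hn : ∀ i, n ≤ i → c i = 0) (i : ℕ) :
    baseCoeff u i (∑ j ∈ Finset.range n, c j * u ^ j) = c i := by
  have hu0 : u ≠ 0 := Polynomial.ne_zero_of_degree_gt hu
  induction n generalizing c i with
  | zero => simp [baseCoeff_zero_right, hn i (Nat.zero_le i)]
  | succ n ih =>
    have hs : ∑ j ∈ Finset.range (n + 1), c j * u ^ j
        = u * (∑ j ∈ Finset.range n, c (j + 1) * u ^ j) + c 0 := by
      rw [Finset.sum_range_succ', Finset.mul_sum]
      simp only [pow_zero, mul_one]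
      congr 1
      exact Finset.sum_congr rfl fun j _ => by ring
    have hmod : (u * (∑ j ∈ Finset.range n, c (j + 1) * u ^ j) + c 0) % u = c 0 := by
      rw [Polynomial.add_mod, (EuclideanDomain.mod_eq_zero).2 (dvd_mul_right u _), zero_add]
      exact (Polynomial.mod_eq_self_iff hu0).2 (hc 0)
    have hdiv : (u * (∑ j ∈ Finset.range n, c (j + 1) * u ^ j) + c 0) / u
        = ∑ j ∈ Finset.range n, c (j + 1) * u ^ j := by
      have h := EuclideanDomain.div_add_mod
        (u * (∑ j ∈ Finset.range n, c (j + 1) * u ^ j) + c 0) u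
      rw [hmod] at h
      exact mul_left_cancel₀ hu0 (by linear_combination h)
    rw [hs]
    cases i with
    | zero => exact hmod
    | succ i =>
      simp only [baseCoeff]
      rw [hdiv]
      exact ih (fun j => c (j + 1)) (fun j => hc _) (fun j hj => hn _ (by omega)) i

theorem baseDegree_lt_iff {u : F[X]} (hu : 0 < u.degree) (f : F[X]) (k : ℕ) :
    baseDegree u f < (k : ℕ) ↔ ∀ i, (baseCoeff u i f).degree < (k : ℕ) := by
  unfold baseDegree
  rw [Finset.sup_lt_iff (show (⊥ : WithBot ℕ) < ((k : ℕ) : WithBot ℕ) from WithBot.bot_lt_coe k)]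
  refine ⟨fun h i => ?_, fun h i _ => h i⟩
  by_cases hi : i < f.natDegree + 1
  · exact h i (Finset.mem_range.2 hi)
  · rw [baseCoeff_eq_zero hu i f]
    · rw [Polynomial.degree_zero]; exact WithBot.bot_lt_coe k
    · refine lt_of_le_of_lt Polynomial.degree_le_natDegree ?_
      have : f.natDegree < i := by omega
      exact_mod_cast this

end BaseDegree

/-! ### Linear codes: minimum distance, rate, Reed–Solomon codes, Tanner codes -/

section Codes

variable {F : Type*} [Field F] {ι : Type*}

/-- Minimum Hamming distance between two distinct codewords. -/
def minDist (C : Submodule F (ι → F)) : ℕ :=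
  sInf {d | ∃ c ∈ C, ∃ c' ∈ C, c ≠ c' ∧ d = Set.ncard {i | c i ≠ c' i}}

/-- Relative distance: minimum distance divided by length. -/
def relDist (C : Submodule F (ι → F)) : ℝ := (minDist C : ℝ) / Nat.card ι

/-- Rate: dimension divided by length. -/
def rate (C : Submodule F (ι → F)) : ℝ := (Module.finrank F C : ℝ) / Nat.card ι

/-- Evaluation of polynomials at the points `x i`. -/
def evalAt (x : ι → F) : F[X] →ₗ[F] (ι → F) := LinearMap.pi fun i => Polynomial.leval (x i)

/-- The Reed–Solomon code of evaluations at the points `x i` of the polynomials of degree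
less than `k`. -/
def rsCode (x : ι → F) (k : ℕ) : Submodule F (ι → F) :=
  (Polynomial.degreeLT F k).map (evalAt x)

/-- The Tanner code of a bipartite (multi)graph with edge set `E`, whose edge `e` joins the left
vertex `l e` to the right vertex `r e`, with local codes `CL v` and `CR v` on the sets of edges
incident to the vertices `v`. -/
def tannerCode {E L R : Type*} (l : E → L) (r : E → R)
    (CL : ∀ v : L, Submodule F ({e : E // l e = v} → F))
    (CR : ∀ v : R, Submodule F ({e : E // r e = v} → F)) : Submodule F (E → F) :=
  (⨅ v : L, (CL v).comap (LinearMap.funLeft F F (Subtype.val : {e : E // l e = v} → E))) ⊓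
  (⨅ v : R, (CR v).comap (LinearMap.funLeft F F (Subtype.val : {e : E // r e = v} → E)))

theorem mem_tannerCode {E L R : Type*} (l : E → L) (r : E → R)
    (CL : ∀ v : L, Submodule F ({e : E // l e = v} → F))
    (CR : ∀ v : R, Submodule F ({e : E // r e = v} → F)) (c : E → F) :
    c ∈ tannerCode l r CL CR ↔
      (∀ v, (fun e : {e : E // l e = v} => c e.1) ∈ CL v) ∧
      (∀ v, (fun e : {e : E // r e = v} => c e.1) ∈ CR v) := by
  simp only [tannerCode, Submodule.mem_inf, Submodule.mem_iInf, Submodule.mem_comap]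
  exact Iff.rfl

end Codes

/-! ### Normalized bi-adjacency operator -/

section Spectral

/-- The bi-adjacency matrix of a bipartite multigraph: the `(u, v)` entry is the number of edges
joining `u` and `v`. -/
def biadj {E L R : Type*} (l : E → L) (r : E → R) : Matrix L R ℝ :=
  fun u v => (Nat.card {e : E // l e = u ∧ r e = v} : ℝ)

open Classical in
/-- The normalized operator `T = B / √(dL dR) : ℓ₂(R) → ℓ₂(L)` of a biregular bipartite multigraph
with left degree `dL` and right degree `dR`. -/
def biadjOp {E L R : Type*} [Fintype L] [Fintype R] (l : E → L) (r : E → R) (dL dR : ℕ) :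
    EuclideanSpace ℝ R →ₗ[ℝ] EuclideanSpace ℝ L :=
  Matrix.toEuclideanLin ((1 / √((dL : ℝ) * dR)) • biadj l r)

/-- The second largest singular value (counted with multiplicity; Mathlib's list of singular
values starts at index `0`). -/
def sigmaTwo {E L R : Type*} [Fintype L] [Fintype R] (l : E → L) (r : E → R) (dL dR : ℕ) : ℝ :=
  (biadjOp l r dL dR).singularValues 1

end Spectral

/-! ### The general construction from a translation group and a scaling group -/

section Construction

variable {F : Type*} [Field F]

/-- The translations `x ↦ x + u`, `u ∈ U`, as a subgroup of `AGL(1, F)`. -/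
def translations (U : AddSubgroup F) : Subgroup (F ≃ᵃ[F] F) :=
  (AddSubgroup.toSubgroup U).map (AffineEquiv.constVAddHom F F)

/-- The scalings `x ↦ v x`, `v ∈ V`, as a subgroup of `AGL(1, F)`. -/
def scalings (V : Subgroup Fˣ) : Subgroup (F ≃ᵃ[F] F) :=
  V.map (AffineEquiv.homothetyUnitsMulHom (0 : F))

theorem mem_translations (U : AddSubgroup F) (φ : F ≃ᵃ[F] F) :
    φ ∈ translations U ↔ ∃ u ∈ U, ∀ x, φ x = x + u := by
  constructor
  · rintro ⟨u, hu, rfl⟩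
    exact ⟨u.toAdd, hu, fun x => add_comm _ _⟩
  · rintro ⟨u, hu, h⟩
    refine ⟨Multiplicative.ofAdd u, hu, ?_⟩
    ext x
    rw [h]
    exact add_comm _ _

theorem mem_scalings (V : Subgroup Fˣ) (φ : F ≃ᵃ[F] F) :
    φ ∈ scalings V ↔ ∃ v ∈ V, ∀ x, φ x = (v : F) * x := by
  constructor
  · rintro ⟨v, hv, rfl⟩
    exact ⟨v, hv, fun x => by simp [AffineMap.homothety_apply]⟩
  · rintro ⟨v, hv, h⟩
    refine ⟨v, hv, ?_⟩
    ext x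
    rw [h]
    simp [AffineMap.homothety_apply]

/-- The group `A = ⟨G, H⟩` generated by the translations by `U` and the scalings by `V`. -/
def genGroup (U : AddSubgroup F) (V : Subgroup Fˣ) : Subgroup (F ≃ᵃ[F] F) :=
  translations U ⊔ scalings V

/-- `α` has trivial stabilizer in `A`. -/
def HasTrivialStabilizer (U : AddSubgroup F) (V : Subgroup Fˣ) (α : F) : Prop :=
  ∀ φ ∈ genGroup U V, φ α = α → φ = 1

/-- The evaluation set: the orbit of `α` under `A`. -/
def evalSet (U : AddSubgroup F) (V : Subgroup Fˣ) (α : F) : Set F :=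
  {x | ∃ φ ∈ genGroup U V, φ α = x}

/-- The invariant polynomial `∏_{u ∈ U} (X - u)` of the translation group. -/
def translationPoly (U : AddSubgroup F) : F[X] := ∏ᶠ u : U, (X - C (u : F))

/-- The invariant polynomial `X^|V|` of the scaling group. -/
def scalingPoly (V : Subgroup Fˣ) : F[X] := X ^ Nat.card V

theorem degree_translationPoly_pos [Finite F] (U : AddSubgroup F) :
    0 < (translationPoly U).degree := by
  classical
  have := Fintype.ofFinite U
  rw [translationPoly, finprod_eq_prod_of_fintype, Polynomial.degree_prod]
  simp [Fintype.card_pos]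

theorem degree_scalingPoly_pos [Finite F] (V : Subgroup Fˣ) : 0 < (scalingPoly V).degree := by
  rw [scalingPoly, Polynomial.degree_X_pow]
  exact_mod_cast Nat.card_pos

theorem baseDegree_lt_add {u f g : F[X]} (hu : 0 < u.degree) {k : ℕ}
    (hf : baseDegree u f < (k : ℕ)) (hg : baseDegree u g < (k : ℕ)) :
    baseDegree u (f + g) < (k : ℕ) := by
  rw [baseDegree_lt_iff hu] at *
  intro i
  rw [baseCoeff_add (Polynomial.ne_zero_of_degree_gt hu)]
  exact lt_of_le_of_lt (Polynomial.degree_add_le _ _) (max_lt (hf i) (hg i))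

theorem baseDegree_lt_smul {u f : F[X]} (hu : 0 < u.degree) {k : ℕ} (a : F)
    (hf : baseDegree u f < (k : ℕ)) : baseDegree u (a • f) < (k : ℕ) := by
  rw [baseDegree_lt_iff hu] at *
  intro i
  rw [Polynomial.smul_eq_C_mul, baseCoeff_C_mul (Polynomial.ne_zero_of_degree_gt hu),
    ← Polynomial.smul_eq_C_mul]
  exact lt_of_le_of_lt (Polynomial.degree_smul_le _ _) (hf i)

theorem baseDegree_lt_zero {u : F[X]} (hu : 0 < u.degree) {k : ℕ} :
    baseDegree u (0 : F[X]) < (k : ℕ) := by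
  rw [baseDegree_lt_iff hu]
  intro i
  rw [baseCoeff_zero_right, Polynomial.degree_zero]
  exact WithBot.bot_lt_coe k

/-- The message space: polynomials `f` with `deg f < D`, `deg_g f < r |U|` and `deg_h f < r |V|`.
For a natural number `d`, the condition `d < r N` is the same as `d < ⌈r N⌉`. -/
def messageSpace [Finite F] (U : AddSubgroup F) (V : Subgroup Fˣ) (r : ℝ) (D : ℕ) :
    Submodule F F[X] where
  carrier := {f | f.degree < (D : ℕ) ∧
    baseDegree (translationPoly U) f < (⌈r * Nat.card U⌉₊ : ℕ) ∧
    baseDegree (scalingPoly V) f < (⌈r * Nat.card V⌉₊ : ℕ)}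
  add_mem' := fun {_ _} hf hg =>
    ⟨lt_of_le_of_lt (Polynomial.degree_add_le _ _) (max_lt hf.1 hg.1),
      baseDegree_lt_add (degree_translationPoly_pos U) hf.2.1 hg.2.1,
      baseDegree_lt_add (degree_scalingPoly_pos V) hf.2.2 hg.2.2⟩
  zero_mem' := ⟨by rw [Polynomial.degree_zero]; exact WithBot.bot_lt_coe D,
    baseDegree_lt_zero (degree_translationPoly_pos U),
    baseDegree_lt_zero (degree_scalingPoly_pos V)⟩
  smul_mem' := fun a _ hf =>
    ⟨lt_of_le_of_lt (Polynomial.degree_smul_le _ _) hf.1,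
      baseDegree_lt_smul (degree_translationPoly_pos U) a hf.2.1,
      baseDegree_lt_smul (degree_scalingPoly_pos V) a hf.2.2⟩

/-- The code `C(G, H; r, D)`: evaluations of the message polynomials on the orbit of `α`. -/
def code [Finite F] (U : AddSubgroup F) (V : Subgroup Fˣ) (r : ℝ) (D : ℕ) (α : F) :
    Submodule F (evalSet U V α → F) :=
  (messageSpace U V r D).map (evalAt (Subtype.val : evalSet U V α → F))

/-! #### The coset graph -/

/-- Left vertices: the right cosets `Gφ` of `G` in `A`. -/
abbrev LeftVertex (U : AddSubgroup F) (V : Subgroup Fˣ) : Type _ :=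
  Quotient (QuotientGroup.rightRel ((translations U).subgroupOf (genGroup U V)))

/-- Right vertices: the right cosets `Hφ` of `H` in `A`. -/
abbrev RightVertex (U : AddSubgroup F) (V : Subgroup Fˣ) : Type _ :=
  Quotient (QuotientGroup.rightRel ((scalings V).subgroupOf (genGroup U V)))

/-- The left end `Gφ` of the edge `φ ∈ A`. -/
def leftEnd (U : AddSubgroup F) (V : Subgroup Fˣ) (φ : genGroup U V) : LeftVertex U V :=
  Quotient.mk _ φ

/-- The right end `Hφ` of the edge `φ ∈ A`. -/
def rightEnd (U : AddSubgroup F) (V : Subgroup Fˣ) (φ : genGroup U V) : RightVertex U V :=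
  Quotient.mk _ φ

instance finiteAffine [Finite F] : Finite (F ≃ᵃ[F] F) :=
  Finite.of_injective (fun φ : F ≃ᵃ[F] F => (φ : F → F)) DFunLike.coe_injective

instance [Finite F] (U : AddSubgroup F) (V : Subgroup Fˣ) : Fintype (LeftVertex U V) :=
  Fintype.ofFinite _

instance [Finite F] (U : AddSubgroup F) (V : Subgroup Fˣ) : Fintype (RightVertex U V) :=
  Fintype.ofFinite _

/-- The identification `φ ↦ φ(α)` of the edges of the coset graph with the code coordinates. -/
def edgePoint (U : AddSubgroup F) (V : Subgroup Fˣ) (α : F) (φ : genGroup U V) :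
    evalSet U V α :=
  ⟨φ.1 α, φ.1, φ.2, rfl⟩

/-- The code, with its coordinates indexed by the edges of the coset graph. -/
def edgeCode [Finite F] (U : AddSubgroup F) (V : Subgroup Fˣ) (r : ℝ) (D : ℕ) (α : F) :
    Submodule F (genGroup U V → F) :=
  (code U V r D α).map (LinearMap.funLeft F F (edgePoint U V α))

/-- The local code at a left vertex: the Reed–Solomon code on the points of the corresponding
`G`-orbit, of degree less than `⌈r |G|⌉`. -/
def leftLocalCode (U : AddSubgroup F) (V : Subgroup Fˣ) (r : ℝ) (α : F) (v : LeftVertex U V) :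
    Submodule F ({φ : genGroup U V // leftEnd U V φ = v} → F) :=
  rsCode (fun φ => (edgePoint U V α φ.1 : F)) ⌈r * Nat.card U⌉₊

/-- The local code at a right vertex: the Reed–Solomon code on the points of the corresponding
`H`-orbit, of degree less than `⌈r |H|⌉`. -/
def rightLocalCode (U : AddSubgroup F) (V : Subgroup Fˣ) (r : ℝ) (α : F) (v : RightVertex U V) :
    Submodule F ({φ : genGroup U V // rightEnd U V φ = v} → F) :=
  rsCode (fun φ => (edgePoint U V α φ.1 : F)) ⌈r * Nat.card V⌉₊

/-- The Tanner code on the coset graph with the Reed–Solomon local codes. -/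
def cosetTannerCode (U : AddSubgroup F) (V : Subgroup Fˣ) (r : ℝ) (α : F) :
    Submodule F (genGroup U V → F) :=
  tannerCode (leftEnd U V) (rightEnd U V) (leftLocalCode U V r α) (rightLocalCode U V r α)

/-- The second largest singular value of the normalized bi-adjacency operator of the coset
graph. -/
def cosetSigmaTwo [Finite F] (U : AddSubgroup F) (V : Subgroup Fˣ) : ℝ :=
  sigmaTwo (leftEnd U V) (rightEnd U V) (Nat.card U) (Nat.card V)

end Construction

/-! ### The instantiation -/

section Instantiation

/-- The additive group of the subfield `F_{p^m}` of `F`, that is, `{x | x^(p^m) = x}`. -/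
def addPart (F : Type*) [Field F] (p m : ℕ) [ExpChar F p] : AddSubgroup F :=
  (iterateFrobenius F p m).toAddMonoidHom.eqLocus (AddMonoidHom.id F)

theorem mem_addPart (F : Type*) [Field F] (p m : ℕ) [ExpChar F p] (x : F) :
    x ∈ addPart F p m ↔ x ^ p ^ m = x := Iff.rfl

/-- The order `(p^(m+1) - 1) / a` of the multiplicative group `H`. -/
def mulOrder (m a p : ℕ) : ℕ := (p ^ (m + 1) - 1) / a

/-- The subgroup of order `(p^(m+1) - 1) / a` of `F_{p^(m+1)}ˣ`, consisting of the roots of unity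
of this order. -/
def mulPart (F : Type*) [Field F] (m a p : ℕ) : Subgroup Fˣ := rootsOfUnity (mulOrder m a p) F

/-- The block length `p^(m(m+1)) · (p^(m+1) - 1) / a`. -/
def blockLength (m a p : ℕ) : ℕ := p ^ (m * (m + 1)) * mulOrder m a p

/-- The admissible characteristics: the primes `p` for which `(p - 1) / a` is an integer. -/
def admissible (a : ℕ) : Set ℕ := {p | p.Prime ∧ a ∣ p - 1}

/-- `p → ∞` along the admissible primes. -/
def admissibleAtTop (a : ℕ) : Filter ℕ := atTop ⊓ 𝓟 (admissible a)

end Instantiation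

end

end AlgExpander

/-! Structure of A. Since |H| > p^m, the additive span of H is all of F_{p^(m+1)}. The additive span
of the products vu with v in H and u in G is therefore a vector space over both F_{p^m} and
F_{p^(m+1)}; as m and m+1 are coprime, its order forces it to be W = F_{p^(m(m+1))}
(`isProductSpan`). So A consists of the maps x ↦ vx + w with v in H and w in W, and every α outside
W has trivial stabilizer.

Expansion. The right cosets of H are indexed by W, and the squared norm of the image of a function
under the bi-adjacency operator is a sum of autocorrelations at the shifts v⁻¹u. On functions of
mean zero, Fourier analysis on W reduces the bound to the sums of nontrivial characters χ(vu)
(`IsProductSpan.isExpander`). For all but at most p^(m-1) of the u, the character v ↦ χ(vu) is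
nontrivial on F_{p^(m+1)} and its sum over H is at most √(p^(m+1)); the other u contribute |H| at
most (`norm_sum_char_le`). Hence σ² ≤ 1/p + √(p^(m+1))/|H|.

Tanner structure. The polynomial g is constant on G-orbits and h on H-orbits, so substituting the
constant into the base expansion turns a bound on the base degree into a degree bound on each orbit.
Conversely, interpolation and root counting recover the base degree from the orbits
(`baseDegree_lt_of_fibres`), which gives equality when D = n.

Distance. A message has fewer than D roots, giving 1 - D/n. A nonzero Tanner codeword has at least a
fraction 1 - r of its local edges at every vertex it touches, and the expander mixing argument then
gives (1-r)² - σ(1-r) (`IsExpander.le_card_edges`).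

Rate. Evaluation is injective, so it is enough to count messages X^e. Here g = X^Q - X with Q = p^m,
each X^(Q^i) is X plus a polynomial in g, and the base-g degree of X^e is at most the base-Q digit
sum of e; its base-h degree is e mod |H|. `card_good_exponents` constructs many e < D with small
digit sum and small residue, and the density obtained is at least the claimed constant
(`rate_constant_le`). -/

namespace AlgExpander

/-! ### Root counting and distance and rate of Reed–Solomon codes -/

section CodeBounds

variable {F : Type*} [Field F] {ι : Type*}

/-- The nonzero codeword is needed: for the zero code the infimum is taken over the empty set and
equals 0. -/
theorem le_minDist {C : Submodule F (ι → F)} {d : ℕ} (hC : ∃ c ∈ C, c ≠ 0)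
    (h : ∀ c ∈ C, c ≠ 0 → d ≤ Set.ncard {i | c i ≠ 0}) : d ≤ minDist C := by
  obtain ⟨c, hc, hc0⟩ := hC
  refine le_csInf ⟨_, c, hc, 0, C.zero_mem, hc0, rfl⟩ ?_
  rintro _ ⟨x, hx, y, hy, hxy, rfl⟩
  have := h (x - y) (C.sub_mem hx hy) (sub_ne_zero.2 hxy)
  simpa [sub_ne_zero] using this

theorem evalAt_apply (x : ι → F) (f : F[X]) (i : ι) : evalAt x f i = f.eval (x i) := rfl

theorem mem_rsCode {x : ι → F} {k : ℕ} {c : ι → F} :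
    c ∈ rsCode x k ↔ ∃ f : F[X], f.degree < k ∧ ∀ i, f.eval (x i) = c i := by
  simp only [rsCode, Submodule.mem_map, Polynomial.mem_degreeLT, funext_iff, evalAt_apply]

theorem finrank_rsCode_le (x : ι → F) (k : ℕ) : Module.finrank F (rsCode x k) ≤ k := by
  have : Module.Finite F (Polynomial.degreeLT F k) :=
    Module.Finite.equiv (Polynomial.degreeLTEquiv F k).symm
  refine (Submodule.finrank_map_le _ _).trans ?_
  rw [(Polynomial.degreeLTEquiv F k).finrank_eq]
  simp

/-- A nonzero polynomial of degree less than `k` has fewer than `k` roots among distinct points. -/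
theorem card_lt_ncard_support_add [Finite ι] {x : ι → F} (hx : Function.Injective x) {k : ℕ}
    {f : F[X]} (hf0 : f ≠ 0) (hf : f.degree < k) :
    Nat.card ι < Set.ncard {i | f.eval (x i) ≠ 0} + k := by
  have h1 : Set.ncard {i | f.eval (x i) ≠ 0} + Set.ncard {i | f.eval (x i) = 0} = Nat.card ι := by
    rw [← Set.ncard_add_ncard_compl {i | f.eval (x i) ≠ 0}]
    congr 2
    ext i
    simp
  have h2 : Set.ncard {i | f.eval (x i) = 0} < k := by
    rw [Polynomial.degree_eq_natDegree hf0, Nat.cast_lt] at hf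
    refine lt_of_le_of_lt ?_ hf
    rw [← Set.ncard_image_of_injective _ hx]
    classical
    refine le_trans ?_ (Polynomial.card_roots' f)
    refine le_trans ?_ (Multiset.toFinset_card_le _)
    rw [← Set.ncard_coe_finset]
    refine Set.ncard_le_ncard ?_ (Finset.finite_toSet _)
    rintro _ ⟨i, hi, rfl⟩
    simpa [hf0] using hi
  omega

theorem rsCode_support [Finite ι] {x : ι → F} (hx : Function.Injective x) {k : ℕ} {c : ι → F}
    (hc : c ∈ rsCode x k) (hc0 : c ≠ 0) : Nat.card ι < Set.ncard {i | c i ≠ 0} + k := by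
  obtain ⟨f, hf, hfc⟩ := mem_rsCode.1 hc
  have h0 : f ≠ 0 := by
    rintro rfl
    exact hc0 (funext fun i => by simp [← hfc i])
  simpa [hfc] using card_lt_ncard_support_add hx h0 hf

/-- A strict inequality between integers gains 1, which pays exactly for rounding rN up, so no error
term appears. -/
theorem one_sub_mul_card_le {N k : ℕ} {r : ℝ} (hr0 : 0 ≤ r) (h : N < k + ⌈r * N⌉₊) :
    (1 - r) * N ≤ k := by
  have h1 : (⌈r * N⌉₊ : ℝ) < r * N + 1 := Nat.ceil_lt_add_one (by positivity)
  have h2 : (N : ℝ) + 1 ≤ k + ⌈r * N⌉₊ := by exact_mod_cast h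
  linarith

theorem rsCode_support_ge [Finite ι] {x : ι → F} (hx : Function.Injective x) {r : ℝ} (hr0 : 0 ≤ r)
    {c : ι → F} (hc : c ∈ rsCode x ⌈r * Nat.card ι⌉₊) (hc0 : c ≠ 0) :
    (1 - r) * Nat.card ι ≤ Set.ncard {i | c i ≠ 0} :=
  one_sub_mul_card_le hr0 (rsCode_support hx hc hc0)

theorem rate_rsCode_le [Finite ι] [Nonempty ι] (x : ι → F) {r ε : ℝ} (hr0 : 0 ≤ r)
    (hε : 1 ≤ ε * Nat.card ι) : rate (rsCode x ⌈r * Nat.card ι⌉₊) ≤ r + ε := by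
  have h0 : (0 : ℝ) < Nat.card ι := by exact_mod_cast Nat.card_pos
  rw [rate, div_le_iff₀ h0]
  have h1 : (⌈r * Nat.card ι⌉₊ : ℝ) < r * Nat.card ι + 1 := Nat.ceil_lt_add_one (by positivity)
  have h2 : (Module.finrank F (rsCode x ⌈r * Nat.card ι⌉₊) : ℝ) ≤ ⌈r * Nat.card ι⌉₊ := by
    exact_mod_cast finrank_rsCode_le x _
  linarith

theorem le_relDist [Finite ι] [Nonempty ι] {C : Submodule F (ι → F)} {δ : ℝ}
    (hC : ∃ c ∈ C, c ≠ 0)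
    (h : ∀ c ∈ C, c ≠ 0 → δ * Nat.card ι ≤ Set.ncard {i | c i ≠ 0}) : δ ≤ relDist C := by
  have h0 : (0 : ℝ) < Nat.card ι := by exact_mod_cast Nat.card_pos
  rw [relDist, le_div_iff₀ h0]
  refine (Nat.le_ceil _).trans ?_
  exact_mod_cast le_minDist hC fun c hc hc0 => Nat.ceil_le.2 (h c hc hc0)

theorem one_mem_rsCode (x : ι → F) {k : ℕ} (hk : 0 < k) : (1 : ι → F) ∈ rsCode x k :=
  mem_rsCode.2 ⟨1, by simpa using hk, by simp⟩

theorem relDist_rsCode_ge [Finite ι] [Nonempty ι] {x : ι → F} (hx : Function.Injective x) {r : ℝ}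
    (hr0 : 0 < r) : 1 - r ≤ relDist (rsCode x ⌈r * Nat.card ι⌉₊) := by
  have h0 : (0 : ℝ) < Nat.card ι := by exact_mod_cast Nat.card_pos
  refine le_relDist ⟨1, one_mem_rsCode x (Nat.ceil_pos.2 (by positivity)), one_ne_zero⟩ ?_
  exact fun c hc hc0 => rsCode_support_ge hx hr0.le hc hc0

end CodeBounds

/-! ### Base degree versus degree on the fibres of u -/

section BaseExpansionOnFibres

variable {F : Type*} [Field F]

theorem degree_div_lt_sub {u f : F[X]} (hu : 0 < u.degree) {i : ℕ}
    (hf : f.degree < ((i + 1) * u.natDegree : ℕ)) : (f / u).degree < (i * u.natDegree : ℕ) := by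
  have hu0 : u ≠ 0 := ne_zero_of_degree_gt hu
  have hun : 0 < u.natDegree := natDegree_pos_iff_degree_pos.2 hu
  by_cases h : u.degree ≤ f.degree
  · have h1 := degree_add_div hu0 h
    have hf0 : f ≠ 0 := by
      rintro rfl
      simp at h
      exact hu0 h
    have h2 : f / u ≠ 0 := by
      intro h2
      rw [h2, degree_zero, WithBot.add_bot] at h1
      exact hf0 (degree_eq_bot.1 h1.symm)
    rw [degree_eq_natDegree hf0] at hf
    rw [degree_eq_natDegree hf0, degree_eq_natDegree h2, degree_eq_natDegree hu0] at h1
    rw [degree_eq_natDegree h2]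
    norm_cast at h1 hf ⊢
    rw [add_mul, one_mul] at hf
    omega
  · rw [(Polynomial.div_eq_zero_iff hu0).2 (not_le.1 h), degree_zero]
    exact WithBot.bot_lt_coe _

/-- Each division by u lowers the degree bound by deg u, not just by 1; this sharpens
`baseCoeff_eq_zero` and makes the number of digits match the number of fibres. -/
theorem baseCoeff_eq_zero_of_degree_lt {u : F[X]} (hu : 0 < u.degree) {i : ℕ} {f : F[X]}
    (hf : f.degree < (i * u.natDegree : ℕ)) : baseCoeff u i f = 0 := by
  induction i generalizing f with
  | zero =>
    have : f = 0 := by simpa using hf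
    subst this
    exact baseCoeff_zero_right u 0
  | succ i ih => exact ih (degree_div_lt_sub hu hf)

theorem degree_sum_lt {ι : Type*} {s : Finset ι} {f : ι → F[X]} {k : ℕ}
    (h : ∀ i ∈ s, (f i).degree < k) : (∑ i ∈ s, f i).degree < k :=
  mem_degreeLT.1 (Submodule.sum_mem _ fun i hi => mem_degreeLT.2 (h i hi))

/-- The polynomial of degree less than `deg u` that agrees with `f` wherever `u` takes the
value `y`. -/
noncomputable def restrictFibre (u f : F[X]) (y : F) (n : ℕ) : F[X] :=
  ∑ i ∈ Finset.range n, C (y ^ i) * baseCoeff u i f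

theorem eval_restrictFibre {u f : F[X]} (hu : 0 < u.degree) {n : ℕ} (hf : f.degree < n) (x : F) :
    (restrictFibre u f (u.eval x) n).eval x = f.eval x := by
  conv_rhs => rw [← sum_baseCoeff hu f n hf]
  simp [restrictFibre, eval_finsetSum, mul_comm]

theorem degree_restrictFibre_lt {u f : F[X]} {y : F} {n k : ℕ}
    (h : ∀ i, (baseCoeff u i f).degree < k) : (restrictFibre u f y n).degree < k := by
  refine degree_sum_lt fun i _ => ?_
  rw [← smul_eq_C_mul]
  exact (degree_smul_le _ _).trans_lt (h i)

variable {E L : Type*} {x : E → F} {l : E → L} {u : F[X]}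

/-- On a fibre u has a single value y, so f agrees there with ∑ yⁱ cᵢ, whose degree is bounded by
that of the digits. -/
theorem mem_rsCode_fibre (hu : 0 < u.degree)
    (hl : ∀ e e', l e = l e' → u.eval (x e) = u.eval (x e')) {f : F[X]} {k : ℕ}
    (hf : baseDegree u f < k) (v : L) :
    (fun e : {e : E // l e = v} => f.eval (x e)) ∈ rsCode (fun e : {e : E // l e = v} => x e) k := by
  rcases isEmpty_or_nonempty {e : E // l e = v} with h | ⟨⟨e₀, he₀⟩⟩
  · convert Submodule.zero_mem _
  have hfn : f.degree < (f.natDegree + 1 : ℕ) :=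
    degree_le_natDegree.trans_lt (by exact_mod_cast Nat.lt_succ_self _)
  refine mem_rsCode.2 ⟨restrictFibre u f (u.eval (x e₀)) (f.natDegree + 1),
    degree_restrictFibre_lt ((baseDegree_lt_iff hu f k).1 hf), ?_⟩
  rintro ⟨e, he⟩
  rw [hl e₀ e (he₀.trans he.symm)]
  exact eval_restrictFibre hu hfn (x e)

/-- If a polynomial of degree less than the number of points restricts on every fibre to a
polynomial of degree less than `k`, then its base degree is less than `k`. -/
theorem baseDegree_lt_of_fibres [Finite E] (hu : 0 < u.degree) (hx : Function.Injective x)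
    (hl : ∀ e e', l e = l e' → u.eval (x e) = u.eval (x e'))
    (hsurj : Function.Surjective l)
    (hcard : ∀ v, Nat.card {e // l e = v} = u.natDegree)
    {f : F[X]} (hf : f.degree < Nat.card E) {k : ℕ} (hk : k ≤ u.natDegree)
    (h : ∀ v, (fun e : {e : E // l e = v} => f.eval (x e)) ∈ rsCode (fun e : {e : E // l e = v} => x e) k) :
    baseDegree u f < k := by
  classical
  have hu0 : u ≠ 0 := ne_zero_of_degree_gt hu
  have hun : 0 < u.natDegree := natDegree_pos_iff_degree_pos.2 hu
  have : Finite L := Finite.of_surjective l hsurj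
  have := Fintype.ofFinite L
  have := Fintype.ofFinite E
  have hE : Nat.card E = Nat.card L * u.natDegree := by
    rw [Nat.card_congr (Equiv.sigmaFiberEquiv l).symm, Nat.card_sigma, Finset.sum_congr rfl fun v _ => hcard v]
    simp
  obtain ⟨s, hs⟩ := hsurj.hasRightInverse
  have hval : ∀ e, u.eval (x e) = u.eval (x (s (l e))) := fun e => hl _ _ (hs (l e)).symm
  -- If two fibres had the same value y, then u - y would have 2 deg u roots.
  have hy : Function.Injective fun v => u.eval (x (s v)) := by
    intro v w hvw
    by_contra hne
    set y := u.eval (x (s v)) with hydef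
    have hd0 : (u - C y).degree = u.degree := degree_sub_C hu
    have hnd : (u - C y).natDegree = u.natDegree := natDegree_sub_C
    have h0 : u - C y ≠ 0 := ne_zero_of_degree_gt (hd0 ▸ hu)
    have h1 := card_lt_ncard_support_add (ι := {e // l e = v} ⊕ {e // l e = w})
      (x := fun e => x (Sum.elim Subtype.val Subtype.val e)) ?_ h0
      (k := u.natDegree + 1) (by
        rw [hd0, degree_eq_natDegree hu0]; exact_mod_cast Nat.lt_succ_self _)
    · rw [Nat.card_sum, hcard, hcard] at h1
      have h2 : {e : {e // l e = v} ⊕ {e // l e = w} |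
          (u - C y).eval (x (Sum.elim Subtype.val Subtype.val e)) ≠ 0} = ∅ := by
        ext e
        rcases e with ⟨e, rfl⟩ | ⟨e, rfl⟩
        · simp [hydef, hval e]
        · simp only [Sum.elim_inr, Set.mem_ofPred_eq, Set.mem_empty_iff_false, iff_false, not_not,
            eval_sub, eval_C, hval e]
          exact sub_eq_zero.2 hvw.symm
      rw [h2, Set.ncard_empty] at h1
      omega
    · refine hx.comp ?_
      rintro (⟨e, he⟩ | ⟨e, he⟩) (⟨e', he'⟩ | ⟨e', he'⟩) hee
      all_goals simp only [Sum.elim_inl, Sum.elim_inr] at hee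
      all_goals subst hee
      · rfl
      · exact absurd (he.symm.trans he') hne
      · exact absurd (he'.symm.trans he) hne
      · rfl
  set M := Nat.card L with hM
  -- Since deg f < |L| deg u, only the digits of index below |L| survive.
  have hcoeff : ∀ i, M ≤ i → baseCoeff u i f = 0 := fun i hi =>
    baseCoeff_eq_zero_of_degree_lt hu (hf.trans_le (by
      rw [hE]; exact_mod_cast Nat.mul_le_mul_right _ hi))
  have hsum : ∀ z, (restrictFibre u f (u.eval z) M).eval z = f.eval z := by
    intro z
    have h1 : f.degree < (M * u.natDegree : ℕ) := by rwa [← hE]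
    have h2 : f.degree < (M * u.natDegree : ℕ) := h1
    rw [← eval_restrictFibre hu h2 z]
    congr 1
    refine Finset.sum_subset (Finset.range_mono (Nat.le_mul_of_pos_right _ hun)) ?_
    intro i _ hi
    rw [hcoeff i (by simpa using hi), mul_zero]
  have hdeg : ∀ v, (restrictFibre u f (u.eval (x (s v))) M).degree < k := by
    intro v
    obtain ⟨R, hR, hRf⟩ := mem_rsCode.1 (h v)
    have hP : (restrictFibre u f (u.eval (x (s v))) M).degree < u.natDegree :=
      degree_restrictFibre_lt fun i => by
        rw [← degree_eq_natDegree hu0]; exact degree_baseCoeff_lt hu0 i f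
    -- Both polynomials have degree less than deg u and agree on the deg u points of the fibre, so
    -- they coincide.
    suffices restrictFibre u f (u.eval (x (s v))) M = R by rw [this]; exact hR
    by_contra hne
    have h1 := card_lt_ncard_support_add (ι := {e // l e = v}) (x := fun e => x e)
      (hx.comp Subtype.val_injective) (sub_ne_zero.2 hne) (k := u.natDegree)
      ((degree_sub_le _ _).trans_lt (max_lt hP (hR.trans_le (by exact_mod_cast hk))))
    have h2 : {e : {e // l e = v} |
        (restrictFibre u f (u.eval (x (s v))) M - R).eval (x e) ≠ 0} = ∅ := by
      ext ⟨e, rfl⟩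
      have h3 := hRf ⟨e, rfl⟩
      simp only at h3
      simp only [Set.mem_ofPred_eq, Set.mem_empty_iff_false, iff_false, not_not, eval_sub]
      rw [h3, ← hval e, hsum, sub_self]
    rw [h2, Set.ncard_empty, hcard] at h1
    omega
  rw [baseDegree_lt_iff hu]
  intro i
  rw [degree_lt_iff_coeff_zero]
  intro j hj
  rcases le_or_gt M i with hi | hi
  · simp [hcoeff i hi]
  -- For fixed j ≥ k, the j-th coefficients of the digits form a polynomial of degree less than |L|;
  -- it vanishes at the |L| distinct values of u on the fibres.
  set q : F[X] := ∑ i ∈ Finset.range M, C ((baseCoeff u i f).coeff j) * X ^ i with hq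
  have hqc : ∀ i < M, q.coeff i = (baseCoeff u i f).coeff j := by
    intro i hi
    simp [hq, coeff_C_mul, coeff_X_pow, hi]
  have hq0 : q = 0 := by
    by_contra hne
    have h1 := card_lt_ncard_support_add hy hne (k := M) (by
      refine degree_sum_lt fun i hi => ?_
      exact (degree_C_mul_X_pow_le _ _).trans_lt (by exact_mod_cast Finset.mem_range.1 hi))
    have h2 : {v | q.eval (u.eval (x (s v))) ≠ 0} = ∅ := by
      ext v
      simp only [Set.mem_ofPred_eq, Set.mem_empty_iff_false, iff_false, not_not]
      have h3 := (degree_lt_iff_coeff_zero _ _).1 (hdeg v) j hj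
      rw [restrictFibre, finsetSum_coeff] at h3
      rw [← h3, hq, eval_finsetSum]
      exact Finset.sum_congr rfl fun i _ => by rw [eval_C_mul, eval_pow, eval_X, coeff_C_mul, mul_comm]
    rw [h2, Set.ncard_empty] at h1
    omega
  rw [← hqc i hi, hq0, coeff_zero]

end BaseExpansionOnFibres

/-! ### The second singular value by a min-max argument -/

section SingularValue

variable {X Y : Type*} [NormedAddCommGroup X] [InnerProductSpace ℝ X] [FiniteDimensional ℝ X]
  [NormedAddCommGroup Y] [InnerProductSpace ℝ Y] [FiniteDimensional ℝ Y]

/-- If `T` has norm at most `σ` on the kernel of a functional, then its second largest singular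
value is at most `σ`. -/
theorem singularValues_one_le (T : X →ₗ[ℝ] Y) (φ : X →ₗ[ℝ] ℝ) {σ : ℝ} (hσ : 0 ≤ σ)
    (h : ∀ x, φ x = 0 → ‖T x‖ ^ 2 ≤ σ ^ 2 * ‖x‖ ^ 2) : T.singularValues 1 ≤ σ := by
  by_cases hn : Module.finrank ℝ X ≤ 1
  · rw [T.singularValues_of_finrank_le hn]
    exact hσ
  push Not at hn
  have hT := T.isSymmetric_adjoint_comp_self
  set b := hT.eigenvectorBasis rfl
  set i0 : Fin (Module.finrank ℝ X) := ⟨0, by omega⟩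
  set i1 : Fin (Module.finrank ℝ X) := ⟨1, hn⟩
  have hne : i0 ≠ i1 := by simp [i0, i1]
  have hle : hT.eigenvalues rfl i1 ≤ hT.eigenvalues rfl i0 :=
    hT.eigenvalues_antitone rfl (by simp [i0, i1, Fin.le_def])
  -- Courant–Fischer: the span of the top two eigenvectors of T*T meets the hyperplane ker φ, and
  -- the Rayleigh quotient on this span is at least the second eigenvalue.
  obtain ⟨c0, c1, hc, hφ⟩ : ∃ c0 c1 : ℝ, 0 < c0 ^ 2 + c1 ^ 2 ∧ c0 * φ (b i0) + c1 * φ (b i1) = 0 := by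
    by_cases h0 : φ (b i1) = 0
    · exact ⟨0, 1, by norm_num, by simp [h0]⟩
    · exact ⟨φ (b i1), -φ (b i0), by positivity, by ring⟩
  set x := c0 • b i0 + c1 • b i1
  have hb0 : inner ℝ (b i0) (b i0) = (1 : ℝ) := by simp
  have hb1 : inner ℝ (b i1) (b i1) = (1 : ℝ) := by simp
  have hb01 : inner ℝ (b i0) (b i1) = (0 : ℝ) := b.orthonormal.2 hne
  have hb10 : inner ℝ (b i1) (b i0) = (0 : ℝ) := b.orthonormal.2 hne.symm
  have hx : ‖x‖ ^ 2 = c0 ^ 2 + c1 ^ 2 := by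
    rw [← real_inner_self_eq_norm_sq]
    simp only [x, inner_add_left, inner_add_right, real_inner_smul_left, real_inner_smul_right, hb0,
      hb1, hb01, hb10]
    ring
  have hTb : ∀ i, T.adjoint (T (b i)) = hT.eigenvalues rfl i • b i := fun i =>
    hT.apply_eigenvectorBasis rfl i
  have hTx : ‖T x‖ ^ 2 = hT.eigenvalues rfl i0 * c0 ^ 2 + hT.eigenvalues rfl i1 * c1 ^ 2 := by
    rw [← real_inner_self_eq_norm_sq, ← LinearMap.adjoint_inner_right]
    simp only [x, map_add, map_smul, hTb]
    simp only [inner_add_left, inner_add_right, real_inner_smul_left, real_inner_smul_right, hb0,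
      hb1, hb01, hb10]
    ring
  have h1 := h x (by simpa [x] using hφ)
  rw [hx, hTx] at h1
  have h2 : T.singularValues 1 ^ 2 = hT.eigenvalues rfl i1 := T.sq_singularValues_of_lt rfl hn
  have h3 : hT.eigenvalues rfl i1 * (c0 ^ 2 + c1 ^ 2) ≤ σ ^ 2 * (c0 ^ 2 + c1 ^ 2) := by
    nlinarith [mul_le_mul_of_nonneg_right hle (sq_nonneg c0)]
  exact le_of_sq_le_sq (h2 ▸ le_of_mul_le_mul_right h3 hc) hσ

end SingularValue

/-! ### Expander mixing in biregular multigraphs -/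

section Expander

variable {E L R : Type*} [Fintype E] [Fintype R] [DecidableEq L] {l : E → L} {r : E → R}

theorem biadj_mulVec (f : R → ℝ) (u : L) :
    (biadj l r).mulVec f u = ∑ e with l e = u, f (r e) := by
  classical
  rw [Matrix.mulVec, dotProduct, ← Finset.sum_fiberwise (s := {e | l e = u}) (g := r)]
  refine Finset.sum_congr rfl fun v _ => ?_
  have h1 : ∀ e ∈ ({e | l e = u} : Finset E).filter (r · = v), f (r e) = f v := by
    intro e he
    rw [(Finset.mem_filter.1 he).2]
  rw [Finset.sum_congr rfl h1, Finset.sum_const, nsmul_eq_mul, biadj, Nat.card_eq_fintype_card,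
    Fintype.card_subtype, Finset.filter_filter]

variable [Fintype L]

/-- The bi-adjacency operator of the bipartite multigraph is bounded by `σ √(dL dR)` on the
functions of mean zero. -/
def IsExpander (l : E → L) (r : E → R) (dL dR : ℕ) (σ : ℝ) : Prop :=
  ∀ f : R → ℝ, ∑ v, f v = 0 →
    ∑ u, (∑ e with l e = u, f (r e)) ^ 2 ≤ σ ^ 2 * (dL * dR) * ∑ v, f v ^ 2

theorem IsExpander.sigmaTwo_le {dL dR : ℕ} {σ : ℝ} (h : IsExpander l r dL dR σ) (hσ : 0 ≤ σ)
    (hL : 0 < dL) (hR : 0 < dR) : sigmaTwo l r dL dR ≤ σ := by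
  classical
  refine singularValues_one_le _ ((∑ v : R, LinearMap.proj v) ∘ₗ
    (WithLp.linearEquiv 2 ℝ (R → ℝ)).toLinearMap) hσ fun x hx => ?_
  have hx' : ∑ v, x v = 0 := by simpa using hx
  have h1 := h x hx'
  have hd : (0 : ℝ) < dL * dR := by positivity
  have h2 : ∀ u, biadjOp l r dL dR x u = (1 / √((dL : ℝ) * dR)) * ∑ e with l e = u, x (r e) := by
    intro u
    rw [← biadj_mulVec]
    simp [biadjOp, Matrix.toLpLin_apply]
  rw [EuclideanSpace.norm_sq_eq, EuclideanSpace.norm_sq_eq]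
  simp only [h2, Real.norm_eq_abs, sq_abs, mul_pow, ← Finset.mul_sum, div_pow, one_pow,
    Real.sq_sqrt hd.le]
  rw [one_div, inv_mul_le_iff₀ hd]
  linarith

/-- The expander bound on the number of edges of a subgraph of large minimum degree. -/
theorem IsExpander.le_card_edges [DecidableEq R] {dL dR : ℕ} {σ : ℝ} (h : IsExpander l r dL dR σ)
    (hσ : 0 ≤ σ) (hR : ∀ v, Finset.card {e | r e = v} = dR)
    (hL : ∀ u, Finset.card {e | l e = u} = dL) {δ : ℝ} (hδ : 0 < δ)
    {S : Finset E} (hS : S.Nonempty)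
    (hSL : ∀ e ∈ S, δ * dL ≤ Finset.card {e' ∈ S | l e' = l e})
    (hSR : ∀ e ∈ S, δ * dR ≤ Finset.card {e' ∈ S | r e' = r e}) :
    (δ ^ 2 - σ * δ) * Fintype.card E ≤ S.card := by
  classical
  -- A and B are the vertices touched by S. The degree hypotheses bound |A| and |B| above by |S|/(δ
  -- dL) and |S|/(δ dR), while the mixing bound on the edges between A and B bounds |S| above;
  -- comparing the two forces S to be large.
  set A := S.image l
  set B := S.image r
  have hA : δ * (dL * A.card) ≤ S.card := by
    rw [Finset.card_eq_sum_card_image l S, Nat.cast_sum]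
    have : ∑ u ∈ A, δ * dL ≤ ∑ u ∈ A, (Finset.card {e' ∈ S | l e' = u} : ℝ) :=
      Finset.sum_le_sum fun u hu => by
        obtain ⟨e, he, rfl⟩ := Finset.mem_image.1 hu
        exact hSL e he
    rw [Finset.sum_const, nsmul_eq_mul] at this
    linarith
  have hB : δ * (dR * B.card) ≤ S.card := by
    rw [Finset.card_eq_sum_card_image r S, Nat.cast_sum]
    have : ∑ u ∈ B, δ * dR ≤ ∑ u ∈ B, (Finset.card {e' ∈ S | r e' = u} : ℝ) :=
      Finset.sum_le_sum fun u hu => by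
        obtain ⟨e, he, rfl⟩ := Finset.mem_image.1 hu
        exact hSR e he
    rw [Finset.sum_const, nsmul_eq_mul] at this
    linarith
  have hE : Fintype.card E = Fintype.card R * dR := by
    rw [← Finset.card_univ, Finset.card_eq_sum_card_fiberwise (f := r) (t := Finset.univ) (by simp)]
    simp [hR]
  obtain ⟨e₀, he₀⟩ := hS
  have hS0 : (0 : ℝ) < S.card := by exact_mod_cast Finset.card_pos.2 ⟨e₀, he₀⟩
  have hE0 : (0 : ℝ) < Fintype.card E := by exact_mod_cast Fintype.card_pos_iff.2 ⟨e₀⟩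
  have hE' : (Fintype.card E : ℝ) = Fintype.card R * dR := by exact_mod_cast hE
  have hR0 : (0 : ℝ) < Fintype.card R := by exact_mod_cast Fintype.card_pos_iff.2 ⟨r e₀⟩
  set β : ℝ := B.card / Fintype.card R
  -- The indicator of B with its mean β removed, so that the expander hypothesis applies.
  set f : R → ℝ := fun v => (if v ∈ B then 1 else 0) - β
  have hind : ∑ v, (if v ∈ B then 1 else 0 : ℝ) = B.card := by simp
  have hf0 : ∑ v, f v = 0 := by
    simp only [f, Finset.sum_sub_distrib, hind, Finset.sum_const, nsmul_eq_mul, Finset.card_univ, β]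
    field_simp
    ring
  have hf2 : ∑ v, f v ^ 2 ≤ B.card := by
    have h1 : ∀ v, f v ^ 2 = (if v ∈ B then 1 else 0) - β * (f v) - β * (if v ∈ B then 1 else 0) := by
      intro v
      simp only [f]
      split_ifs <;> ring
    simp only [h1, Finset.sum_sub_distrib, ← Finset.mul_sum, hf0, hind]
    have : 0 ≤ β * B.card := by positivity
    linarith
  set g : L → ℝ := fun u => ∑ e with l e = u, f (r e)
  have hg : ∀ u, ∑ e with l e = u, (if r e ∈ B then 1 else 0 : ℝ) = g u + dL * β := by
    intro u
    simp only [g, f, Finset.sum_sub_distrib, Finset.sum_const, nsmul_eq_mul, hL]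
    ring
  have hSle : (S.card : ℝ) ≤ ∑ u ∈ A, (g u + dL * β) := by
    simp only [← hg]
    rw [Finset.card_eq_sum_card_image l S, Nat.cast_sum]
    refine Finset.sum_le_sum fun u _ => ?_
    rw [Finset.sum_boole, Finset.filter_filter]
    norm_cast
    refine Finset.card_le_card fun e he => ?_
    rw [Finset.mem_filter] at he
    simpa [he.2, B] using ⟨e, he.1, rfl⟩
  rw [Finset.sum_add_distrib, Finset.sum_const, nsmul_eq_mul] at hSle
  -- Cauchy–Schwarz over A, then the expander bound for f.
  have hg2 : (∑ u ∈ A, g u) ^ 2 ≤ A.card * (σ ^ 2 * (dL * dR) * B.card) := by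
    refine sq_sum_le_card_mul_sum_sq.trans (mul_le_mul_of_nonneg_left ?_ (by positivity))
    refine (Finset.sum_le_univ_sum_of_nonneg fun u => sq_nonneg _).trans ((h f hf0).trans ?_)
    exact mul_le_mul_of_nonneg_left hf2 (by positivity)
  have hAB : (δ * (dL * A.card)) * (δ * (dR * B.card)) ≤ S.card * S.card :=
    mul_le_mul hA hB (by positivity) (by positivity)
  have hg3 : δ * ∑ u ∈ A, g u ≤ σ * S.card := by
    refine le_of_sq_le_sq ?_ (by positivity)
    calc (δ * ∑ u ∈ A, g u) ^ 2 = δ ^ 2 * (∑ u ∈ A, g u) ^ 2 := by ring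
      _ ≤ δ ^ 2 * (A.card * (σ ^ 2 * (dL * dR) * B.card)) := by gcongr
      _ = σ ^ 2 * ((δ * (dL * A.card)) * (δ * (dR * B.card))) := by ring
      _ ≤ σ ^ 2 * (S.card * S.card) := by gcongr
      _ = (σ * S.card) ^ 2 := by ring
  have hβ : δ ^ 2 * (A.card * (dL * β)) * Fintype.card E ≤ S.card * S.card := by
    refine le_trans (le_of_eq ?_) hAB
    rw [hE']
    simp only [β]
    field_simp
  have hfin : (δ ^ 2 - σ * δ) * Fintype.card E * S.card ≤ S.card * S.card := by
    have h1 : δ ^ 2 * S.card ≤ σ * S.card * δ + δ ^ 2 * (A.card * (dL * β)) := by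
      nlinarith [mul_le_mul_of_nonneg_left hSle (sq_nonneg δ), mul_le_mul_of_nonneg_left hg3 hδ.le]
    nlinarith [mul_le_mul_of_nonneg_right h1 hE0.le]
  exact le_of_mul_le_mul_right hfin hS0

end Expander

/-! ### Autocorrelations on a finite abelian group -/

section Fourier

variable {W : Type*} [AddCommGroup W] [Fintype W]

/-- Expand |f̂(χ)|² as a double sum over s and t; summing over χ, orthogonality keeps only t = s +
x. -/
theorem card_mul_autocorrelation (f : W → ℝ) (x : W) :
    ((Fintype.card W * ∑ s, f s * f (s + x) : ℝ) : ℂ) =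
      ∑ χ : AddChar W ℂ, ((‖∑ s, (f s : ℂ) * χ s‖ ^ 2 : ℝ) : ℂ) * χ x := by
  classical
  have h1 : ∀ χ : AddChar W ℂ, ((‖∑ s, (f s : ℂ) * χ s‖ ^ 2 : ℝ) : ℂ) * χ x =
      ∑ s, ∑ t, ((f s : ℂ) * f t) * χ (s - t + x) := by
    intro χ
    rw [← Complex.normSq_eq_norm_sq, ← Complex.mul_conj, map_sum, Finset.sum_mul_sum,
      Finset.sum_mul]
    refine Finset.sum_congr rfl fun s _ => ?_
    rw [Finset.sum_mul]
    refine Finset.sum_congr rfl fun t _ => ?_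
    rw [map_mul, Complex.conj_ofReal, ← AddChar.map_neg_eq_conj, AddChar.map_add_eq_mul, sub_eq_add_neg,
      AddChar.map_add_eq_mul]
    ring
  simp only [h1]
  rw [Finset.sum_comm]
  push_cast
  rw [Finset.mul_sum]
  refine Finset.sum_congr rfl fun s _ => ?_
  rw [Finset.sum_comm]
  simp only [← Finset.mul_sum, AddChar.sum_apply_eq_ite]
  rw [Finset.sum_eq_single (s + x)]
  · simp
    ring
  · intro t _ ht
    rw [if_neg, mul_zero]
    intro h
    apply ht
    rw [sub_add_eq_add_sub, sub_eq_zero] at h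
    exact h.symm
  · simp

/-- Autocorrelation bound for a function of mean zero, from a bound on nontrivial character
sums over the shifts. -/
theorem sum_autocorrelation_le {T : Type*} [Fintype T] (y : T → W) {M : ℝ}
    (hy : ∀ χ : AddChar W ℂ, χ ≠ 0 → ‖∑ t, χ (y t)‖ ≤ M) (f : W → ℝ) (hf : ∑ s, f s = 0) :
    ∑ t, ∑ s, f s * f (s + y t) ≤ M * ∑ s, f s ^ 2 := by
  have hW : (0 : ℝ) < Fintype.card W := by exact_mod_cast Fintype.card_pos
  refine le_of_mul_le_mul_left ?_ hW
  refine (le_abs_self _).trans ?_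
  rw [Finset.mul_sum, ← Real.norm_eq_abs, ← Complex.norm_real, Complex.ofReal_sum]
  simp only [card_mul_autocorrelation]
  rw [Finset.sum_comm]
  simp only [← Finset.mul_sum]
  -- Parseval, as the autocorrelation at shift 0.
  have h0 : ((Fintype.card W * ∑ s, f s ^ 2 : ℝ) : ℂ) =
      ((∑ χ : AddChar W ℂ, ‖∑ s, (f s : ℂ) * χ s‖ ^ 2 : ℝ) : ℂ) := by
    have := card_mul_autocorrelation f 0
    simp only [add_zero, AddChar.map_zero_eq_one, mul_one] at this
    rw [Complex.ofReal_sum, ← this]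
    simp only [sq]
  have h1 := Complex.ofReal_injective h0
  calc _ ≤ ∑ χ : AddChar W ℂ, ‖∑ s, (f s : ℂ) * χ s‖ ^ 2 * M := by
        refine (norm_sum_le _ _).trans (Finset.sum_le_sum fun χ _ => ?_)
        rw [norm_mul, Complex.norm_real, Real.norm_of_nonneg (by positivity)]
        by_cases hχ : χ = 0
        · subst hχ
          have : ∑ s, (f s : ℂ) * (0 : AddChar W ℂ) s = 0 := by
            simp only [AddChar.zero_apply, mul_one]
            rw [← Complex.ofReal_sum, hf, Complex.ofReal_zero]
          rw [this]
          simp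
        · exact mul_le_mul_of_nonneg_left (hy χ hχ) (by positivity)
    _ = Fintype.card W * (M * ∑ s, f s ^ 2) := by
        rw [← Finset.sum_mul, ← h1]
        ring

end Fourier

/-! ### Elements and cosets of the group A -/

section AffineGroup

variable {F : Type*} [Field F]

/-- The affine bijection `x ↦ v x + w`. -/
noncomputable def affine (v : Fˣ) (w : F) : F ≃ᵃ[F] F :=
  AffineEquiv.constVAdd F F w * AffineEquiv.homothetyUnitsMulHom (0 : F) v

@[simp] theorem affine_apply (v : Fˣ) (w x : F) : affine v w x = v * x + w := by
  simp [affine, AffineEquiv.mul_def, AffineMap.homothety_apply, add_comm]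

theorem affine_injective {v v' : Fˣ} {w w' : F} (h : affine v w = affine v' w') :
    v = v' ∧ w = w' := by
  have h0 : affine v w 0 = affine v' w' 0 := by rw [h]
  have h1 : affine v w 1 = affine v' w' 1 := by rw [h]
  simp only [affine_apply, mul_zero, zero_add, mul_one] at h0 h1
  subst h0
  exact ⟨Units.ext (add_right_cancel h1), rfl⟩

theorem affine_mul (v v' : Fˣ) (w w' : F) :
    affine v w * affine v' w' = affine (v * v') (v * w' + w) := by
  ext x
  rw [AffineEquiv.mul_def, AffineEquiv.trans_apply]
  simp only [affine_apply, Units.val_mul]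
  ring

theorem affine_one_zero : affine (1 : Fˣ) 0 = 1 := by
  ext x
  simp

theorem affine_inv (v : Fˣ) (w : F) :
    (affine v w)⁻¹ = affine v⁻¹ (-(((v⁻¹ : Fˣ) : F) * w)) := by
  rw [inv_eq_iff_mul_eq_one, affine_mul, ← affine_one_zero]
  congr 1
  · simp
  · simp

/-- `W` is stable under the scalings by `V` and generated by the products of elements of `V` and
elements of `U`. -/
structure IsProductSpan (U : AddSubgroup F) (V : Subgroup Fˣ) (W : AddSubgroup F) : Prop where
  scale_mem : ∀ v ∈ V, ∀ w ∈ W, (v : F) * w ∈ W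
  le : U ≤ W
  le_closure : W ≤ AddSubgroup.closure {x | ∃ v ∈ V, ∃ u ∈ U, x = (v : F) * u}

variable {U : AddSubgroup F} {V : Subgroup Fˣ} {W : AddSubgroup F}

theorem affine_one_mem {u : F} (hu : u ∈ U) : affine 1 u ∈ genGroup U V := by
  refine Subgroup.mem_sup_left ((mem_translations U _).2 ⟨u, hu, fun x => ?_⟩)
  simp

theorem affine_zero_mem {v : Fˣ} (hv : v ∈ V) : affine v 0 ∈ genGroup U V := by
  refine Subgroup.mem_sup_right ((mem_scalings V _).2 ⟨v, hv, fun x => ?_⟩)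
  simp

/-- Conjugating the translation by u with the scaling by v gives the translation by vu, and such
products generate W. -/
theorem IsProductSpan.affine_mem (h : IsProductSpan U V W) {v : Fˣ} {w : F} (hv : v ∈ V)
    (hw : w ∈ W) : affine v w ∈ genGroup U V := by
  have h1 : affine 1 w ∈ genGroup U V := by
    have hc := h.le_closure hw
    clear hw
    induction hc using AddSubgroup.closure_induction with
    | mem x hx =>
      obtain ⟨v, hv, u, hu, rfl⟩ := hx
      have : affine 1 (v * u) = affine v 0 * affine 1 u * (affine v 0)⁻¹ := by
        rw [affine_inv, affine_mul, affine_mul]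
        congr 1 <;> simp
      rw [this]
      exact mul_mem (mul_mem (affine_zero_mem hv) (affine_one_mem hu))
        (inv_mem (affine_zero_mem hv))
    | zero => rw [affine_one_zero]; exact one_mem _
    | add x y _ _ hx hy =>
      have : affine 1 (x + y) = affine 1 y * affine 1 x := by
        rw [affine_mul]
        congr 1 <;> simp
      rw [this]
      exact mul_mem hy hx
    | neg x _ hx =>
      have : affine 1 (-x) = (affine 1 x)⁻¹ := by
        rw [affine_inv]
        congr 1 <;> simp
      rw [this]
      exact inv_mem hx
  have : affine v w = affine 1 w * affine v 0 := by
    rw [affine_mul]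
    congr 1 <;> simp
  rw [this]
  exact mul_mem h1 (affine_zero_mem hv)

theorem IsProductSpan.mem_genGroup (h : IsProductSpan U V W) (φ : F ≃ᵃ[F] F) :
    φ ∈ genGroup U V ↔ ∃ v ∈ V, ∃ w ∈ W, φ = affine v w := by
  constructor
  · let K : Subgroup (F ≃ᵃ[F] F) :=
      { carrier := {φ | ∃ v ∈ V, ∃ w ∈ W, φ = affine v w}
        mul_mem' := by
          rintro _ _ ⟨v, hv, w, hw, rfl⟩ ⟨v', hv', w', hw', rfl⟩
          exact ⟨v * v', mul_mem hv hv', _, add_mem (h.scale_mem v hv w' hw') hw, affine_mul _ _ _ _⟩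
        one_mem' := ⟨1, one_mem _, 0, zero_mem _, affine_one_zero.symm⟩
        inv_mem' := by
          rintro _ ⟨v, hv, w, hw, rfl⟩
          exact ⟨v⁻¹, inv_mem hv, _, neg_mem (h.scale_mem _ (inv_mem hv) w hw), affine_inv _ _⟩ }
    suffices genGroup U V ≤ K from fun hφ => this hφ
    refine sup_le ?_ ?_
    · intro φ hφ
      obtain ⟨u, hu, hx⟩ := (mem_translations U φ).1 hφ
      exact ⟨1, one_mem _, u, h.le hu, by ext x; simp [hx]⟩
    · intro φ hφ
      obtain ⟨v, hv, hx⟩ := (mem_scalings V φ).1 hφ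
      exact ⟨v, hv, 0, zero_mem _, by ext x; simp [hx]⟩
  · rintro ⟨v, hv, w, hw, rfl⟩
    exact h.affine_mem hv hw

/-- The elements of `A` are the maps `x ↦ v x + w` with `v ∈ V` and `w ∈ W`. -/
noncomputable def IsProductSpan.equiv (h : IsProductSpan U V W) : V × W ≃ genGroup U V :=
  Equiv.ofBijective (fun z => ⟨affine (z.1 : Fˣ) (z.2 : F), h.affine_mem z.1.2 z.2.2⟩) <| by
    constructor
    · rintro ⟨v, w⟩ ⟨v', w'⟩ hz
      obtain ⟨h1, h2⟩ := affine_injective (Subtype.ext_iff.1 hz)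
      exact Prod.ext (Subtype.ext h1) (Subtype.ext h2)
    · rintro ⟨φ, hφ⟩
      obtain ⟨v, hv, w, hw, rfl⟩ := (h.mem_genGroup φ).1 hφ
      exact ⟨(⟨v, hv⟩, ⟨w, hw⟩), rfl⟩

theorem IsProductSpan.equiv_coe (h : IsProductSpan U V W) (z : V × W) :
    (h.equiv z : F ≃ᵃ[F] F) = affine (z.1 : Fˣ) (z.2 : F) := rfl

theorem IsProductSpan.card_genGroup (h : IsProductSpan U V W) :
    Nat.card (genGroup U V) = Nat.card W * Nat.card V := by
  rw [← Nat.card_congr h.equiv, Nat.card_prod, mul_comm]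

theorem leftEnd_surjective : Function.Surjective (leftEnd U V) := Quotient.mk_surjective

theorem rightEnd_surjective : Function.Surjective (rightEnd U V) := Quotient.mk_surjective

theorem affine_eq_of_div {v : Fˣ} {w : F} {φ ψ : F ≃ᵃ[F] F} (h : ∀ x, (ψ * φ⁻¹) x = v * x + w) :
    ψ = affine v w * φ := by
  rw [← mul_inv_eq_iff_eq_mul]
  ext x
  rw [h, affine_apply]

theorem leftEnd_eq_iff (φ ψ : genGroup U V) :
    leftEnd U V φ = leftEnd U V ψ ↔ ∃ u ∈ U, (ψ : F ≃ᵃ[F] F) = affine 1 u * φ := by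
  rw [leftEnd, leftEnd, Quotient.eq, QuotientGroup.rightRel_apply, Subgroup.mem_subgroupOf,
    mem_translations]
  refine exists_congr fun u => and_congr_right fun _ => ⟨fun h => ?_, fun h x => ?_⟩
  · exact affine_eq_of_div fun x => by simpa using h x
  · rw [Subgroup.coe_mul, Subgroup.coe_inv, h, mul_inv_cancel_right, affine_apply]
    simp

theorem rightEnd_eq_iff (φ ψ : genGroup U V) :
    rightEnd U V φ = rightEnd U V ψ ↔ ∃ v ∈ V, (ψ : F ≃ᵃ[F] F) = affine v 0 * φ := by
  rw [rightEnd, rightEnd, Quotient.eq, QuotientGroup.rightRel_apply, Subgroup.mem_subgroupOf,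
    mem_scalings]
  refine exists_congr fun u => and_congr_right fun _ => ⟨fun h => ?_, fun h x => ?_⟩
  · exact affine_eq_of_div fun x => by simpa using h x
  · rw [Subgroup.coe_mul, Subgroup.coe_inv, h, mul_inv_cancel_right, affine_apply]
    simp

/-- The edges at a left vertex. -/
noncomputable def leftFibreEquiv (φ : genGroup U V) :
    U ≃ {ψ : genGroup U V // leftEnd U V ψ = leftEnd U V φ} :=
  Equiv.ofBijective (fun u => ⟨⟨affine 1 (u : F), affine_one_mem u.2⟩ * φ,
    ((leftEnd_eq_iff _ _).2 ⟨(u : F), u.2, rfl⟩).symm⟩) <| by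
    constructor
    · intro u u' h
      have h1 := mul_right_cancel (Subtype.ext_iff.1 h)
      exact Subtype.ext (affine_injective (Subtype.ext_iff.1 h1)).2
    · rintro ⟨ψ, hψ⟩
      obtain ⟨u, hu, h⟩ := (leftEnd_eq_iff _ _).1 hψ.symm
      exact ⟨⟨u, hu⟩, Subtype.ext (Subtype.ext h.symm)⟩

/-- The edges at a right vertex. -/
noncomputable def rightFibreEquiv (φ : genGroup U V) :
    V ≃ {ψ : genGroup U V // rightEnd U V ψ = rightEnd U V φ} :=
  Equiv.ofBijective (fun v => ⟨⟨affine v 0, affine_zero_mem v.2⟩ * φ,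
    ((rightEnd_eq_iff _ _).2 ⟨(v : Fˣ), v.2, rfl⟩).symm⟩) <| by
    constructor
    · intro u u' h
      have h1 := mul_right_cancel (Subtype.ext_iff.1 h)
      exact Subtype.ext (affine_injective (Subtype.ext_iff.1 h1)).1
    · rintro ⟨ψ, hψ⟩
      obtain ⟨v, hv, h⟩ := (rightEnd_eq_iff _ _).1 hψ.symm
      exact ⟨⟨v, hv⟩, Subtype.ext (Subtype.ext h.symm)⟩

theorem card_leftEnd_fibre (v : LeftVertex U V) :
    Nat.card {φ // leftEnd U V φ = v} = Nat.card U := by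
  obtain ⟨φ, rfl⟩ := leftEnd_surjective v
  exact (Nat.card_congr (leftFibreEquiv φ)).symm

theorem card_rightEnd_fibre (v : RightVertex U V) :
    Nat.card {φ // rightEnd U V φ = v} = Nat.card V := by
  obtain ⟨φ, rfl⟩ := rightEnd_surjective v
  exact (Nat.card_congr (rightFibreEquiv φ)).symm

/-- The scaling of `W` by an element of `V`. -/
def IsProductSpan.scale (h : IsProductSpan U V W) (v : V) : W ≃ W where
  toFun w := ⟨((v : Fˣ) : F) * w, h.scale_mem v v.2 w w.2⟩
  invFun w := ⟨((v⁻¹ : Fˣ) : F) * w, h.scale_mem _ (inv_mem v.2) w w.2⟩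
  left_inv w := by simp
  right_inv w := by simp

end AffineGroup

/-! ### Spectral bound for the coset graph -/

section CosetGraph

variable {F : Type*} [Field F] {U : AddSubgroup F} {V : Subgroup Fˣ} {W : AddSubgroup F}

/-- Scaling x ↦ vx + w by v⁻¹ gives the translation by v⁻¹w: right vertices are represented by
elements of W. -/
theorem IsProductSpan.rightEnd_equiv (h : IsProductSpan U V W) (v : V) (w : W) :
    rightEnd U V (h.equiv (v, w)) = rightEnd U V (h.equiv (1, h.scale v⁻¹ w)) := by
  refine ((rightEnd_eq_iff _ _).2 ⟨(v : Fˣ), v.2, ?_⟩).symm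
  rw [h.equiv_coe, h.equiv_coe, affine_mul]
  congr 1
  · simp
  · simp [scale]

theorem IsProductSpan.translate_equiv (h : IsProductSpan U V W) (v : V) (w : W) (u : U) :
    (⟨affine 1 (u : F), affine_one_mem u.2⟩ : genGroup U V) * h.equiv (v, w) =
      h.equiv (v, w + ⟨u, h.le u.2⟩) := by
  refine Subtype.ext ?_
  rw [Subgroup.coe_mul, h.equiv_coe, h.equiv_coe, affine_mul]
  congr 1
  · simp
  · simp

theorem IsProductSpan.scale_add (h : IsProductSpan U V W) (v : V) (w w' : W) :
    h.scale v (w + w') = h.scale v w + h.scale v w' :=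
  Subtype.ext (mul_add _ _ _)

variable [Finite F]

/-- Both sides, multiplied by |V|, equal the sum over all edges: every vertex has |V| edges, and
scaling by v⁻¹ permutes W. -/
theorem IsProductSpan.sum_rightVertex [Fintype W] (h : IsProductSpan U V W)
    (g : RightVertex U V → ℝ) : ∑ y, g y = ∑ w : W, g (rightEnd U V (h.equiv (1, w))) := by
  classical
  have := Fintype.ofFinite V
  have := Fintype.ofFinite (genGroup U V)
  have h1 : ∑ φ, g (rightEnd U V φ) = Fintype.card V * ∑ y, g y := by
    rw [← Finset.sum_fiberwise (s := Finset.univ) (g := rightEnd U V), Finset.mul_sum]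
    refine Finset.sum_congr rfl fun y _ => ?_
    rw [Finset.sum_congr rfl (g := fun _ => g y) fun φ hφ => by rw [(Finset.mem_filter.1 hφ).2],
      Finset.sum_const, nsmul_eq_mul, ← Fintype.card_subtype, ← Nat.card_eq_fintype_card,
      card_rightEnd_fibre, Nat.card_eq_fintype_card]
  have h2 : ∑ φ, g (rightEnd U V φ) =
      Fintype.card V * ∑ w : W, g (rightEnd U V (h.equiv (1, w))) := by
    rw [← Equiv.sum_comp h.equiv, Fintype.sum_prod_type]
    rw [Finset.sum_congr rfl fun v _ => (Finset.sum_congr rfl fun w _ => by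
      rw [h.rightEnd_equiv]).trans (Equiv.sum_comp (h.scale v⁻¹)
      (fun w => g (rightEnd U V (h.equiv (1, w))))), Finset.sum_const, nsmul_eq_mul,
      Finset.card_univ]
  have h3 : (Fintype.card V : ℝ) ≠ 0 := by exact_mod_cast Fintype.card_ne_zero
  exact mul_left_cancel₀ h3 (h1.symm.trans h2)

/-- In the coordinates (v, w), the edge has right end v⁻¹w, and translating by u moves that end by
v⁻¹u. The quadratic form is thus a sum of autocorrelations at the shifts v⁻¹u, and only the
character sums over these shifts matter. -/
theorem IsProductSpan.isExpander [Fintype U] [Fintype V] [Fintype (genGroup U V)]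
    [DecidableEq (LeftVertex U V)] (h : IsProductSpan U V W) {M σ : ℝ}
    (hM : ∀ χ : AddChar W ℂ, χ ≠ 0 → ‖∑ u : U, ∑ v : V, χ (h.scale v ⟨u, h.le u.2⟩)‖ ≤ M)
    (hσ : M ≤ σ ^ 2 * (Nat.card U * Nat.card V)) :
    IsExpander (leftEnd U V) (rightEnd U V) (Nat.card U) (Nat.card V) σ := by
  classical
  intro f hf
  have := Fintype.ofFinite W
  set g : W → ℝ := fun w => f (rightEnd U V (h.equiv (1, w)))
  have hg0 : ∑ w, g w = 0 := by rw [← hf, h.sum_rightVertex]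
  have hg2 : ∑ y, f y ^ 2 = ∑ w, g w ^ 2 := h.sum_rightVertex fun y => f y ^ 2
  have hgr : ∀ v w, f (rightEnd U V (h.equiv (v, w))) = g (h.scale v⁻¹ w) := fun v w => by
    rw [h.rightEnd_equiv]
  have hfib : ∀ φ : genGroup U V, ∑ ψ with leftEnd U V ψ = leftEnd U V φ, f (rightEnd U V ψ) =
      ∑ u : U, f (rightEnd U V (⟨affine 1 (u : F), affine_one_mem u.2⟩ * φ)) := by
    intro φ
    rw [Finset.sum_subtype (p := fun ψ => leftEnd U V ψ = leftEnd U V φ) _ (by simp),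
      ← Equiv.sum_comp (leftFibreEquiv φ)]
    rfl
  -- Squaring a vertex sum pairs each edge φ with all its translates; then w is replaced by s =
  -- v⁻¹w.
  have hsq : ∑ p, (∑ φ with leftEnd U V φ = p, f (rightEnd U V φ)) ^ 2 =
      ∑ t : U × V, ∑ s, g s * g (s + h.scale t.2⁻¹ ⟨t.1, h.le t.1.2⟩) := by
    calc _ = ∑ p, ∑ φ with leftEnd U V φ = p, f (rightEnd U V φ) *
          ∑ u : U, f (rightEnd U V (⟨affine 1 (u : F), affine_one_mem u.2⟩ * φ)) := by
          refine Finset.sum_congr rfl fun p _ => ?_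
          rw [sq, Finset.sum_mul]
          refine Finset.sum_congr rfl fun φ hφ => ?_
          rw [← hfib, (Finset.mem_filter.1 hφ).2]
      _ = ∑ v : V, ∑ w : W, ∑ u : U, g (h.scale v⁻¹ w) *
          g (h.scale v⁻¹ w + h.scale v⁻¹ ⟨u, h.le u.2⟩) := by
          rw [Finset.sum_fiberwise, ← Equiv.sum_comp h.equiv, Fintype.sum_prod_type]
          simp only [Finset.mul_sum, h.translate_equiv, hgr, h.scale_add]
      _ = ∑ v : V, ∑ s : W, ∑ u : U, g s * g (s + h.scale v⁻¹ ⟨u, h.le u.2⟩) :=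
          Finset.sum_congr rfl fun v _ => Equiv.sum_comp (h.scale v⁻¹)
            fun s => ∑ u : U, g s * g (s + h.scale v⁻¹ ⟨u, h.le u.2⟩)
      _ = _ := by
          rw [Fintype.sum_prod_type_right]
          exact Finset.sum_congr rfl fun v _ => Finset.sum_comm
  rw [hsq, hg2]
  refine (sum_autocorrelation_le _ (M := M) ?_ g hg0).trans
    (mul_le_mul_of_nonneg_right hσ (by positivity))
  intro χ hχ
  rw [Fintype.sum_prod_type]
  refine le_trans (le_of_eq ?_) (hM χ hχ)
  congr 1
  exact Finset.sum_congr rfl fun u _ =>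
    Equiv.sum_comp (Equiv.inv V) fun v => χ (h.scale v ⟨u, h.le u.2⟩)

end CosetGraph

/-! ### The code as a Tanner code; its distance and dimension -/

section TannerStructure

variable {F : Type*} [Field F] {U : AddSubgroup F} {V : Subgroup Fˣ}

theorem translationPoly_eq_prod [Fintype U] : translationPoly U = ∏ u : U, (X - C (u : F)) :=
  finprod_eq_prod_of_fintype _

theorem natDegree_scalingPoly : (scalingPoly V).natDegree = Nat.card V := natDegree_X_pow _

theorem eval_scalingPoly_mul (x : F) {v : Fˣ} (hv : v ∈ V) :
    (scalingPoly V).eval (v * x) = (scalingPoly V).eval x := by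
  have h1 : v ^ Nat.card V = 1 := by
    have h0 := pow_card_eq_one' (x := (⟨v, hv⟩ : V))
    exact Subtype.ext_iff.1 h0
  have h2 : (v : F) ^ Nat.card V = 1 := by rw [← Units.val_pow_eq_pow_val, h1, Units.val_one]
  simp [scalingPoly, mul_pow, h2]

variable [Finite F]

theorem natDegree_translationPoly : (translationPoly U).natDegree = Nat.card U := by
  have := Fintype.ofFinite U
  rw [translationPoly_eq_prod, natDegree_prod_of_monic _ _ fun u _ => monic_X_sub_C _]
  simp

theorem eval_translationPoly_add (x : F) {u : F} (hu : u ∈ U) :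
    (translationPoly U).eval (x + u) = (translationPoly U).eval x := by
  have := Fintype.ofFinite U
  rw [translationPoly_eq_prod, eval_prod, eval_prod,
    ← Equiv.prod_comp (Equiv.addRight (⟨u, hu⟩ : U))]
  refine Finset.prod_congr rfl fun w _ => ?_
  simp

theorem eval_translationPoly_leftEnd (α : F) (φ ψ : genGroup U V)
    (h : leftEnd U V φ = leftEnd U V ψ) :
    (translationPoly U).eval (φ.1 α) = (translationPoly U).eval (ψ.1 α) := by
  obtain ⟨u, hu, hψ⟩ := (leftEnd_eq_iff _ _).1 h
  rw [hψ, AffineEquiv.mul_def, AffineEquiv.trans_apply, affine_apply, Units.val_one, one_mul,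
    eval_translationPoly_add _ hu]

omit [Finite F] in
theorem eval_scalingPoly_rightEnd (α : F) (φ ψ : genGroup U V)
    (h : rightEnd U V φ = rightEnd U V ψ) :
    (scalingPoly V).eval (φ.1 α) = (scalingPoly V).eval (ψ.1 α) := by
  obtain ⟨v, hv, hψ⟩ := (rightEnd_eq_iff _ _).1 h
  rw [hψ, AffineEquiv.mul_def, AffineEquiv.trans_apply, affine_apply, add_zero,
    eval_scalingPoly_mul _ hv]

omit [Finite F] in
theorem HasTrivialStabilizer.injective {α : F} (h : HasTrivialStabilizer U V α) :
    Function.Injective fun φ : genGroup U V => φ.1 α := by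
  intro φ ψ hφψ
  have h1 := h (ψ⁻¹ * φ : genGroup U V) (ψ⁻¹ * φ).2 (by
    rw [Subgroup.coe_mul, Subgroup.coe_inv, AffineEquiv.mul_def, AffineEquiv.trans_apply]
    simp only at hφψ
    rw [hφψ, AffineEquiv.inv_def, AffineEquiv.symm_apply_apply])
  have h2 : ψ⁻¹ * φ = 1 := Subtype.ext h1
  exact (inv_mul_eq_one.1 h2).symm

omit [Finite F] in
theorem HasTrivialStabilizer.bijective {α : F} (h : HasTrivialStabilizer U V α) :
    Function.Bijective (edgePoint U V α) := by
  refine ⟨fun φ ψ hφψ => h.injective (Subtype.ext_iff.1 hφψ), ?_⟩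
  rintro ⟨x, φ, hφ, rfl⟩
  exact ⟨⟨φ, hφ⟩, rfl⟩

theorem mem_messageSpace {r : ℝ} {D : ℕ} {f : F[X]} : f ∈ messageSpace U V r D ↔ f.degree < D ∧
    baseDegree (translationPoly U) f < (⌈r * Nat.card U⌉₊ : ℕ) ∧
    baseDegree (scalingPoly V) f < (⌈r * Nat.card V⌉₊ : ℕ) := Iff.rfl

theorem mem_code {r : ℝ} {D : ℕ} {α : F} {c : evalSet U V α → F} : c ∈ code U V r D α ↔
    ∃ f ∈ messageSpace U V r D, ∀ x : evalSet U V α, f.eval (x : F) = c x := by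
  simp only [code, Submodule.mem_map, funext_iff, evalAt_apply]

theorem mem_edgeCode {r : ℝ} {D : ℕ} {α : F} {c : genGroup U V → F} : c ∈ edgeCode U V r D α ↔
    ∃ f ∈ messageSpace U V r D, ∀ φ : genGroup U V, f.eval (φ.1 α) = c φ := by
  simp only [edgeCode, Submodule.mem_map, mem_code]
  constructor
  · rintro ⟨b, ⟨f, hf, hb⟩, rfl⟩
    exact ⟨f, hf, fun φ => hb (edgePoint U V α φ)⟩
  · rintro ⟨f, hf, hc⟩
    exact ⟨fun x => f.eval (x : F), ⟨f, hf, fun _ => rfl⟩, funext hc⟩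

theorem edgeCode_le_cosetTannerCode (r : ℝ) (D : ℕ) (α : F) :
    edgeCode U V r D α ≤ cosetTannerCode U V r α := by
  intro c hc
  obtain ⟨f, ⟨-, hf1, hf2⟩, hfc⟩ := mem_edgeCode.1 hc
  obtain rfl : (fun φ => f.eval (φ.1 α)) = c := funext hfc
  exact (mem_tannerCode _ _ _ _ _).2
    ⟨mem_rsCode_fibre (degree_translationPoly_pos U) (eval_translationPoly_leftEnd α) hf1,
      mem_rsCode_fibre (degree_scalingPoly_pos V) (eval_scalingPoly_rightEnd α) hf2⟩

theorem ceil_mul_le {r : ℝ} (hr : r ≤ 1) (N : ℕ) : ⌈r * N⌉₊ ≤ N :=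
  Nat.ceil_le.2 (mul_le_of_le_one_left (Nat.cast_nonneg N) hr)

/-- The coordinates are distinct points, so every word is interpolated by a polynomial of degree
less than |A|; the local conditions then control both of its base degrees. -/
theorem cosetTannerCode_le_edgeCode {r : ℝ} (hr : r ≤ 1) {α : F}
    (hα : HasTrivialStabilizer U V α) :
    cosetTannerCode U V r α ≤ edgeCode U V r (Nat.card (genGroup U V)) α := by
  classical
  have := Fintype.ofFinite (genGroup U V)
  intro c hc
  obtain ⟨hc1, hc2⟩ := (mem_tannerCode _ _ _ _ _).1 hc
  set x : genGroup U V → F := fun φ => φ.1 α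
  have hx : Function.Injective x := hα.injective
  set f := Lagrange.interpolate Finset.univ x c
  have hfc : ∀ φ, f.eval (x φ) = c φ := fun φ =>
    Lagrange.eval_interpolate_at_node c hx.injOn (Finset.mem_univ φ)
  have hfd : f.degree < Nat.card (genGroup U V) := by
    rw [Nat.card_eq_fintype_card]
    exact Lagrange.degree_interpolate_lt c hx.injOn
  refine mem_edgeCode.2 ⟨f, ⟨hfd, ?_, ?_⟩, hfc⟩
  · refine baseDegree_lt_of_fibres (degree_translationPoly_pos U) hx
      (eval_translationPoly_leftEnd α) leftEnd_surjective (fun v => ?_) hfd ?_ fun v => ?_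
    · rw [card_leftEnd_fibre, natDegree_translationPoly]
    · rw [natDegree_translationPoly]
      exact ceil_mul_le hr _
    · simp only [hfc]
      exact hc1 v
  · refine baseDegree_lt_of_fibres (degree_scalingPoly_pos V) hx
      (eval_scalingPoly_rightEnd α) rightEnd_surjective (fun v => ?_) hfd ?_ fun v => ?_
    · rw [card_rightEnd_fibre, natDegree_scalingPoly]
    · rw [natDegree_scalingPoly]
      exact ceil_mul_le hr _
    · simp only [hfc]
      exact hc2 v

omit [Finite F] in
theorem baseDegree_one_lt {u : F[X]} (hu : 0 < u.degree) {k : ℕ} (hk : 0 < k) :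
    baseDegree u 1 < k := by
  rw [baseDegree_lt_iff hu]
  intro i
  cases i with
  | zero =>
    rw [baseCoeff, (mod_eq_self_iff (ne_zero_of_degree_gt hu)).2 (by rwa [degree_one]), degree_one]
    exact_mod_cast hk
  | succ i =>
    rw [baseCoeff_eq_zero hu _ _ (by rw [degree_one]; exact_mod_cast i.succ_pos), degree_zero]
    exact WithBot.bot_lt_coe k

theorem one_mem_messageSpace {r : ℝ} (hr : 0 < r) {D : ℕ} (hD : 0 < D) :
    (1 : F[X]) ∈ messageSpace U V r D := by
  have h1 : (0 : ℝ) < Nat.card U := by exact_mod_cast Nat.card_pos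
  have h2 : (0 : ℝ) < Nat.card V := by exact_mod_cast Nat.card_pos
  exact ⟨by rw [degree_one]; exact_mod_cast hD,
    baseDegree_one_lt (degree_translationPoly_pos U) (Nat.ceil_pos.2 (by positivity)),
    baseDegree_one_lt (degree_scalingPoly_pos V) (Nat.ceil_pos.2 (by positivity))⟩

omit [Field F] [Finite F] in
theorem ncard_subtype_eq_card {E L : Type*} [Fintype E] [DecidableEq F] [DecidableEq L] [Zero F]
    (l : E → L) (c : E → F) (v : L) :
    Set.ncard {e : {e : E // l e = v} | c e.1 ≠ 0} =
      Finset.card {e ∈ ({e | c e ≠ 0} : Finset E) | l e = v} := by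
  rw [← Set.ncard_coe_finset, ← Set.ncard_image_of_injective _ Subtype.val_injective]
  congr 1
  ext e
  simp [and_comm]

/-- The distance of the Tanner code of the coset graph. -/
theorem IsExpander.le_ncard_support [Fintype (genGroup U V)] [DecidableEq (LeftVertex U V)] {σ r : ℝ}
    (h : IsExpander (leftEnd U V) (rightEnd U V) (Nat.card U) (Nat.card V) σ) (hσ : 0 ≤ σ)
    (hr0 : 0 ≤ r) (hr1 : r < 1) {α : F} (hα : HasTrivialStabilizer U V α) {c : genGroup U V → F}
    (hc : c ∈ cosetTannerCode U V r α) (hc0 : c ≠ 0) :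
    ((1 - r) ^ 2 - σ * (1 - r)) * Nat.card (genGroup U V) ≤ Set.ncard {φ | c φ ≠ 0} := by
  classical
  obtain ⟨hc1, hc2⟩ := (mem_tannerCode _ _ _ _ _).1 hc
  obtain ⟨φ₀, hφ₀⟩ := Function.ne_iff.1 hc0
  have h1 := h.le_card_edges hσ (S := {φ | c φ ≠ 0})
    (fun v => by
      rw [← Fintype.card_subtype, ← Nat.card_eq_fintype_card, card_rightEnd_fibre])
    (fun v => by
      rw [← Fintype.card_subtype, ← Nat.card_eq_fintype_card, card_leftEnd_fibre])
    (sub_pos.2 hr1) ⟨φ₀, by simpa using hφ₀⟩ ?_ ?_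
  · rw [Nat.card_eq_fintype_card]
    refine h1.trans (le_of_eq ?_)
    rw [← Set.ncard_coe_finset]
    simp
  · intro φ hφ
    rw [← ncard_subtype_eq_card, ← card_leftEnd_fibre (leftEnd U V φ)]
    refine rsCode_support_ge (hα.injective.comp Subtype.val_injective) hr0 ?_ ?_
    · rw [card_leftEnd_fibre]
      exact hc1 (leftEnd U V φ)
    · exact fun h0 => (Finset.mem_filter.1 hφ).2 (congrFun h0 ⟨φ, rfl⟩)
  · intro φ hφ
    rw [← ncard_subtype_eq_card, ← card_rightEnd_fibre (rightEnd U V φ)]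
    refine rsCode_support_ge (hα.injective.comp Subtype.val_injective) hr0 ?_ ?_
    · rw [card_rightEnd_fibre]
      exact hc2 (rightEnd U V φ)
    · exact fun h0 => (Finset.mem_filter.1 hφ).2 (congrFun h0 ⟨φ, rfl⟩)

omit [Finite F] in
instance (α : F) : Nonempty (evalSet U V α) := ⟨edgePoint U V α 1⟩

omit [Finite F] in
theorem HasTrivialStabilizer.card_evalSet {α : F} (hα : HasTrivialStabilizer U V α) :
    Nat.card (evalSet U V α) = Nat.card (genGroup U V) :=
  (Nat.card_congr (Equiv.ofBijective _ hα.bijective)).symm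

theorem max_le_relDist_code [Fintype (genGroup U V)] [DecidableEq (LeftVertex U V)] {σ r : ℝ}
    (h : IsExpander (leftEnd U V) (rightEnd U V) (Nat.card U) (Nat.card V) σ) (hσ : 0 ≤ σ)
    (hr0 : 0 < r) (hr1 : r < 1) {α : F} (hα : HasTrivialStabilizer U V α) {D : ℕ} (hD : 0 < D) :
    max (1 - (D : ℝ) / Nat.card (genGroup U V)) ((1 - r) ^ 2 - σ * (1 - r)) ≤
      relDist (code U V r D α) := by
  have hn : (0 : ℝ) < Nat.card (genGroup U V) := by exact_mod_cast Nat.card_pos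
  -- The all-one word, which is a codeword because D > 0 and r > 0.
  have hne : ∃ c ∈ code U V r D α, c ≠ 0 :=
    ⟨1, mem_code.2 ⟨1, one_mem_messageSpace hr0 hD, fun _ => by simp⟩, one_ne_zero⟩
  refine max_le (le_relDist hne fun c hc hc0 => ?_) (le_relDist hne fun c hc hc0 => ?_)
  · obtain ⟨f, hf, hfc⟩ := mem_code.1 hc
    have hf0 : f ≠ 0 := by
      rintro rfl
      exact hc0 (funext fun x => by simp [← hfc x])
    have h1 := card_lt_ncard_support_add (x := (Subtype.val : evalSet U V α → F))
      Subtype.val_injective hf0 hf.1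
    simp only [hfc] at h1
    rw [hα.card_evalSet] at h1 ⊢
    rw [sub_mul, one_mul, div_mul_cancel₀ _ hn.ne', sub_le_iff_le_add]
    exact_mod_cast h1.le
  · set b : genGroup U V → F := fun φ => c (edgePoint U V α φ)
    have hb : b ∈ edgeCode U V r D α := ⟨c, hc, rfl⟩
    have hb0 : b ≠ 0 := by
      obtain ⟨x, hx⟩ := Function.ne_iff.1 hc0
      obtain ⟨φ, rfl⟩ := hα.bijective.2 x
      exact fun h0 => hx (congrFun h0 φ)
    rw [hα.card_evalSet]
    refine (h.le_ncard_support hσ hr0.le hr1 hα (edgeCode_le_cosetTannerCode r D α hb) hb0).trans ?_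
    rw [← Set.ncard_image_of_injective _ hα.bijective.1]
    exact_mod_cast Set.ncard_le_ncard (by rintro _ ⟨φ, hφ, rfl⟩; exact hφ)

/-- A message has degree less than D, hence fewer roots than there are evaluation points, so
evaluation is injective. -/
theorem finrank_code {r : ℝ} {D : ℕ} {α : F} (hα : HasTrivialStabilizer U V α)
    (hD : D ≤ Nat.card (genGroup U V)) :
    Module.finrank F (code U V r D α) = Module.finrank F (messageSpace U V r D) := by
  refine (LinearEquiv.finrank_eq (LinearEquiv.ofBijective
    ((evalAt (Subtype.val : evalSet U V α → F)).submoduleMap (messageSpace U V r D))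
    ⟨?_, LinearMap.submoduleMap_surjective _ _⟩)).symm
  rw [← LinearMap.ker_eq_bot, LinearMap.ker_eq_bot']
  rintro ⟨f, hf⟩ h0
  by_contra hne
  have h1 := card_lt_ncard_support_add (x := (Subtype.val : evalSet U V α → F))
      Subtype.val_injective (fun h => hne (Subtype.ext h)) hf.1
  have h2 : {x : evalSet U V α | f.eval (x : F) ≠ 0} = ∅ := by
    ext x
    have h3 : f.eval (x : F) = 0 := congrFun (Subtype.ext_iff.1 h0) x
    simpa using h3
  rw [h2, Set.ncard_empty, hα.card_evalSet] at h1
  omega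

end TannerStructure

/-! ### Character sums over multiplicative subgroups -/

section CharacterSum

/-- Square-root bound for the sum of a nontrivial additive character of a finite field over a
multiplicative subgroup. -/
theorem norm_sq_sum_char_le {K G : Type*} [Field K] [Fintype K] [Group G] [Fintype G]
    (ι : G →* Kˣ) (hι : Function.Injective ι) {ψ : AddChar K ℂ} (hψ : ψ ≠ 1) :
    ‖∑ g, ψ (ι g : K)‖ ^ 2 ≤ Fintype.card K := by
  classical
  have hprim := AddChar.IsPrimitive.of_ne_one hψ
  -- Second moment over all dilations b of the character: by orthogonality only the diagonal g = g'
  -- remains.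
  have htot : ∑ b : K, ‖∑ g, ψ (b * (ι g : K))‖ ^ 2 = Fintype.card K * Fintype.card G := by
    rw [← Complex.ofReal_inj, Complex.ofReal_sum]
    have h1 : ∀ b : K, ((‖∑ g, ψ (b * (ι g : K))‖ ^ 2 : ℝ) : ℂ) =
        ∑ g, ∑ g', ψ (b * ((ι g : K) - ι g')) := by
      intro b
      rw [← Complex.normSq_eq_norm_sq, ← Complex.mul_conj, map_sum, Finset.sum_mul_sum]
      refine Finset.sum_congr rfl fun g _ => Finset.sum_congr rfl fun g' _ => ?_
      rw [← AddChar.map_neg_eq_conj, ← AddChar.map_add_eq_mul, mul_sub, sub_eq_add_neg]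
    simp only [h1]
    rw [Finset.sum_comm]
    have h2 : ∀ g : G, ∑ b : K, ∑ g', ψ (b * ((ι g : K) - ι g')) = Fintype.card K := by
      intro g
      rw [Finset.sum_comm, Finset.sum_eq_single g]
      · simp
      · intro g' _ hg'
        rw [AddChar.sum_mulShift _ hprim, if_neg, Nat.cast_zero]
        intro h
        exact hg' (hι (Units.ext (sub_eq_zero.1 h))).symm
      · simp
    simp only [h2]
    simp [mul_comm]
  have hG : (0 : ℝ) < Fintype.card G := by exact_mod_cast Fintype.card_pos
  refine le_of_mul_le_mul_right ?_ hG
  rw [← htot]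
  -- Dilating by an element of the subgroup does not change the sum, so the second moment contains
  -- |G| equal copies of the desired square.
  have h3 : ∀ g' : G, ‖∑ g, ψ ((ι g' : K) * (ι g : K))‖ ^ 2 = ‖∑ g, ψ (ι g : K)‖ ^ 2 := by
    intro g'
    rw [← Equiv.sum_comp (Equiv.mulLeft g') fun g => ψ (ι g : K)]
    simp
  calc ‖∑ g, ψ (ι g : K)‖ ^ 2 * Fintype.card G
      = ∑ g' : G, ‖∑ g, ψ ((ι g' : K) * (ι g : K))‖ ^ 2 := by simp [h3, mul_comm]
    _ = ∑ b ∈ Finset.univ.map ⟨fun g : G => (ι g : K), Units.val_injective.comp hι⟩,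
          ‖∑ g, ψ (b * (ι g : K))‖ ^ 2 := by simp
    _ ≤ _ := Finset.sum_le_univ_sum_of_nonneg fun b => by positivity

end CharacterSum

/-! ### Subfields and roots of unity in a finite field -/

section Subfields

variable {F : Type*} [Field F] {p : ℕ} [Fact p.Prime] [CharP F p]

variable (F p) in
/-- The subfield `F_{p^k}` of `F`. -/
def fixedSubfield (k : ℕ) : Subfield F :=
  (iterateFrobenius F p k).eqLocusField (RingHom.id F)

theorem mem_fixedSubfield {k : ℕ} {x : F} : x ∈ fixedSubfield F p k ↔ x ^ p ^ k = x := Iff.rfl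

theorem mem_addPart_iff_fixedSubfield {k : ℕ} {x : F} :
    x ∈ addPart F p k ↔ x ∈ fixedSubfield F p k := Iff.rfl

theorem fixedSubfield_le {k l : ℕ} (h : k ∣ l) : fixedSubfield F p k ≤ fixedSubfield F p l := by
  obtain ⟨c, rfl⟩ := h
  intro x hx
  rw [mem_fixedSubfield] at hx ⊢
  induction c with
  | zero => simp
  | succ c ih => rw [mul_add, mul_one, pow_add, pow_mul, ih, hx]

omit [Fact p.Prime] [CharP F p] in
theorem card_units_pow_eq_one [Finite F] {N k d : ℕ} (hF : Nat.card F = p ^ N) (hk : k ∣ N)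
    (hd : d ∣ p ^ k - 1) : Nat.card (rootsOfUnity d F) = d := by
  have h1 : d ∣ Nat.card Fˣ := by
    rw [Nat.card_units, hF]
    exact hd.trans (Nat.pow_sub_one_dvd_pow_sub_one p hk)
  have h2 : rootsOfUnity d F = (powMonoidHom d : Fˣ →* Fˣ).ker := by
    ext u
    simp [MonoidHom.mem_ker]
  rw [h2, IsCyclic.card_powMonoidHom_ker]
  exact Nat.gcd_eq_right h1

/-- The fixed points are 0 and the roots of unity of order dividing p^k - 1. -/
theorem card_addPart [Finite F] {N k : ℕ} (hF : Nat.card F = p ^ N) (hk : k ∣ N) (hk0 : 0 < k) :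
    Nat.card (addPart F p k) = p ^ k := by
  have hp : 1 < p := (Fact.out : p.Prime).one_lt
  have hq : 1 < p ^ k := Nat.one_lt_pow hk0.ne' hp
  have h1 : ((addPart F p k : AddSubgroup F) : Set F) =
      insert 0 (Units.val '' ((rootsOfUnity (p ^ k - 1) F : Subgroup Fˣ) : Set Fˣ)) := by
    ext x
    rw [SetLike.mem_coe, mem_addPart, Set.mem_insert_iff, Set.mem_image]
    constructor
    · intro hx
      rcases eq_or_ne x 0 with h0 | h0
      · exact Or.inl h0
      · refine Or.inr ⟨Units.mk0 x h0, ?_, rfl⟩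
        rw [SetLike.mem_coe, mem_rootsOfUnity]
        refine Units.ext (mul_left_cancel₀ h0 ?_)
        rw [Units.val_pow_eq_pow_val, Units.val_mk0, ← pow_succ', Nat.sub_add_cancel hq.le, hx]
        simp
    · rintro (rfl | ⟨u, hu, rfl⟩)
      · exact zero_pow (by positivity)
      · rw [SetLike.mem_coe, mem_rootsOfUnity] at hu
        have : u ^ p ^ k = u := by
          rw [← Nat.sub_add_cancel hq.le, pow_succ, hu, one_mul]
        rw [← Units.val_pow_eq_pow_val, this]
  have h2 := card_units_pow_eq_one (F := F) hF hk dvd_rfl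
  rw [← SetLike.coe_sort_coe, Nat.card_coe_set_eq, h1, Set.ncard_insert_of_notMem,
    Set.ncard_image_of_injective _ Units.val_injective, ← Nat.card_coe_set_eq,
    SetLike.coe_sort_coe, h2, Nat.sub_add_cancel hq.le]
  rintro ⟨u, -, hu⟩
  exact u.ne_zero hu

omit [CharP F p] in
theorem exists_card_addSubgroup {N : ℕ} (hF : Nat.card F = p ^ N) (S : AddSubgroup F) :
    ∃ j, Nat.card S = p ^ j := by
  obtain ⟨j, -, hj⟩ := (Nat.dvd_prime_pow (Fact.out : p.Prime)).1 (hF ▸ S.card_addSubgroup_dvd_card)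
  exact ⟨j, hj⟩

/-- Such an S is a vector space over F_{p^k}. -/
theorem exists_card_eq_pow_of_stable [Finite F] {k : ℕ} {S : AddSubgroup F}
    (hS : ∀ c ∈ addPart F p k, ∀ x ∈ S, c * x ∈ S) :
    ∃ i, Nat.card S = Nat.card (addPart F p k) ^ i := by
  let S' : Submodule (fixedSubfield F p k) F :=
    { S with smul_mem' := fun c x hx => hS c c.2 x hx }
  exact ⟨Module.finrank (fixedSubfield F p k) S',
    Module.natCard_eq_pow_finrank (K := fixedSubfield F p k) (V := S')⟩

end Subfields

/-! ### Span, group order, free orbits and character sums for the chosen G and H -/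

section Parameters

theorem mul_mulOrder {m a p : ℕ} (ha : a ∣ p - 1) : a * mulOrder m a p = p ^ (m + 1) - 1 :=
  Nat.mul_div_cancel' (ha.trans (by simpa using Nat.pow_sub_one_dvd_pow_sub_one p (one_dvd (m + 1))))

/-- As a ≤ p - 1, the contrary would give p^(m+1) - 1 ≤ p^(m+1) - p^m. This inequality keeps H out
of every additive subgroup of order at most p^m. -/
theorem pow_lt_mulOrder {m a p : ℕ} (hm : 1 ≤ m) (hp : 1 < p) (ha : a ∣ p - 1) :
    p ^ m < mulOrder m a p := by
  have h1 := mul_mulOrder (m := m) ha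
  have h2 : a ≤ p - 1 := Nat.le_of_dvd (by omega) ha
  by_contra! h
  have h3 : a * mulOrder m a p ≤ (p - 1) * p ^ m := Nat.mul_le_mul h2 h
  have h4 : 1 < p ^ m := Nat.one_lt_pow (by omega) hp
  rw [h1, Nat.sub_mul, one_mul, pow_succ'] at h3
  have h5 : p ^ m ≤ p * p ^ m := Nat.le_mul_of_pos_left _ (by omega)
  omega

variable {F : Type*} [Field F] [Finite F] {p : ℕ} [Fact p.Prime] [CharP F p] {m a N : ℕ}

omit [Fact p.Prime] [CharP F p] in
theorem card_mulPart (ha : a ∣ p - 1) (hF : Nat.card F = p ^ N) (hN : m * (m + 1) ∣ N) :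
    Nat.card (mulPart F m a p) = mulOrder m a p :=
  card_units_pow_eq_one hF ((Dvd.intro_left _ rfl).trans hN) (Dvd.intro_left a (mul_mulOrder ha))

omit [Finite F] in
theorem mulPart_le (ha : a ∣ p - 1) {v : Fˣ} (hv : v ∈ mulPart F m a p) :
    (v : F) ∈ addPart F p (m + 1) := by
  have hp : 1 < p := (Fact.out : p.Prime).one_lt
  have h1 : v ^ mulOrder m a p = 1 := hv
  have h2 : v ^ (p ^ (m + 1) - 1) = 1 := by rw [← mul_mulOrder ha, mul_comm, pow_mul, h1, one_pow]
  have h3 : v ^ p ^ (m + 1) = v := by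
    rw [← Nat.sub_add_cancel (Nat.one_le_pow (m + 1) p (by omega)), pow_succ, h2, one_mul]
  rw [mem_addPart, ← Units.val_pow_eq_pow_val, h3]

/-- The multiplicative group `H` spans `F_{p^(m+1)}`. -/
theorem closure_mulPart (hm : 1 ≤ m) (ha : a ∣ p - 1) (hF : Nat.card F = p ^ N)
    (hN : m * (m + 1) ∣ N) :
    AddSubgroup.closure (Units.val '' (mulPart F m a p : Set Fˣ)) = addPart F p (m + 1) := by
  have hp : 1 < p := (Fact.out : p.Prime).one_lt
  have hle : AddSubgroup.closure (Units.val '' (mulPart F m a p : Set Fˣ)) ≤ addPart F p (m + 1) := by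
    rw [AddSubgroup.closure_le]
    rintro _ ⟨v, hv, rfl⟩
    exact mulPart_le ha hv
  refine AddSubgroup.eq_of_le_of_card_ge hle ?_
  obtain ⟨j, hj⟩ := exists_card_addSubgroup hF
    (AddSubgroup.closure (Units.val '' (mulPart F m a p : Set Fˣ)))
  rw [card_addPart hF ((Dvd.intro_left _ rfl).trans hN) m.succ_pos, hj]
  -- The span has order p^j and contains H, so p^j > p^m and j ≥ m + 1.
  refine Nat.pow_le_pow_right (by omega) ?_
  rw [Nat.succ_le_iff, ← Nat.pow_lt_pow_iff_right hp, ← hj]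
  refine (pow_lt_mulOrder hm hp ha).trans_le ?_
  rw [← card_mulPart (F := F) ha hF hN]
  exact Nat.card_le_card_of_injective
    (fun v : mulPart F m a p => (⟨(v : Fˣ), AddSubgroup.subset_closure ⟨v, v.2, rfl⟩⟩ :
      AddSubgroup.closure (Units.val '' (mulPart F m a p : Set Fˣ))))
    fun v w h => Subtype.ext (Units.ext (Subtype.ext_iff.1 h))

/-- The span S of the products is stable under F_{p^m}, and also under F_{p^(m+1)} because H spans
that field. Its order is a power of both p^m and p^(m+1), hence at least p^(m(m+1)). -/
theorem isProductSpan (hm : 1 ≤ m) (ha : a ∣ p - 1) (hF : Nat.card F = p ^ N)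
    (hN : m * (m + 1) ∣ N) :
    IsProductSpan (addPart F p m) (mulPart F m a p) (addPart F p (m * (m + 1))) := by
  have hp : 1 < p := (Fact.out : p.Prime).one_lt
  have hU : addPart F p m ≤ addPart F p (m * (m + 1)) := fixedSubfield_le (Dvd.intro _ rfl)
  have hE : addPart F p (m + 1) ≤ addPart F p (m * (m + 1)) := fixedSubfield_le (Dvd.intro_left _ rfl)
  have hmul : ∀ k, ∀ x ∈ addPart F p k, ∀ y ∈ addPart F p k, x * y ∈ addPart F p k :=
    fun k x hx y hy => (fixedSubfield F p k).mul_mem hx hy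
  refine ⟨fun v hv w hw => hmul _ _ (hE (mulPart_le ha hv)) _ hw, hU, ?_⟩
  set S := AddSubgroup.closure
    {x : F | ∃ v ∈ mulPart F m a p, ∃ u ∈ addPart F p m, x = (v : F) * u} with hS
  have hSW : S ≤ addPart F p (m * (m + 1)) := by
    rw [hS, AddSubgroup.closure_le]
    rintro _ ⟨v, hv, u, hu, rfl⟩
    exact hmul _ _ (hE (mulPart_le ha hv)) _ (hU hu)
  have hSU : ∀ c ∈ addPart F p m, ∀ x ∈ S, c * x ∈ S := by
    intro c hc x hx
    induction hx using AddSubgroup.closure_induction with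
    | mem x hx =>
      obtain ⟨v, hv, u, hu, rfl⟩ := hx
      exact AddSubgroup.subset_closure ⟨v, hv, c * u, hmul _ _ hc _ hu, by ring⟩
    | zero => simp
    | add x y _ _ hx hy => rw [mul_add]; exact add_mem hx hy
    | neg x _ hx => rw [mul_neg]; exact neg_mem hx
  have hSV : ∀ v ∈ mulPart F m a p, ∀ x ∈ S, (v : F) * x ∈ S := by
    intro c hc x hx
    induction hx using AddSubgroup.closure_induction with
    | mem x hx =>
      obtain ⟨v, hv, u, hu, rfl⟩ := hx
      exact AddSubgroup.subset_closure ⟨c * v, mul_mem hc hv, u, hu, by push_cast; ring⟩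
    | zero => simp
    | add x y _ _ hx hy => rw [mul_add]; exact add_mem hx hy
    | neg x _ hx => rw [mul_neg]; exact neg_mem hx
  have hSE : ∀ c ∈ addPart F p (m + 1), ∀ x ∈ S, c * x ∈ S := by
    intro c hc x hx
    rw [← closure_mulPart hm ha hF hN] at hc
    induction hc using AddSubgroup.closure_induction with
    | mem c hc =>
      obtain ⟨v, hv, rfl⟩ := hc
      exact hSV v hv x hx
    | zero => simp
    | add c d _ _ hc hd => rw [add_mul]; exact add_mem hc hd
    | neg c _ hc => rw [neg_mul]; exact neg_mem hc
  obtain ⟨i, hi⟩ := exists_card_eq_pow_of_stable hSU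
  obtain ⟨j, hj⟩ := exists_card_eq_pow_of_stable hSE
  rw [card_addPart hF ((Dvd.intro _ rfl).trans hN) hm, ← pow_mul] at hi
  rw [card_addPart hF ((Dvd.intro_left _ rfl).trans hN) m.succ_pos, ← pow_mul] at hj
  have hij : m * i = (m + 1) * j := Nat.pow_right_injective hp (hi.symm.trans hj)
  have hdvd : m + 1 ∣ i := by
    have h1 : (m + 1).Coprime m := by simp
    exact h1.dvd_of_dvd_mul_left ⟨j, hij⟩
  have hi0 : i ≠ 0 := by
    rintro rfl
    have h1 : Nat.card S = 1 := by simpa using hi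
    rw [AddSubgroup.card_eq_one] at h1
    have h2 : (1 : F) ∈ S := AddSubgroup.subset_closure
      ⟨1, one_mem _, 1, (fixedSubfield F p m).one_mem, by simp⟩
    rw [h1] at h2
    exact one_ne_zero (AddSubgroup.mem_bot.1 h2)
  refine (AddSubgroup.eq_of_le_of_card_ge hSW ?_).ge
  rw [card_addPart hF hN (by positivity), hi]
  exact Nat.pow_le_pow_right (by omega)
    (Nat.mul_le_mul_left _ (Nat.le_of_dvd (Nat.pos_of_ne_zero hi0) hdvd))

theorem card_genGroup (hm : 1 ≤ m) (ha : a ∣ p - 1) (hF : Nat.card F = p ^ N)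
    (hN : m * (m + 1) ∣ N) :
    Nat.card (genGroup (addPart F p m) (mulPart F m a p)) = blockLength m a p := by
  rw [(isProductSpan hm ha hF hN).card_genGroup, card_addPart hF hN (by positivity),
    card_mulPart ha hF hN, blockLength]

/-- Any α outside F_{p^(m(m+1))} works: the fixed point w/(1 - v) of a map with v ≠ 1 lies in this
subfield. Such α exist because |F| ≥ n exceeds its order. -/
theorem exists_hasTrivialStabilizer (hm : 1 ≤ m) (ha : a ∣ p - 1) (hF : Nat.card F = p ^ N)
    (hN : m * (m + 1) ∣ N) (hn : blockLength m a p ≤ Nat.card F) :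
    ∃ α : F, HasTrivialStabilizer (addPart F p m) (mulPart F m a p) α := by
  have hp : 1 < p := (Fact.out : p.Prime).one_lt
  have h := isProductSpan hm ha hF hN
  have hlt : Nat.card (addPart F p (m * (m + 1))) < Nat.card F := by
    rw [card_addPart hF hN (by positivity)]
    refine lt_of_lt_of_le ?_ hn
    have h1 := pow_lt_mulOrder hm hp ha
    have h2 : 1 ≤ p ^ m := Nat.one_le_pow _ _ (by omega)
    exact lt_mul_of_one_lt_right (by positivity) (by omega)
  obtain ⟨α, hα⟩ : ∃ α : F, α ∉ addPart F p (m * (m + 1)) := by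
    by_contra! hall
    refine hlt.ne ?_
    rw [(AddSubgroup.eq_top_iff' _).2 hall, AddSubgroup.card_top]
  refine ⟨α, fun φ hφ hφα => ?_⟩
  obtain ⟨v, hv, w, hw, rfl⟩ := (h.mem_genGroup φ).1 hφ
  rw [affine_apply] at hφα
  have hv1 : v = 1 := by
    by_contra hne
    have hne' : (1 : F) - v ≠ 0 := sub_ne_zero.2 fun h => hne (Units.ext h.symm)
    apply hα
    have : α = w / (1 - v) := by
      rw [eq_div_iff hne']
      linear_combination -hφα
    rw [this]
    have hv' : (v : F) ∈ fixedSubfield F p (m * (m + 1)) :=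
      fixedSubfield_le (Dvd.intro_left _ rfl) (mulPart_le ha hv)
    exact mem_addPart_iff_fixedSubfield.2
      (div_mem (mem_addPart_iff_fixedSubfield.1 hw) (sub_mem (one_mem _) hv'))
  subst hv1
  have hw0 : w = 0 := by simpa using hφα
  rw [hw0, affine_one_zero]

/-- The u for which v ↦ χ(vu) is identically 1 on H form a subgroup T of G; it is proper because the
products vu generate the domain of χ, so |T| ≤ p^(m-1). Outside T the square-root bound applies. -/
theorem norm_sum_char_le (hm : 1 ≤ m) (ha : a ∣ p - 1) (hF : Nat.card F = p ^ N)
    (hN : m * (m + 1) ∣ N)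
    (h : IsProductSpan (addPart F p m) (mulPart F m a p) (addPart F p (m * (m + 1))))
    [Fintype (addPart F p m)] [Fintype (mulPart F m a p)]
    (χ : AddChar (addPart F p (m * (m + 1))) ℂ) (hχ : χ ≠ 0) :
    ‖∑ u : addPart F p m, ∑ v : mulPart F m a p, χ (h.scale v ⟨u, h.le u.2⟩)‖ ≤
      p ^ m * (mulOrder m a p / p + √((p : ℝ) ^ (m + 1))) := by
  classical
  have hp : 1 < p := (Fact.out : p.Prime).one_lt
  have hU : Nat.card (addPart F p m) = p ^ m := card_addPart hF ((Dvd.intro _ rfl).trans hN) hm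
  have hV : Nat.card (mulPart F m a p) = mulOrder m a p := card_mulPart ha hF hN
  have hE : Nat.card (fixedSubfield F p (m + 1)) = p ^ (m + 1) :=
    card_addPart (F := F) hF ((Dvd.intro_left _ rfl).trans hN) m.succ_pos
  have := Fintype.ofFinite (fixedSubfield F p (m + 1))
  let ev : mulPart F m a p → addPart F p m → ℂ := fun v u => χ (h.scale v ⟨u, h.le u.2⟩)
  have hadd : ∀ v u u', ev v (u + u') = ev v u * ev v u' := by
    intro v u u'
    simp only [ev]
    rw [← AddChar.map_add_eq_mul, ← h.scale_add]
    rfl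
  have hzero : ∀ v, ev v 0 = 1 := by
    intro v
    have : h.scale v ⟨((0 : addPart F p m) : F), h.le (0 : addPart F p m).2⟩ = 0 :=
      Subtype.ext (mul_zero _)
    simp only [ev, this, AddChar.map_zero_eq_one]
  let T : AddSubgroup (addPart F p m) :=
    { carrier := {u | ∀ v, ev v u = 1}
      zero_mem' := hzero
      add_mem' := fun {u u'} hu hu' v => by rw [hadd, hu v, hu' v, one_mul]
      neg_mem' := fun {u} hu v => by
        have h1 := hadd v (-u) u
        rw [neg_add_cancel, hzero, hu v, mul_one] at h1
        exact h1.symm }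
  have hTmem : ∀ u, u ∈ T ↔ ∀ v, ev v u = 1 := fun u => Iff.rfl
  have hTne : T ≠ ⊤ := by
    intro hT
    apply hχ
    have hall : ∀ (x : F) (hx : x ∈ AddSubgroup.closure
        {x : F | ∃ v ∈ mulPart F m a p, ∃ u ∈ addPart F p m, x = (v : F) * u})
        (hx' : x ∈ addPart F p (m * (m + 1))), χ ⟨x, hx'⟩ = 1 := by
      have hsub : AddSubgroup.closure
        {x : F | ∃ v ∈ mulPart F m a p, ∃ u ∈ addPart F p m, x = (v : F) * u} ≤
          addPart F p (m * (m + 1)) := by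
        rw [AddSubgroup.closure_le]
        rintro _ ⟨v, hv, u, hu, rfl⟩
        exact h.scale_mem v hv u (h.le hu)
      intro x hx
      induction hx using AddSubgroup.closure_induction with
      | mem x hx =>
        intro hx'
        obtain ⟨v, hv, u, hu, rfl⟩ := hx
        exact (hTmem ⟨u, hu⟩).1 (hT ▸ AddSubgroup.mem_top _) ⟨v, hv⟩
      | zero =>
        intro hx'
        exact AddChar.map_zero_eq_one χ
      | add x y hx hy hxi hyi =>
        intro hx'
        have h1 := AddChar.map_add_eq_mul χ ⟨x, hsub hx⟩ ⟨y, hsub hy⟩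
        rw [hxi, hyi, one_mul] at h1
        exact h1
      | neg x hx hxi =>
        intro hx'
        have h1 := AddChar.map_add_eq_mul χ ⟨-x, hx'⟩ ⟨x, hsub hx⟩
        rw [hxi, mul_one] at h1
        rw [← h1, ← AddChar.map_zero_eq_one χ]
        congr 1
        exact Subtype.ext (neg_add_cancel x)
    ext ⟨x, hx⟩
    exact hall x (h.le_closure hx) hx
  have hTcard : (Nat.card T : ℝ) * p ≤ p ^ m := by
    have hdvd : Nat.card T ∣ p ^ m := hU ▸ T.card_addSubgroup_dvd_card
    obtain ⟨j, hj, hTj⟩ := (Nat.dvd_prime_pow (Fact.out : p.Prime)).1 hdvd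
    have hjm : j ≠ m := by
      rintro rfl
      exact hTne (AddSubgroup.eq_top_of_card_eq T (hTj.trans hU.symm))
    rw [hTj]
    norm_cast
    rw [← pow_succ]
    exact Nat.pow_le_pow_right (by omega) (by omega)
  have hmain : ∀ u ∉ T, ‖∑ v, ev v u‖ ≤ √((p : ℝ) ^ (m + 1)) := by
    intro u hu
    have hmemE : ∀ e : fixedSubfield F p (m + 1), (e : F) * u ∈ addPart F p (m * (m + 1)) := fun e =>
      (fixedSubfield F p (m * (m + 1))).mul_mem (fixedSubfield_le (Dvd.intro_left _ rfl) e.2)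
        (h.le u.2)
    -- For u outside T, e ↦ χ(eu) is a nontrivial additive character of F_{p^(m+1)}, in whose unit
    -- group H embeds.
    let ψ : AddChar (fixedSubfield F p (m + 1)) ℂ :=
      { toFun := fun e => χ ⟨e * u, hmemE e⟩
        map_zero_eq_one' := by
          rw [← AddChar.map_zero_eq_one χ]
          congr 1
          exact Subtype.ext (zero_mul _)
        map_add_eq_mul' := fun e e' => by
          rw [← AddChar.map_add_eq_mul]
          congr 1
          exact Subtype.ext (add_mul _ _ _) }
    let ι : mulPart F m a p →* (fixedSubfield F p (m + 1))ˣ :=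
      MonoidHom.toHomUnits
        { toFun := fun v => ⟨((v : Fˣ) : F), mulPart_le ha v.2⟩
          map_one' := rfl
          map_mul' := fun _ _ => rfl }
    have hι : Function.Injective ι := fun v w hvw =>
      Subtype.ext (Units.ext (Subtype.ext_iff.1 (Units.ext_iff.1 hvw)))
    have hψ : ψ ≠ 1 := by
      intro h1
      apply hu
      intro v
      have h2 : ψ (ι v : fixedSubfield F p (m + 1)) = 1 := by rw [h1, AddChar.one_apply]
      exact h2
    have h3 := norm_sq_sum_char_le ι hι hψ
    rw [← Nat.card_eq_fintype_card, hE] at h3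
    refine Real.le_sqrt_of_sq_le ?_
    push_cast at h3
    exact h3
  have hsmall : ∀ u, ‖∑ v, ev v u‖ ≤ (if u ∈ T then (mulOrder m a p : ℝ) else 0) +
      √((p : ℝ) ^ (m + 1)) := by
    intro u
    split_ifs with hu
    · rw [Finset.sum_congr rfl fun v _ => (hTmem u).1 hu v]
      simp only [Finset.sum_const, Finset.card_univ, nsmul_eq_mul, mul_one, Complex.norm_natCast]
      rw [← Nat.card_eq_fintype_card, hV]
      exact le_add_of_nonneg_right (Real.sqrt_nonneg _)
    · rw [zero_add]
      exact hmain u hu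
  refine (norm_sum_le _ _).trans ((Finset.sum_le_sum fun u _ => hsmall u).trans ?_)
  rw [Finset.sum_add_distrib, Finset.sum_const, Finset.card_univ, ← Nat.card_eq_fintype_card, hU,
    ← Finset.sum_filter, Finset.sum_const, nsmul_eq_mul, nsmul_eq_mul, mul_add]
  have hT' : Finset.card {u | u ∈ T} = Nat.card T := by
    rw [Nat.card_eq_fintype_card, ← Fintype.card_subtype]
  rw [hT']
  push_cast
  refine add_le_add_left ?_ _
  have hp0 : (0 : ℝ) < p := by positivity
  rw [mul_div_assoc', le_div_iff₀ hp0]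
  calc (Nat.card T : ℝ) * mulOrder m a p * p = (Nat.card T * p) * mulOrder m a p := by ring
    _ ≤ p ^ m * mulOrder m a p := by gcongr

end Parameters

/-! ### Base degrees of monomials -/

section BivariateExpansion

variable {F : Type*} [Field F]

/-- `f` is the value at `u` of a polynomial in `F[X][Y]` of degree at most `k` in `X`. -/
def HasExpansion (u : F[X]) (k : ℕ) (f : F[X]) : Prop :=
  ∃ P : F[X][X], P.eval u = f ∧ ∀ i, (P.coeff i).natDegree ≤ k

theorem HasExpansion.mul {u f g : F[X]} {k l : ℕ} (hf : HasExpansion u k f)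
    (hg : HasExpansion u l g) : HasExpansion u (k + l) (f * g) := by
  obtain ⟨P, rfl, hP⟩ := hf
  obtain ⟨R, rfl, hR⟩ := hg
  refine ⟨P * R, eval_mul, fun i => ?_⟩
  rw [coeff_mul]
  exact natDegree_sum_le_of_forall_le _ _ fun x _ =>
    natDegree_mul_le.trans (add_le_add (hP _) (hR _))

theorem HasExpansion.one (u : F[X]) : HasExpansion u 0 1 := by
  refine ⟨1, eval_one, fun i => ?_⟩
  rw [coeff_one]
  split_ifs <;> simp

theorem HasExpansion.pow {u f : F[X]} {k : ℕ} (hf : HasExpansion u k f) (j : ℕ) :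
    HasExpansion u (j * k) (f ^ j) := by
  induction j with
  | zero => simpa using HasExpansion.one u
  | succ j ih => rw [pow_succ, add_mul, one_mul]; exact ih.mul hf

/-- Since k < deg u, the coefficients of the expansion are themselves the base-u digits, by
uniqueness. -/
theorem HasExpansion.baseDegree_lt {u f : F[X]} {k l : ℕ} (hf : HasExpansion u k f)
    (hk : k < u.natDegree) (hl : k < l) : baseDegree u f < l := by
  obtain ⟨P, rfl, hP⟩ := hf
  have hu : 0 < u.degree := natDegree_pos_iff_degree_pos.1 (by omega)
  have hlt : ∀ i j, k < j → (P.coeff i).degree < j := fun i j hj =>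
    degree_le_natDegree.trans_lt (by exact_mod_cast (hP i).trans_lt hj)
  rw [baseDegree_lt_iff hu, eval_eq_sum_range]
  intro i
  rw [baseCoeff_sum hu _ (fun i => P.coeff i)]
  · exact hlt i l hl
  · intro i
    rw [degree_eq_natDegree (ne_zero_of_degree_gt hu)]
    exact hlt i _ hk
  · intro i hi
    exact coeff_eq_zero_of_natDegree_lt (by omega)

theorem baseDegree_scalingPoly_X_pow_lt [Finite F] {V : Subgroup Fˣ} {e k : ℕ}
    (he : e % Nat.card V < k) : baseDegree (scalingPoly V) (X ^ e) < k := by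
  have h : HasExpansion (scalingPoly V) (e % Nat.card V) (X ^ e) := by
    refine ⟨monomial (e / Nat.card V) (X ^ (e % Nat.card V)), ?_, fun i => ?_⟩
    · rw [eval_monomial, scalingPoly, ← pow_mul, ← pow_add, Nat.mod_add_div]
    · rw [coeff_monomial]
      split_ifs <;> simp
  exact h.baseDegree_lt (by rw [natDegree_scalingPoly]; exact Nat.mod_lt _ Nat.card_pos) he

variable {p m : ℕ} [Fact p.Prime] [CharP F p]

/-- With Q = p^m and g = X^Q - X, raising to the Q-th power is additive: (X + s(g))^Q = X^Q + s^Q(g)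
= X + (X + s^Q)(g). -/
theorem exists_X_pow_eq (i : ℕ) :
    ∃ s : F[X], (X : F[X]) ^ (p ^ m) ^ i = X + s.comp (X ^ p ^ m - X) := by
  induction i with
  | zero => exact ⟨0, by simp⟩
  | succ i ih =>
    obtain ⟨s, hs⟩ := ih
    refine ⟨X + s ^ p ^ m, ?_⟩
    rw [pow_succ, pow_mul, hs, add_pow_char_pow, add_comp, X_comp, pow_comp]
    ring

theorem hasExpansion_X_pow (i : ℕ) :
    HasExpansion (X ^ p ^ m - X) 1 ((X : F[X]) ^ (p ^ m) ^ i) := by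
  obtain ⟨s, hs⟩ := exists_X_pow_eq (F := F) (p := p) (m := m) i
  refine ⟨C X + s.map C, ?_, fun i => ?_⟩
  · rw [hs, eval_add, eval_C, eval_map, comp]
  · rw [coeff_add, coeff_map, coeff_C]
    refine natDegree_add_le_of_degree_le ?_ (by simp)
    split_ifs <;> simp

/-- Each X^(Q^i) costs degree 1 in X, so a digit d costs d; the shift i is carried along for the
induction on the digit list. -/
theorem hasExpansion_ofDigits (L : List ℕ) (i : ℕ) : HasExpansion (X ^ p ^ m - X) L.sum
    ((X : F[X]) ^ ((p ^ m) ^ i * Nat.ofDigits (p ^ m) L)) := by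
  induction L generalizing i with
  | nil => simpa using HasExpansion.one _
  | cons d L ih =>
    have h1 : (p ^ m) ^ i * Nat.ofDigits (p ^ m) (d :: L) =
        (p ^ m) ^ i * d + (p ^ m) ^ (i + 1) * Nat.ofDigits (p ^ m) L := by
      rw [Nat.ofDigits_cons, pow_succ]
      ring
    rw [h1, pow_add, pow_mul, List.sum_cons]
    have h2 := (hasExpansion_X_pow (F := F) (p := p) (m := m) i).pow d
    rw [mul_one] at h2
    exact h2.mul (ih (i + 1))

variable [Finite F]

/-- Both sides are monic of degree p^m and vanish on the p^m elements of the subfield. -/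
theorem translationPoly_addPart {N : ℕ} (hF : Nat.card F = p ^ N) (hN : m ∣ N) (hm : 1 ≤ m) :
    translationPoly (addPart F p m) = X ^ p ^ m - X := by
  classical
  have hp : 1 < p := (Fact.out : p.Prime).one_lt
  have hq : 1 < p ^ m := Nat.one_lt_pow (by omega) hp
  have := Fintype.ofFinite (addPart F p m)
  have hcard := card_addPart (F := F) hF hN hm
  have hmon : (translationPoly (addPart F p m)).Monic := by
    rw [translationPoly_eq_prod]
    exact monic_prod_of_monic _ _ fun u _ => monic_X_sub_C _
  have hX : (X ^ p ^ m - X : F[X]).Monic := monic_X_pow_sub (by rw [degree_X]; exact_mod_cast hq)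
  have hdeg : (translationPoly (addPart F p m)).degree = p ^ m := by
    rw [degree_eq_natDegree hmon.ne_zero, natDegree_translationPoly, hcard]
    simp
  have hdegX : (X ^ p ^ m - X : F[X]).degree = p ^ m := by
    rw [degree_sub_eq_left_of_degree_lt, degree_X_pow]
    · simp
    · rw [degree_X, degree_X_pow]
      exact_mod_cast hq
  by_contra hne
  have h1 := card_lt_ncard_support_add (x := (Subtype.val : addPart F p m → F))
    Subtype.val_injective (sub_ne_zero.2 hne) (k := p ^ m) (by
      have := degree_sub_lt_left (hdeg.trans hdegX.symm) hmon.ne_zero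
        (by rw [hmon.leadingCoeff, hX.leadingCoeff])
      rw [hdeg] at this
      exact_mod_cast this)
  have h2 : {u : addPart F p m | (translationPoly (addPart F p m) - (X ^ p ^ m - X)).eval (u : F) ≠ 0}
      = ∅ := by
    ext u
    have hu : (u : F) ^ p ^ m = u := u.2
    have h3 : (translationPoly (addPart F p m)).eval (u : F) = 0 := by
      rw [translationPoly_eq_prod, eval_prod]
      exact Finset.prod_eq_zero (Finset.mem_univ u) (by simp)
    simp [h3, hu]
  rw [h2, Set.ncard_empty, hcard] at h1
  omega

theorem baseDegree_translationPoly_X_pow_lt {N : ℕ} (hF : Nat.card F = p ^ N) (hN : m ∣ N)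
    (hm : 1 ≤ m) {e k : ℕ} (he : (Nat.digits (p ^ m) e).sum < k) (hk : k ≤ p ^ m) :
    baseDegree (translationPoly (addPart F p m)) (X ^ e) < k := by
  have h := hasExpansion_ofDigits (F := F) (p := p) (m := m) (Nat.digits (p ^ m) e) 0
  rw [Nat.ofDigits_digits, pow_zero, one_mul] at h
  refine HasExpansion.baseDegree_lt ?_ ?_ he
  · rwa [translationPoly_addPart hF hN hm]
  · rw [natDegree_translationPoly, card_addPart hF hN hm]
    omega

omit [Fact p.Prime] [CharP F p] in
theorem card_le_finrank_messageSpace {U : AddSubgroup F} {V : Subgroup Fˣ} {r : ℝ} {D : ℕ}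
    (S : Finset ℕ) (hS : ∀ e ∈ S, (X ^ e : F[X]) ∈ messageSpace U V r D) :
    S.card ≤ Module.finrank F (messageSpace U V r D) := by
  have : Module.Finite F (Polynomial.degreeLT F D) :=
    Module.Finite.equiv (Polynomial.degreeLTEquiv F D).symm
  have hle : messageSpace U V r D ≤ Polynomial.degreeLT F D := fun f hf =>
    Polynomial.mem_degreeLT.2 hf.1
  have : Module.Finite F (messageSpace U V r D) := Submodule.finiteDimensional_of_le hle
  have hli : LinearIndependent F fun e : S => (⟨X ^ (e : ℕ), hS e e.2⟩ : messageSpace U V r D) := by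
    refine LinearIndependent.of_comp (messageSpace U V r D).subtype ?_
    have h1 := (Polynomial.basisMonomials F).linearIndependent.comp _
      (Subtype.val_injective (p := fun e => e ∈ S))
    convert! h1 using 1
    ext e : 1
    simp [X_pow_eq_monomial]
  simpa using hli.fintype_card_le_finrank

end BivariateExpansion

/-! ### Counting exponents with small digit sum and small residue -/

section Counting

theorem digits_sum_add {Q : ℕ} (hQ : 1 < Q) {j : ℕ} (hj : j < Q) (e : ℕ) :
    (Nat.digits Q (j + Q * e)).sum = j + (Nat.digits Q e).sum := by
  rcases Nat.eq_zero_or_pos (j + Q * e) with h | h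
  · have h1 : j = 0 := by omega
    have h2 : e = 0 := by
      have : Q * e = 0 := by omega
      rcases Nat.mul_eq_zero.1 this with h | h <;> omega
    simp [h1, h2]
  · rw [Nat.digits_def' hQ h, List.sum_cons, Nat.add_mul_mod_self_left, Nat.mod_eq_of_lt hj,
      Nat.add_mul_div_left _ _ (by omega), Nat.div_eq_of_lt hj, zero_add]

theorem digits_sum_add_pow {Q : ℕ} (hQ : 1 < Q) (k : ℕ) {x : ℕ} (hx : x < Q ^ k) (t : ℕ) :
    (Nat.digits Q (x + Q ^ k * t)).sum = (Nat.digits Q x).sum + (Nat.digits Q t).sum := by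
  induction k generalizing x with
  | zero =>
    have : x = 0 := by simpa using hx
    simp [this]
  | succ k ih =>
    have h1 : x + Q ^ (k + 1) * t = x % Q + Q * (x / Q + Q ^ k * t) := by
      conv_lhs => rw [← Nat.mod_add_div x Q]
      ring
    have h2 : x / Q < Q ^ k := Nat.div_lt_of_lt_mul (by rwa [pow_succ'] at hx)
    have h3 := Nat.mod_lt x (show Q > 0 by omega)
    conv_rhs => rw [← Nat.mod_add_div x Q]
    rw [h1, digits_sum_add hQ h3, digits_sum_add hQ h3, ih h2, add_assoc]

theorem succ_pow_succ_le (N k : ℕ) : (N + 1) ^ (k + 1) ≤ N ^ (k + 1) + (k + 1) * (N + 1) ^ k := by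
  induction k with
  | zero => simp
  | succ k ih =>
    have h1 := Nat.mul_le_mul_left (N + 1) ih
    have h2 : N ^ (k + 1) ≤ (N + 1) ^ (k + 1) := Nat.pow_le_pow_left (by omega) _
    calc (N + 1) ^ (k + 2) = (N + 1) * (N + 1) ^ (k + 1) := by ring
      _ ≤ (N + 1) * (N ^ (k + 1) + (k + 1) * (N + 1) ^ k) := h1
      _ = N ^ (k + 2) + N ^ (k + 1) + (k + 1) * (N + 1) ^ (k + 1) := by ring
      _ ≤ N ^ (k + 2) + (N + 1) ^ (k + 1) + (k + 1) * (N + 1) ^ (k + 1) := by gcongr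
      _ = _ := by ring

/-- Discrete form of the integral of x^k; it drives the simplex count below. -/
theorem pow_succ_le_sum_range (N k : ℕ) :
    N ^ (k + 1) ≤ (k + 1) * ∑ j ∈ Finset.range N, (N - j) ^ k := by
  have h1 : ∑ j ∈ Finset.range N, (N - j) ^ k = ∑ j ∈ Finset.range N, (j + 1) ^ k := by
    rw [← Finset.sum_range_reflect]
    refine Finset.sum_congr rfl fun j hj => ?_
    have := Finset.mem_range.1 hj
    congr 1
    omega
  rw [h1]
  induction N with
  | zero => simp
  | succ N ih =>
    rw [Finset.sum_range_succ, mul_add]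
    refine (succ_pow_succ_le N k).trans (add_le_add_left (ih ?_) _)
    rw [← Finset.sum_range_reflect]
    refine Finset.sum_congr rfl fun j hj => ?_
    have := Finset.mem_range.1 hj
    congr 1
    omega

/-- The numbers with at most `k` base-`Q` digits and digit sum less than `N`. -/
def smallDigitSum (Q k N : ℕ) : Finset ℕ := {e ∈ Finset.range (Q ^ k) | (Nat.digits Q e).sum < N}

theorem mem_smallDigitSum {Q k N e : ℕ} :
    e ∈ smallDigitSum Q k N ↔ e < Q ^ k ∧ (Nat.digits Q e).sum < N := by
  simp [smallDigitSum]

/-- Lattice points in a simplex: as N ≤ Q, the digit sum bound already keeps every digit below Q.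
The induction splits off the lowest digit j and leaves the budget N - j. -/
theorem pow_le_card_smallDigitSum {Q : ℕ} (hQ : 1 < Q) (k : ℕ) {N : ℕ} (hN0 : 0 < N) (hN : N ≤ Q) :
    N ^ k ≤ k.factorial * (smallDigitSum Q k N).card := by
  induction k generalizing N with
  | zero =>
    have h0 : 0 ∈ smallDigitSum Q 0 N := by simpa [mem_smallDigitSum] using hN0
    simpa using Finset.card_pos.2 ⟨0, h0⟩
  | succ k ih =>
    have h1 : ∑ j ∈ Finset.range N, (smallDigitSum Q k (N - j)).card ≤
        (smallDigitSum Q (k + 1) N).card := by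
      rw [← Finset.card_sigma]
      refine Finset.card_le_card_of_injOn (fun x => x.1 + Q * x.2) ?_ ?_
      · rintro ⟨j, e⟩ h
        simp only [Finset.coe_sigma, Set.mem_sigma_iff, Finset.mem_coe, Finset.mem_range,
          mem_smallDigitSum] at h
        simp only [Finset.mem_coe, mem_smallDigitSum]
        rw [digits_sum_add hQ (by omega)]
        refine ⟨?_, by omega⟩
        calc j + Q * e < Q + Q * e := by omega
          _ = Q * (e + 1) := by ring
          _ ≤ Q * Q ^ k := Nat.mul_le_mul_left _ h.2.1
          _ = Q ^ (k + 1) := by ring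
      · rintro ⟨j, e⟩ h ⟨j', e'⟩ h' heq
        simp only [Finset.coe_sigma, Set.mem_sigma_iff, Finset.mem_coe, Finset.mem_range] at h h'
        simp only at heq
        have hj : j = j' := by
          have := congrArg (· % Q) heq
          simpa [Nat.mod_eq_of_lt (h.1.trans_le hN), Nat.mod_eq_of_lt (h'.1.trans_le hN)] using this
        subst hj
        have he : e = e' := Nat.eq_of_mul_eq_mul_left (show 0 < Q by omega) (by omega)
        subst he
        rfl
    calc N ^ (k + 1) ≤ (k + 1) * ∑ j ∈ Finset.range N, (N - j) ^ k := pow_succ_le_sum_range N k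
      _ ≤ (k + 1) * ∑ j ∈ Finset.range N, k.factorial * (smallDigitSum Q k (N - j)).card := by
          gcongr with j hj
          have := Finset.mem_range.1 hj
          exact ih (by omega) (by omega)
      _ = (k + 1).factorial * ∑ j ∈ Finset.range N, (smallDigitSum Q k (N - j)).card := by
          rw [← Finset.mul_sum, Nat.factorial_succ, mul_assoc]
      _ ≤ _ := Nat.mul_le_mul_left _ h1

/-- The progression b + Qy with y < p covers length pQ ≥ 2K, so after reaching a multiple of K it
has room to cross the window [0, k) of residues, in at least k/Q steps. -/
theorem div_le_card_window {Q K p k : ℕ} (hQ : 0 < Q) (hk : k ≤ K) (hK : 2 * K ≤ p * Q) (b : ℕ) :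
    k / Q ≤ Finset.card {y ∈ Finset.range p | (b + Q * y) % K < k} := by
  rcases Nat.eq_zero_or_pos K with rfl | hK0
  · simp [show k = 0 by omega]
  have hb := Nat.mod_lt b hK0
  set c := b % K
  -- The rounded-up quotient (K - c)/Q: the first y at which the progression passes K.
  set y₀ := (K - c + Q - 1) / Q
  have h1 : K - c ≤ Q * y₀ := by
    have := Nat.lt_mul_div_succ (K - c + Q - 1) hQ
    rw [mul_add, mul_one] at this
    change _ < Q * y₀ + Q at this
    omega
  have h2 : Q * y₀ < K - c + Q := by
    have : Q * y₀ ≤ _ := Nat.mul_div_le (K - c + Q - 1) Q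
    omega
  have h3 : ∀ i < k / Q, Q * i + Q ≤ k := by
    intro i hi
    have : Q * (i + 1) ≤ Q * (k / Q) := Nat.mul_le_mul_left _ hi
    have h4 := Nat.mul_div_le k Q
    rw [mul_add, mul_one] at this
    omega
  rw [← Finset.card_range (k / Q)]
  refine Finset.card_le_card_of_injOn (fun i => y₀ + i) ?_ fun i _ j _ hij => by simpa using hij
  intro i hi
  have hi' := h3 i (by simpa using hi)
  simp only [Finset.coe_filter, Finset.mem_range, Set.mem_ofPred_eq]
  constructor
  · refine lt_of_mul_lt_mul_left (a := Q) ?_ (Nat.zero_le _)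
    rw [mul_add, mul_comm Q p]
    omega
  · have h5 : (b + Q * (y₀ + i)) % K = (c + Q * (y₀ + i)) % K := by
      rw [Nat.add_mod, ← Nat.mod_mod b K, ← Nat.add_mod]
    rw [h5, mul_add, Nat.mod_eq_sub_mod (by omega), Nat.mod_eq_of_lt (by omega)]
    omega

/-- With Q = p^m, v supplies the lowest digit and m higher digits, under a simplex constraint; the
second digit is y + pz, and t < τ sits above Q^(m+2). The choices of v, z and t are free within the
digit budget N + pZ + τ, and y is reserved for steering e mod K into the window. -/
theorem card_good_exponents {p m K D N Z τ kU kV : ℕ} (hp : 1 < p) (hm : 1 ≤ m)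
    (hkV : kV ≤ K) (hK : 2 * K ≤ p * p ^ m) (hN0 : 0 < N) (hN : N ≤ p ^ m) (hZ : Z ≤ p ^ (m - 1))
    (hkU : N + p * Z + τ ≤ kU) (hτ : τ * (p ^ m) ^ (m + 2) ≤ D) :
    N ^ (m + 1) * (Z * τ * (kV / p ^ m)) ≤ (m + 1).factorial *
      Finset.card {e ∈ Finset.range D | (Nat.digits (p ^ m) e).sum < kU ∧ e % K < kV} := by
  set Q := p ^ m with hQdef
  have hQ : 1 < Q := Nat.one_lt_pow (by omega) hp
  have hQp : p * p ^ (m - 1) = Q := by rw [← pow_succ', Nat.sub_add_cancel hm]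
  have h1 := pow_le_card_smallDigitSum hQ (m + 1) hN0 hN
  refine (Nat.mul_le_mul_right _ h1).trans ?_
  rw [mul_assoc]
  refine Nat.mul_le_mul_left _ ?_
  set A := smallDigitSum Q (m + 1) N ×ˢ Finset.range Z ×ˢ Finset.range τ with hA
  -- The exponent with y = 0. Raising y by 1 adds Q to it, which is the progression of
  -- `div_le_card_window`.
  let base : ℕ × ℕ × ℕ → ℕ := fun x => x.1 % Q + Q * (p * x.2.1 + Q * (x.1 / Q + Q ^ m * x.2.2))
  let Y : ℕ × ℕ × ℕ → Finset ℕ := fun x => {y ∈ Finset.range p | (base x + Q * y) % K < kV}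
  have h2 : (smallDigitSum Q (m + 1) N).card * (Z * τ * (kV / Q)) ≤ (A.sigma Y).card := by
    rw [Finset.card_sigma]
    calc _ = ∑ _x ∈ A, kV / Q := by
          rw [Finset.sum_const, hA, Finset.card_product, Finset.card_product, Finset.card_range,
            Finset.card_range, smul_eq_mul]
          ring
      _ ≤ _ := Finset.sum_le_sum fun x _ => div_le_card_window (by omega) hkV hK (base x)
  refine h2.trans (Finset.card_le_card_of_injOn (fun x => base x.1 + Q * x.2) ?_ ?_)
  all_goals
    have hform : ∀ v z t y, base (v, z, t) + Q * y =
        v % Q + Q * ((y + p * z) + Q * (v / Q + Q ^ m * t)) := by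
      intro v z t y
      simp only [base]
      ring
    have hdig : ∀ y z, y < p → z < Z → y + p * z < Q := by
      intro y z hy hz
      have : p * (z + 1) ≤ p * p ^ (m - 1) := Nat.mul_le_mul_left _ (by omega)
      rw [mul_add, mul_one, hQp] at this
      omega
  · rintro ⟨⟨v, z, t⟩, y⟩ h
    simp only [A, Finset.coe_sigma, Set.mem_sigma_iff, Finset.mem_coe, Finset.mem_product,
      Finset.mem_range, mem_smallDigitSum, Y, Finset.mem_filter] at h
    obtain ⟨⟨⟨hv, hvs⟩, hz, ht⟩, hy, hmod⟩ := h
    simp only [Finset.coe_filter, Finset.mem_range, Set.mem_ofPred_eq]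
    refine ⟨?_, ?_, hmod⟩
    all_goals
      have hv' : v / Q < Q ^ m := Nat.div_lt_of_lt_mul (by rwa [pow_succ'] at hv)
      have hvQ := Nat.mod_lt v (show Q > 0 by omega)
      have hyz := hdig y z hy hz
      rw [hform]
    · refine lt_of_lt_of_le ?_ hτ
      have e1 : v / Q + Q ^ m * t + 1 ≤ Q ^ m * τ := by
        have : Q ^ m * (t + 1) ≤ Q ^ m * τ := Nat.mul_le_mul_left _ ht
        rw [mul_add, mul_one] at this
        omega
      have e2 : (y + p * z) + Q * (v / Q + Q ^ m * t) + 1 ≤ Q * (Q ^ m * τ) := by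
        have := Nat.mul_le_mul_left Q e1
        rw [mul_add, mul_one] at this
        omega
      have e3 : v % Q + Q * ((y + p * z) + Q * (v / Q + Q ^ m * t)) < Q * (Q * (Q ^ m * τ)) := by
        have := Nat.mul_le_mul_left Q e2
        rw [mul_add Q _ 1, mul_one] at this
        omega
      refine e3.trans_le (le_of_eq ?_)
      ring
    · rw [digits_sum_add hQ hvQ, digits_sum_add hQ hyz, digits_sum_add_pow hQ m hv']
      have e1 : (Nat.digits Q v).sum = v % Q + (Nat.digits Q (v / Q)).sum := by
        conv_lhs => rw [← Nat.mod_add_div v Q]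
        exact digits_sum_add hQ hvQ _
      have e2 := Nat.digit_sum_le Q t
      have e3 : p * (z + 1) ≤ p * Z := Nat.mul_le_mul_left _ hz
      rw [mul_add, mul_one] at e3
      omega
  · rintro ⟨⟨v, z, t⟩, y⟩ h ⟨⟨v', z', t'⟩, y'⟩ h' heq
    simp only [A, Finset.coe_sigma, Set.mem_sigma_iff, Finset.mem_coe, Finset.mem_product,
      Finset.mem_range, mem_smallDigitSum, Y, Finset.mem_filter] at h h'
    obtain ⟨⟨⟨hv, hvs⟩, hz, ht⟩, hy, hmod⟩ := h
    obtain ⟨⟨⟨hv', hvs'⟩, hz', ht'⟩, hy', hmod'⟩ := h'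
    have split : ∀ {b i i' j j' : ℕ}, i < b → i' < b → i + b * j = i' + b * j' → i = i' ∧ j = j' := by
      intro b i i' j j' hi hi' h
      have h1 : i = i' := by
        have := congrArg (· % b) h
        simpa [Nat.mod_eq_of_lt hi, Nat.mod_eq_of_lt hi'] using this
      subst h1
      exact ⟨rfl, Nat.eq_of_mul_eq_mul_left (show 0 < b by omega) (by omega)⟩
    simp only [hform] at heq
    have hQ0 : Q > 0 := by omega
    obtain ⟨e1, e2⟩ := split (Nat.mod_lt v hQ0) (Nat.mod_lt v' hQ0) heq
    obtain ⟨e3, e4⟩ := split (hdig y z hy hz) (hdig y' z' hy' hz') e2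
    obtain ⟨rfl, rfl⟩ := split hy hy' e3
    obtain ⟨e5, rfl⟩ := split (Nat.div_lt_of_lt_mul (by rwa [pow_succ'] at hv))
      (Nat.div_lt_of_lt_mul (by rwa [pow_succ'] at hv')) e4
    obtain rfl : v = v' := by rw [← Nat.mod_add_div v Q, ← Nat.mod_add_div v' Q, e1, e5]
    rfl

end Counting

/-! ### Limits along the admissible primes and comparison of rate constants -/

section Asymptotics

variable {m a : ℕ}

theorem eventually_admissible (a : ℕ) : ∀ᶠ p in admissibleAtTop a, p ∈ admissible a :=
  mem_inf_of_right (mem_principal_self _)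

theorem tendsto_natCast_admissibleAtTop (a : ℕ) :
    Tendsto (fun p : ℕ => (p : ℝ)) (admissibleAtTop a) atTop :=
  tendsto_natCast_atTop_atTop.mono_left inf_le_left

theorem tendsto_natCast_pow_admissibleAtTop (a : ℕ) {k : ℕ} (hk : k ≠ 0) :
    Tendsto (fun p : ℕ => (p : ℝ) ^ k) (admissibleAtTop a) atTop :=
  (tendsto_pow_atTop hk).comp (tendsto_natCast_admissibleAtTop a)

theorem admissibleAtTop_neBot (ha : a ≠ 0) : (admissibleAtTop a).NeBot := by
  refine frequently_mem_iff_neBot.1 (frequently_atTop.2 fun n => ?_)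
  obtain ⟨p, hp, hnp, hpa⟩ := Nat.exists_prime_gt_modEq_one n ha
  exact ⟨p, hnp.le, hp, (Nat.modEq_iff_dvd' hp.one_lt.le).1 hpa.symm⟩

theorem cast_mulOrder {p : ℕ} (hp : p ∈ admissible a) (ha : a ≠ 0) :
    (mulOrder m a p : ℝ) = 1 / (a : ℝ) * ((p : ℝ) ^ (m + 1) - 1) := by
  have h1 := mul_mulOrder (m := m) hp.2
  have h2 : 1 ≤ p ^ (m + 1) := Nat.one_le_pow _ _ hp.1.pos
  have h3 : (a : ℝ) * mulOrder m a p = (p : ℝ) ^ (m + 1) - 1 := by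
    have := congrArg (Nat.cast (R := ℝ)) h1
    push_cast [Nat.cast_sub h2] at this
    exact this
  have ha' : (a : ℝ) ≠ 0 := by exact_mod_cast ha
  rw [← h3]
  field_simp

theorem tendsto_mulOrder_div (ha : a ≠ 0) :
    Tendsto (fun p : ℕ => (mulOrder m a p : ℝ) / (p : ℝ) ^ (m + 1)) (admissibleAtTop a)
      (𝓝 (1 / (a : ℝ))) := by
  have h1 : Tendsto (fun p : ℕ => 1 / (a : ℝ) * (1 - ((p : ℝ) ^ (m + 1))⁻¹)) (admissibleAtTop a)
      (𝓝 (1 / (a : ℝ) * (1 - 0))) :=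
    ((tendsto_natCast_pow_admissibleAtTop a m.succ_ne_zero).inv_tendsto_atTop.const_sub
      1).const_mul _
  rw [sub_zero, mul_one] at h1
  refine h1.congr' ?_
  filter_upwards [eventually_admissible a] with p hp
  have h0 : (p : ℝ) ≠ 0 := by exact_mod_cast hp.1.ne_zero
  rw [cast_mulOrder hp ha]
  field_simp

theorem cast_blockLength (p : ℕ) :
    (blockLength m a p : ℝ) = (p : ℝ) ^ (m * (m + 1)) * mulOrder m a p := by
  rw [blockLength]
  push_cast
  rfl

theorem blockLength_isEquivalent (ha : a ≠ 0) :
    (fun p => (blockLength m a p : ℝ)) ~[admissibleAtTop a]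
      (fun p => 1 / (a : ℝ) * (p : ℝ) ^ ((m + 1) ^ 2)) := by
  have ha' : (a : ℝ) ≠ 0 := by exact_mod_cast ha
  refine isEquivalent_of_tendsto_one ?_
  have h1 := (tendsto_mulOrder_div (m := m) ha).const_mul (a : ℝ)
  rw [mul_one_div_cancel ha'] at h1
  refine h1.congr' ?_
  filter_upwards [eventually_admissible a] with p hp
  have h0 : (p : ℝ) ≠ 0 := by exact_mod_cast hp.1.ne_zero
  simp only [Pi.div_apply]
  rw [cast_blockLength]
  field_simp
  ring

/-- n has order p^((m+1)²), so n^s has order p^k exactly when (m+1)² s = k. -/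
theorem pow_isTheta_blockLength (ha : a ≠ 0) {k : ℕ} {s : ℝ}
    (hs : ((m : ℝ) + 1) ^ 2 * s = k) :
    (fun p : ℕ => (p : ℝ) ^ k) =Θ[admissibleAtTop a] (fun p => (blockLength m a p : ℝ) ^ s) := by
  have ha' : 1 / (a : ℝ) ≠ 0 := by
    have : (a : ℝ) ≠ 0 := by exact_mod_cast ha
    positivity
  have h1 : (fun p : ℕ => (p : ℝ) ^ ((m + 1) ^ 2)) =Θ[admissibleAtTop a]
      (fun p => (blockLength m a p : ℝ)) :=
    ((isTheta_const_mul_left ha').2 (isTheta_refl _ _)).symm.trans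
      (blockLength_isEquivalent (m := m) ha).isTheta.symm
  have h2 := h1.rpow (r := s) (Eventually.of_forall fun p => by simp only [Pi.zero_apply]; positivity)
    (Eventually.of_forall fun p => by simp only [Pi.zero_apply]; positivity)
  refine IsTheta.trans (EventuallyEq.isTheta (Eventually.of_forall fun p => ?_)) h2
  simp only
  rw [← Real.rpow_natCast (p : ℝ) ((m + 1) ^ 2), ← Real.rpow_mul (Nat.cast_nonneg p),
    ← Real.rpow_natCast]
  congr 1
  push_cast
  exact hs.symm

theorem pow_sub_one_isTheta {γ : ℝ} (hγ : γ ≠ 0) :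
    (fun p : ℕ => γ * ((p : ℝ) ^ (m + 1) - 1)) =Θ[admissibleAtTop a]
      (fun p => (p : ℝ) ^ (m + 1)) := by
  refine (isTheta_const_mul_left hγ).2 (IsEquivalent.isTheta ?_)
  refine isEquivalent_of_tendsto_one ?_
  have h1 : Tendsto (fun p : ℕ => 1 - ((p : ℝ) ^ (m + 1))⁻¹) (admissibleAtTop a) (𝓝 (1 - 0)) :=
    (tendsto_natCast_pow_admissibleAtTop a m.succ_ne_zero).inv_tendsto_atTop.const_sub 1
  rw [sub_zero] at h1
  refine h1.congr' ?_
  filter_upwards [eventually_admissible a] with p hp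
  have h0 : (p : ℝ) ≠ 0 := by exact_mod_cast hp.1.ne_zero
  simp only [Pi.div_apply]
  field_simp

/-- Roundings by floors, ceilings and integer division vanish on division by a quantity tending to
infinity. -/
theorem tendsto_div_of_near {l : Filter ℕ} {f : ℕ → ℕ} {g y : ℕ → ℝ} {c : ℝ}
    (hy : Tendsto y l atTop) (hg : Tendsto (fun p => g p / y p) l (𝓝 c))
    (hfg : ∀ᶠ p in l, |(f p : ℝ) - g p| ≤ 1) : Tendsto (fun p => (f p : ℝ) / y p) l (𝓝 c) := by
  have h1 : Tendsto (fun p => ((f p : ℝ) - g p) / y p) l (𝓝 0) := by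
    refine squeeze_zero_norm' ?_ hy.inv_tendsto_atTop
    filter_upwards [hfg, hy.eventually_gt_atTop 0] with p hp hy0
    rw [norm_div, Real.norm_eq_abs, Real.norm_of_nonneg hy0.le, Pi.inv_apply, ← one_div]
    gcongr
  have h2 := h1.add hg
  rw [zero_add] at h2
  refine h2.congr fun p => ?_
  ring

theorem abs_floor_sub_le {x : ℝ} (hx : 0 ≤ x) : |(⌊x⌋₊ : ℝ) - x| ≤ 1 := by
  have h1 := Nat.floor_le hx
  have h2 := Nat.lt_floor_add_one x
  rw [abs_le]
  constructor <;> linarith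

theorem abs_div_sub_le (x y : ℕ) : |((x / y : ℕ) : ℝ) - (x : ℝ) / y| ≤ 1 := by
  rw [← Nat.floor_div_eq_div (K := ℝ)]
  exact abs_floor_sub_le (by positivity)

theorem abs_ceil_div_sub_le {x : ℝ} (hx : 0 ≤ x) (y : ℕ) (hy : 0 < y) :
    |((⌈x⌉₊ / y : ℕ) : ℝ) - x / y| ≤ 1 := by
  have hy' : (0 : ℝ) < y := by exact_mod_cast hy
  have h1 := Nat.le_ceil x
  have h2 := Nat.ceil_lt_add_one hx
  have h3 : x / y ≤ (⌈x⌉₊ : ℝ) / y := by gcongr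
  have h4 : (⌈x⌉₊ : ℝ) / y < ((⌈x⌉₊ / y : ℕ) : ℝ) + 1 := by
    rw [← Nat.floor_div_eq_div (K := ℝ)]
    exact Nat.lt_floor_add_one _
  have h5 : ((⌈x⌉₊ / y : ℕ) : ℝ) ≤ x / y + 1 := by
    refine (Nat.cast_div_le).trans ?_
    rw [div_add_one hy'.ne']
    gcongr
    have : (1 : ℝ) ≤ y := by exact_mod_cast hy
    linarith
  rw [abs_le]
  constructor <;> linarith

/-- The lower bound for the number of monomials of the message space. -/
noncomputable def monomialCount (m a : ℕ) (r : ℝ) (D : ℕ → ℕ) (p : ℕ) : ℝ :=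
  (⌊r / 2 * (p : ℝ) ^ m⌋₊ : ℝ) ^ (m + 1) *
    (⌊r / 4 * (p : ℝ) ^ (m - 1)⌋₊ * (D p / (p ^ m) ^ (m + 2) : ℕ) *
      (⌈r * mulOrder m a p⌉₊ / p ^ m : ℕ)) / (m + 1).factorial

/-- The factors have orders p^(m(m+1)), p^(m-1), p and p, whose product has the order p^((m+1)²) of
n. -/
theorem tendsto_monomialCount {r ρ : ℝ} (hm : 2 ≤ m) (ha : a ≠ 0) (hr0 : 0 < r) {D : ℕ → ℕ}
    (hDρ : Tendsto (fun p => (D p : ℝ) / blockLength m a p) (admissibleAtTop a) (𝓝 ρ)) :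
    Tendsto (fun p => monomialCount m a r D p / blockLength m a p) (admissibleAtTop a)
      (𝓝 ((r / 2) ^ (m + 1) * (r / 4 * (ρ * (1 / a)) * (r * (1 / a))) / (m + 1).factorial /
        (1 / a))) := by
  have hK := tendsto_mulOrder_div (m := m) ha
  have ha' : 1 / (a : ℝ) ≠ 0 := by
    have : (a : ℝ) ≠ 0 := by exact_mod_cast ha
    positivity
  have h0 : ∀ᶠ p : ℕ in admissibleAtTop a, (p : ℝ) ≠ 0 := by
    filter_upwards [eventually_admissible a] with p hp
    exact_mod_cast hp.1.ne_zero
  have hK0 : ∀ᶠ p : ℕ in admissibleAtTop a, (mulOrder m a p : ℝ) ≠ 0 := by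
    filter_upwards [eventually_admissible a] with p hp
    have := pow_lt_mulOrder (m := m) (by omega) hp.1.one_lt hp.2
    exact_mod_cast (by omega)
  have h1 : Tendsto (fun p : ℕ => (⌊r / 2 * (p : ℝ) ^ m⌋₊ : ℝ) / (p : ℝ) ^ m) (admissibleAtTop a)
      (𝓝 (r / 2)) := by
    refine tendsto_div_of_near (g := fun p => r / 2 * (p : ℝ) ^ m)
      (tendsto_natCast_pow_admissibleAtTop a (by omega)) ?_
      (Eventually.of_forall fun p => abs_floor_sub_le (by positivity))
    refine tendsto_const_nhds.congr' ?_
    filter_upwards [h0] with p hp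
    field_simp
  have h2 : Tendsto (fun p : ℕ => (⌊r / 4 * (p : ℝ) ^ (m - 1)⌋₊ : ℝ) / (p : ℝ) ^ (m - 1))
      (admissibleAtTop a) (𝓝 (r / 4)) := by
    refine tendsto_div_of_near (g := fun p => r / 4 * (p : ℝ) ^ (m - 1))
      (tendsto_natCast_pow_admissibleAtTop a (by omega)) ?_
      (Eventually.of_forall fun p => abs_floor_sub_le (by positivity))
    refine tendsto_const_nhds.congr' ?_
    filter_upwards [h0] with p hp
    field_simp
  have h3 : Tendsto (fun p : ℕ => ((D p / (p ^ m) ^ (m + 2) : ℕ) : ℝ) / p)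
      (admissibleAtTop a) (𝓝 (ρ * (1 / a))) := by
    refine tendsto_div_of_near (g := fun p => (D p : ℝ) / ((p ^ m) ^ (m + 2) : ℕ))
      (tendsto_natCast_admissibleAtTop a) ?_
      (Eventually.of_forall fun p => abs_div_sub_le _ _)
    refine (hDρ.mul hK).congr' ?_
    filter_upwards [h0, hK0] with p hp hKp
    rw [cast_blockLength]
    push_cast
    field_simp
    ring
  have h4 : Tendsto (fun p : ℕ => ((⌈r * mulOrder m a p⌉₊ / p ^ m : ℕ) : ℝ) / p)
      (admissibleAtTop a) (𝓝 (r * (1 / a))) := by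
    refine tendsto_div_of_near (g := fun p => r * mulOrder m a p / (p ^ m : ℕ))
      (tendsto_natCast_admissibleAtTop a) ?_ ?_
    · refine (hK.const_mul r).congr' ?_
      filter_upwards [h0] with p hp
      push_cast
      field_simp
      ring
    · filter_upwards [eventually_admissible a] with p hp
      exact abs_ceil_div_sub_le (by positivity) _ (pow_pos hp.1.pos _)
  refine ((((h1.pow (m + 1)).mul ((h2.mul h3).mul h4)).div_const
    ((m + 1).factorial : ℝ)).div hK ha').congr' ?_
  filter_upwards [h0, hK0] with p hp hKp
  obtain ⟨k, rfl⟩ : ∃ k, m = k + 1 := ⟨m - 1, by omega⟩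
  rw [cast_blockLength, monomialCount]
  simp only [Nat.add_sub_cancel, div_pow, Pi.div_apply]
  generalize (⌊r / 2 * (p : ℝ) ^ (k + 1)⌋₊ : ℝ) = A
  generalize (⌊r / 4 * (p : ℝ) ^ k⌋₊ : ℝ) = B
  generalize ((D p / (p ^ (k + 1)) ^ (k + 1 + 2) : ℕ) : ℝ) = E
  generalize ((⌈r * mulOrder (k + 1) a p⌉₊ / p ^ (k + 1) : ℕ) : ℝ) = G
  have hf : (((k + 1 + 1).factorial : ℕ) : ℝ) ≠ 0 := by positivity
  field_simp
  ring

theorem pow_sub_pow_le {r b : ℝ} (hb : 0 ≤ b) (hbr : b ≤ r) (k : ℕ) :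
    r ^ (k + 1) - b ^ (k + 1) ≤ (k + 1) * r ^ k * (r - b) := by
  induction k with
  | zero => simp
  | succ k ih =>
    have h1 : b ^ (k + 1) ≤ r ^ (k + 1) := by gcongr
    have h2 := mul_le_mul_of_nonneg_left ih (hb.trans hbr)
    have h3 := mul_le_mul_of_nonneg_right h1 (sub_nonneg.2 hbr)
    push_cast
    calc r ^ (k + 1 + 1) - b ^ (k + 1 + 1)
        = r * (r ^ (k + 1) - b ^ (k + 1)) + b ^ (k + 1) * (r - b) := by ring
      _ ≤ r * (((k : ℝ) + 1) * r ^ k * (r - b)) + r ^ (k + 1) * (r - b) := add_le_add h2 h3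
      _ = _ := by ring

/-- For m ≥ 2 one has m + 3 ≤ 2m + 1, (m+1)! ≤ (2m-1)! and 4 ≤ 2m. -/
theorem factorial_bound (hm : 2 ≤ m) :
    2 ^ (m + 3) * (m + 1).factorial ≤ 2 ^ (2 * m - 1) * (2 * m).factorial := by
  have h1 : (m + 1).factorial ≤ (2 * m - 1).factorial := Nat.factorial_le (by omega)
  have h2 : (2 * m).factorial = 2 * m * (2 * m - 1).factorial :=
    (Nat.mul_factorial_pred (by omega)).symm
  calc 2 ^ (m + 3) * (m + 1).factorial ≤ 2 ^ (2 * m - 1 + 2) * (2 * m - 1).factorial :=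
        Nat.mul_le_mul (Nat.pow_le_pow_right (by omega) (by omega)) h1
    _ = 2 ^ (2 * m - 1) * (4 * (2 * m - 1).factorial) := by ring
    _ ≤ 2 ^ (2 * m - 1) * (2 * m * (2 * m - 1).factorial) := by gcongr; omega
    _ = _ := by rw [h2]

/-- The right side is γρ r^(m+3) / (2^(m+3) (m+1)!). On the left, the difference of powers is at
most (2m+1) r^(2m) ρ, and γ ≤ 1/2 turns γ^(2m) into γ/2^(2m-1); `factorial_bound` compares what
remains. -/
theorem rate_constant_le {r ρ : ℝ} (hm : 2 ≤ m) (ha : 2 ≤ a) (hr0 : 0 < r) (hr1 : r < 1)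
    (hρ0 : 0 < ρ) :
    (1 / (a : ℝ)) ^ (2 * m) * r / ((2 * m + 1).factorial : ℝ) *
        (r ^ (2 * m + 1) - (max 0 (r - ρ)) ^ (2 * m + 1)) ≤
      (r / 2) ^ (m + 1) * (r / 4 * (ρ * (1 / a)) * (r * (1 / a))) / (m + 1).factorial / (1 / a) := by
  have ha0 : (0 : ℝ) < a := by exact_mod_cast (by omega : 0 < a)
  set γ : ℝ := 1 / a with hγ
  have hγ0 : 0 < γ := by positivity
  have hγ2 : γ ≤ 1 / 2 := by
    rw [hγ]
    gcongr
    exact_mod_cast ha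
  have h1 : r ^ (2 * m + 1) - (max 0 (r - ρ)) ^ (2 * m + 1) ≤ (2 * m + 1) * r ^ (m + 2) * ρ := by
    have h := pow_sub_pow_le (le_max_left 0 (r - ρ)) (max_le hr0.le (by linarith)) (2 * m)
    refine h.trans ?_
    push_cast
    have h2 : r ^ (2 * m) ≤ r ^ (m + 2) := pow_le_pow_of_le_one hr0.le hr1.le (by omega)
    have h3 : r - max 0 (r - ρ) ≤ ρ := by linarith [le_max_right 0 (r - ρ)]
    calc (2 * (m : ℝ) + 1) * r ^ (2 * m) * (r - max 0 (r - ρ))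
        ≤ (2 * (m : ℝ) + 1) * r ^ (2 * m) * ρ := by gcongr
      _ ≤ _ := by gcongr
  have h2 : γ ^ (2 * m) ≤ γ * (1 / 2) ^ (2 * m - 1) := by
    obtain ⟨k, hk⟩ : ∃ k, 2 * m = k + 1 := ⟨2 * m - 1, by omega⟩
    rw [hk, pow_succ', Nat.add_sub_cancel]
    gcongr
  have hfac : ((2 * m + 1).factorial : ℝ) = (2 * m + 1) * (2 * m).factorial := by
    rw [Nat.factorial_succ]
    push_cast
    ring
  have hfb : (2 : ℝ) ^ (m + 3) * (m + 1).factorial ≤ 2 ^ (2 * m - 1) * (2 * m).factorial := by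
    exact_mod_cast factorial_bound hm
  calc γ ^ (2 * m) * r / ((2 * m + 1).factorial : ℝ) *
        (r ^ (2 * m + 1) - (max 0 (r - ρ)) ^ (2 * m + 1))
      ≤ (γ * (1 / 2) ^ (2 * m - 1)) * r / ((2 * m + 1).factorial : ℝ) *
        ((2 * m + 1) * r ^ (m + 2) * ρ) := by
        gcongr
        exact sub_nonneg.2 (pow_le_pow_left₀ (le_max_left _ _) (max_le hr0.le (by linarith)) _)
    _ = γ * r ^ (m + 3) * ρ / (2 ^ (2 * m - 1) * (2 * m).factorial) := by
        rw [hfac, one_div_pow]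
        have : ((2 * m).factorial : ℝ) ≠ 0 := by positivity
        field_simp
        ring
    _ ≤ γ * r ^ (m + 3) * ρ / (2 ^ (m + 3) * (m + 1).factorial) := by
        gcongr
    _ = _ := by
        have : ((m + 1).factorial : ℝ) ≠ 0 := by positivity
        rw [div_pow]
        field_simp
        ring

end Asymptotics

/-! ### Rate and distance of the local codes -/

section LocalCodes

variable {F : Type*} [Field F] [Finite F] {U : AddSubgroup F} {V : Subgroup Fˣ} {r ε : ℝ} {α : F}

theorem leftLocalCode_bounds (hr0 : 0 < r) (hε : 0 < ε) (hcard : 1 ≤ ε * Nat.card U)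
    (hα : HasTrivialStabilizer U V α) (v : LeftVertex U V) :
    rate (leftLocalCode U V r α v) ≤ r + ε ∧ 1 - r - ε ≤ relDist (leftLocalCode U V r α v) := by
  have : Nonempty {φ : genGroup U V // leftEnd U V φ = v} :=
    (leftEnd_surjective v).elim fun φ hφ => ⟨φ, hφ⟩
  rw [← card_leftEnd_fibre v] at hcard
  rw [leftLocalCode, ← card_leftEnd_fibre v]
  refine ⟨rate_rsCode_le _ hr0.le hcard, ?_⟩
  have h1 := relDist_rsCode_ge
    (x := fun φ : {φ : genGroup U V // leftEnd U V φ = v} => (edgePoint U V α φ.1 : F))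
    (hα.injective.comp Subtype.val_injective) hr0
  linarith

theorem rightLocalCode_bounds (hr0 : 0 < r) (hε : 0 < ε) (hcard : 1 ≤ ε * Nat.card V)
    (hα : HasTrivialStabilizer U V α) (v : RightVertex U V) :
    rate (rightLocalCode U V r α v) ≤ r + ε ∧ 1 - r - ε ≤ relDist (rightLocalCode U V r α v) := by
  have : Nonempty {φ : genGroup U V // rightEnd U V φ = v} :=
    (rightEnd_surjective v).elim fun φ hφ => ⟨φ, hφ⟩
  rw [← card_rightEnd_fibre v] at hcard
  rw [rightLocalCode, ← card_rightEnd_fibre v]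
  refine ⟨rate_rsCode_le _ hr0.le hcard, ?_⟩
  have h1 := relDist_rsCode_ge
    (x := fun φ : {φ : genGroup U V // rightEnd U V φ = v} => (edgePoint U V α φ.1 : F))
    (hα.injective.comp Subtype.val_injective) hr0
  linarith

end LocalCodes

/-! ### Explicit spectral and dimension bounds -/

section Instance

variable {F : Type*} [Field F] [Finite F] {p : ℕ} [Fact p.Prime] [CharP F p] {m a N : ℕ}

/-- The bound for the second largest singular value of the coset graph. -/
noncomputable def sigmaBound (m a p : ℕ) : ℝ :=
  √(1 / p + √((p : ℝ) ^ (m + 1)) / mulOrder m a p)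

theorem isExpander_coset (hm : 1 ≤ m) (ha : a ∣ p - 1) (hF : Nat.card F = p ^ N)
    (hN : m * (m + 1) ∣ N) [Fintype (genGroup (addPart F p m) (mulPart F m a p))]
    [DecidableEq (LeftVertex (addPart F p m) (mulPart F m a p))] :
    IsExpander (leftEnd (addPart F p m) (mulPart F m a p))
      (rightEnd (addPart F p m) (mulPart F m a p)) (Nat.card (addPart F p m))
      (Nat.card (mulPart F m a p)) (sigmaBound m a p) := by
  have hp : 1 < p := (Fact.out : p.Prime).one_lt
  have := Fintype.ofFinite (addPart F p m)
  have := Fintype.ofFinite (mulPart F m a p)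
  have h := isProductSpan (F := F) hm ha hF hN
  refine h.isExpander (norm_sum_char_le hm ha hF hN h) (le_of_eq ?_)
  have hK : (mulOrder m a p : ℝ) ≠ 0 := by
    have := pow_lt_mulOrder hm hp ha
    exact_mod_cast (by omega)
  rw [card_addPart hF ((Dvd.intro _ rfl).trans hN) hm, card_mulPart ha hF hN, sigmaBound,
    Real.sq_sqrt (by positivity)]
  push_cast
  field_simp

omit [Fact p.Prime] in
-- With q = √(p^(m+1)), |H| is at least γq²/2, and m ≥ 2 gives q ≥ p√p. Thus q/|H| ≤ 2/(γq) ≤ ε/p.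
theorem sigmaBound_le {ε γ : ℝ} (hm : 2 ≤ m) (ha : a ≠ 0) (hp : p ∈ admissible a)
    (hγ : γ = 1 / (a : ℝ)) (hε : 0 < ε) (hpε : 2 / (γ * ε) ≤ √(p : ℝ)) :
    sigmaBound m a p ≤ (1 + ε) / √(p : ℝ) := by
  have hγ0 : 0 < γ := by
    have : (0 : ℝ) < a := by exact_mod_cast Nat.pos_of_ne_zero ha
    rw [hγ]
    positivity
  have hp1 : (2 : ℝ) ≤ p := by exact_mod_cast hp.1.two_le
  have hp0 : (0 : ℝ) < p := by linarith
  have hs0 : 0 < √(p : ℝ) := Real.sqrt_pos.2 hp0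
  set q : ℝ := √((p : ℝ) ^ (m + 1)) with hq
  have hqsq : q ^ 2 = (p : ℝ) ^ (m + 1) := Real.sq_sqrt (by positivity)
  have hpq : p * √(p : ℝ) ≤ q := by
    rw [hq]
    refine Real.le_sqrt_of_sq_le ?_
    rw [mul_pow, Real.sq_sqrt hp0.le, ← pow_succ]
    exact pow_le_pow_right₀ (by linarith) (by omega)
  have hq0 : 0 < q := lt_of_lt_of_le (by positivity) hpq
  have hpow : (2 : ℝ) ≤ (p : ℝ) ^ (m + 1) :=
    hp1.trans (le_self_pow₀ (by linarith) (by omega))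
  have hK : γ * (q ^ 2 / 2) ≤ mulOrder m a p := by
    rw [cast_mulOrder hp ha, ← hγ, hqsq]
    exact mul_le_mul_of_nonneg_left (by linarith) hγ0.le
  have hK0 : (0 : ℝ) < mulOrder m a p := lt_of_lt_of_le (by positivity) hK
  have h1 : q / mulOrder m a p ≤ ε / p := by
    rw [div_le_div_iff₀ hK0 hp0]
    rw [div_le_iff₀ (by positivity)] at hpε
    have h2 : 2 * (p : ℝ) ≤ γ * ε * q := by
      calc 2 * (p : ℝ) ≤ √p * (γ * ε) * p := by gcongr
        _ = γ * ε * (p * √p) := by ring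
        _ ≤ γ * ε * q := by gcongr
    calc q * p = q * (2 * p) / 2 := by ring
      _ ≤ q * (γ * ε * q) / 2 := by gcongr
      _ = ε * (γ * (q ^ 2 / 2)) := by ring
      _ ≤ ε * mulOrder m a p := by gcongr
  refine Real.sqrt_le_iff.2 ⟨by positivity, ?_⟩
  rw [div_pow, Real.sq_sqrt hp0.le]
  calc 1 / (p : ℝ) + q / mulOrder m a p ≤ 1 / p + ε / p := by gcongr
    _ = (1 + ε) / p := by ring
    _ ≤ (1 + ε) ^ 2 / p := by
        gcongr
        nlinarith

/-- The digit budget r p^m is spent as r/2 on the simplex, r/4 on the second digit and r/4 on the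
top part t; the last share suffices because t < τ ≤ p ≤ (r/4) p^m. -/
theorem monomialCount_le_finrank {r : ℝ} (hm : 2 ≤ m) (ha2 : 2 ≤ a) (ha : a ∣ p - 1)
    (hF : Nat.card F = p ^ N) (hN : m * (m + 1) ∣ N) (hr0 : 0 < r) (hr1 : r < 1) {D : ℕ → ℕ}
    (hD : D p ≤ blockLength m a p) (hpr : 4 ≤ r * (p : ℝ) ^ (m - 1)) :
    monomialCount m a r D p ≤
      Module.finrank F (messageSpace (addPart F p m) (mulPart F m a p) r (D p)) := by
  have hp : 1 < p := (Fact.out : p.Prime).one_lt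
  have hp0 : (0 : ℝ) < p := by positivity
  have hU := card_addPart (F := F) hF ((Dvd.intro _ rfl).trans hN) (show 0 < m by omega)
  have hV := card_mulPart (F := F) (m := m) ha hF hN
  have haK := mul_mulOrder (m := m) ha
  have hQ : (p : ℝ) ^ m = p * (p : ℝ) ^ (m - 1) := by
    rw [← pow_succ', Nat.sub_add_cancel (by omega)]
  -- Here a ≥ 2 is used: the window argument needs H to have at most half of p^(m+1) elements.
  have h2K : 2 * mulOrder m a p ≤ p * p ^ m := by
    rw [← pow_succ']
    have := Nat.mul_le_mul_right (mulOrder m a p) ha2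
    omega
  have hp1 : (1 : ℝ) ≤ (p : ℝ) := by exact_mod_cast hp.le
  have hrQ : 4 * p ≤ r * (p : ℝ) ^ m := by
    rw [hQ]
    nlinarith
  have hτ : D p / (p ^ m) ^ (m + 2) ≤ p := by
    refine Nat.div_le_of_le_mul (hD.trans ?_)
    rw [blockLength]
    calc p ^ (m * (m + 1)) * mulOrder m a p ≤ p ^ (m * (m + 1)) * (p * p ^ m) := by gcongr; omega
      _ ≤ p ^ (m * (m + 1)) * (p * p ^ m) := le_rfl
      _ = (p ^ m) ^ (m + 2) * p := by ring
  have hN0 : 0 < ⌊r / 2 * (p : ℝ) ^ m⌋₊ := by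
    rw [Nat.floor_pos]
    linarith
  have hNle : ⌊r / 2 * (p : ℝ) ^ m⌋₊ ≤ p ^ m := by
    refine Nat.floor_le_of_le ?_
    push_cast
    exact mul_le_of_le_one_left (by positivity) (by linarith)
  have hZle : ⌊r / 4 * (p : ℝ) ^ (m - 1)⌋₊ ≤ p ^ (m - 1) := by
    refine Nat.floor_le_of_le ?_
    push_cast
    exact mul_le_of_le_one_left (by positivity) (by linarith)
  have hkU : ⌊r / 2 * (p : ℝ) ^ m⌋₊ + p * ⌊r / 4 * (p : ℝ) ^ (m - 1)⌋₊ + D p / (p ^ m) ^ (m + 2) ≤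
      ⌈r * (p ^ m : ℕ)⌉₊ := by
    have h1 : (⌊r / 2 * (p : ℝ) ^ m⌋₊ : ℝ) ≤ r / 2 * (p : ℝ) ^ m := Nat.floor_le (by positivity)
    have h2 : (⌊r / 4 * (p : ℝ) ^ (m - 1)⌋₊ : ℝ) ≤ r / 4 * (p : ℝ) ^ (m - 1) :=
      Nat.floor_le (by positivity)
    have h3 : ((D p / (p ^ m) ^ (m + 2) : ℕ) : ℝ) ≤ p := by exact_mod_cast hτ
    have h4 : (p : ℝ) * ⌊r / 4 * (p : ℝ) ^ (m - 1)⌋₊ ≤ r / 4 * (p : ℝ) ^ m := by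
      rw [hQ]
      calc (p : ℝ) * ⌊r / 4 * (p : ℝ) ^ (m - 1)⌋₊ ≤ p * (r / 4 * (p : ℝ) ^ (m - 1)) := by gcongr
        _ = _ := by ring
    have h5 := Nat.le_ceil (r * (p ^ m : ℕ))
    push_cast at h5
    rw [← Nat.cast_le (α := ℝ)]
    push_cast
    linarith
  have hmain := card_good_exponents (m := m) (K := mulOrder m a p) (D := D p)
    (kV := ⌈r * mulOrder m a p⌉₊) hp (by omega) (ceil_mul_le hr1.le _) h2K hN0 hNle hZle hkU
    (Nat.div_mul_le_self _ _)
  have hcard := card_le_finrank_messageSpace (F := F) (U := addPart F p m) (V := mulPart F m a p)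
    (r := r) (D := D p) {e ∈ Finset.range (D p) |
      (Nat.digits (p ^ m) e).sum < ⌈r * (p ^ m : ℕ)⌉₊ ∧
        e % mulOrder m a p < ⌈r * mulOrder m a p⌉₊} (fun e he => by
    obtain ⟨he, hes, hem⟩ := Finset.mem_filter.1 he
    refine mem_messageSpace.2 ⟨?_, ?_, ?_⟩
    · rw [degree_X_pow]
      exact_mod_cast Finset.mem_range.1 he
    · rw [hU]
      exact baseDegree_translationPoly_X_pow_lt hF ((Dvd.intro _ rfl).trans hN) (by omega) hes
        (ceil_mul_le hr1.le _)
    · refine baseDegree_scalingPoly_X_pow_lt ?_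
      rwa [hV])
  rw [monomialCount, div_le_iff₀ (by positivity), mul_comm _ (((m + 1).factorial : ℕ) : ℝ)]
  have h6 := hmain.trans (Nat.mul_le_mul_left _ hcard)
  have h7 : ((⌊r / 2 * (p : ℝ) ^ m⌋₊ ^ (m + 1) * (⌊r / 4 * (p : ℝ) ^ (m - 1)⌋₊ *
    (D p / (p ^ m) ^ (m + 2)) * (⌈r * mulOrder m a p⌉₊ / p ^ m)) : ℕ) : ℝ) ≤
    (((m + 1).factorial *
      Module.finrank F (messageSpace (addPart F p m) (mulPart F m a p) r (D p)) : ℕ) : ℝ) :=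
    Nat.cast_le.2 h6
  simpa only [Nat.cast_mul, Nat.cast_pow] using h7

end Instance

end AlgExpander

/-! ### Assembly -/

open AlgExpander in
theorem theorem5p2 (m a : ℕ) (hm : 2 ≤ m) (ha : 2 ≤ a) (γ r ρ : ℝ) (hγ : γ = 1 / (a : ℝ))
    (hr0 : 0 < r) (hr1 : r < 1) (hρ0 : 0 < ρ) (hρ1 : ρ ≤ 1) (D : ℕ → ℕ)
    (hD : ∀ p ∈ admissible a, D p ≤ blockLength m a p)
    (hDρ : Tendsto (fun p => (D p : ℝ) / blockLength m a p) (admissibleAtTop a) (𝓝 ρ)) :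
    -- there are infinitely many admissible primes
    (admissibleAtTop a).NeBot ∧
    -- the length, and the local lengths in terms of it
    (fun p => (blockLength m a p : ℝ)) ~[admissibleAtTop a]
      (fun p => γ * (p : ℝ) ^ ((m + 1) ^ 2)) ∧
    (fun p : ℕ => (p : ℝ) ^ m) =Θ[admissibleAtTop a]
      (fun p => (blockLength m a p : ℝ) ^ ((m : ℝ) / ((m : ℝ) + 1) ^ 2)) ∧
    (fun p : ℕ => γ * ((p : ℝ) ^ (m + 1) - 1)) =Θ[admissibleAtTop a]
      (fun p => (blockLength m a p : ℝ) ^ (1 / ((m : ℝ) + 1))) ∧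
    ∀ ε : ℝ, 0 < ε → ∀ᶠ p in admissibleAtTop a,
      -- every finite field of characteristic `p` that contains `F_{p^m}` and `F_{p^(m+1)}`
      -- and has at least as many elements as the group `A`
      ∀ (F : Type*) [Field F] [Finite F] [Fact p.Prime] [CharP F p] (N : ℕ),
        Nat.card F = p ^ N → m * (m + 1) ∣ N → blockLength m a p ≤ Nat.card F →
        ∀ (U : AddSubgroup F) (V : Subgroup Fˣ), U = addPart F p m → V = mulPart F m a p →
        Nat.card U = p ^ m ∧
        (Nat.card V : ℝ) = γ * ((p : ℝ) ^ (m + 1) - 1) ∧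
        Nat.card (genGroup U V) = blockLength m a p ∧
        (∃ α : F, HasTrivialStabilizer U V α) ∧
        -- the coset graph is biregular and a spectral expander
        (∀ v, Nat.card {φ // leftEnd U V φ = v}
          = Nat.card U) ∧
        (∀ v, Nat.card {φ // rightEnd U V φ = v}
          = Nat.card V) ∧
        cosetSigmaTwo U V ≤ (1 + ε) / √(p : ℝ) ∧
        ∀ α : F, HasTrivialStabilizer U V α →
          -- the length, and the structure as a (subcode of a) Tanner code
          Function.Bijective (edgePoint U V α) ∧
          Nat.card (evalSet U V α) = blockLength m a p ∧
          edgeCode U V r (D p) α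
            ≤ cosetTannerCode U V r α ∧
          (D p = blockLength m a p →
            edgeCode U V r (D p) α
              = cosetTannerCode U V r α) ∧
          -- the local codes
          (∀ v, rate (leftLocalCode U V r α v) ≤ r + ε ∧
            1 - r - ε ≤ relDist (leftLocalCode U V r α v)) ∧
          (∀ v, rate (rightLocalCode U V r α v) ≤ r + ε ∧
            1 - r - ε ≤ relDist (rightLocalCode U V r α v)) ∧
          -- the global relative distance
          max (1 - ρ) ((1 - r) ^ 2) - ε
            ≤ relDist (code U V r (D p) α) ∧
          -- the global rate
          γ ^ (2 * m) * r / ((2 * m + 1).factorial : ℝ) *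
              (r ^ (2 * m + 1) - (max 0 (r - ρ)) ^ (2 * m + 1)) - ε
            ≤ rate (code U V r (D p) α) := by
  have ha0 : a ≠ 0 := by omega
  have haR : (0 : ℝ) < a := by exact_mod_cast (by omega : 0 < a)
  have hγ0 : 0 < γ := by rw [hγ]; positivity
  have hm1 : ((m : ℝ) + 1) ≠ 0 := by positivity
  refine ⟨admissibleAtTop_neBot ha0, ?_, ?_, ?_, fun ε hε => ?_⟩
  · rw [hγ]
    exact blockLength_isEquivalent ha0
  · exact pow_isTheta_blockLength ha0 (by field_simp)
  · exact (pow_sub_one_isTheta hγ0.ne').trans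
      (pow_isTheta_blockLength ha0 (by push_cast; field_simp))
  have hlim := tendsto_monomialCount hm ha0 hr0 hDρ
  have hconst := rate_constant_le hm ha hr0 hr1 hρ0
  rw [← hγ] at hlim hconst
  have hreal := tendsto_natCast_admissibleAtTop a
  have hsqrt := Real.tendsto_sqrt_atTop.comp hreal
  -- The thresholds depend only on p, which makes all bounds uniform in F and α: 2/(γε) gives the
  -- spectral bound, (1+ε)/ε gives σ ≤ ε, 1/ε absorbs the local rounding, and 4/r makes room for the
  -- digit budget.
  filter_upwards [eventually_admissible a,
    hsqrt.eventually_ge_atTop (2 / (γ * ε)), hsqrt.eventually_ge_atTop ((1 + ε) / ε),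
    hreal.eventually_ge_atTop (1 / ε), hDρ.eventually_const_lt hρ0,
    hDρ.eventually_lt_const (show ρ < ρ + ε by linarith),
    (tendsto_natCast_pow_admissibleAtTop a (show m - 1 ≠ 0 by omega)).eventually_ge_atTop (4 / r),
    hlim.eventually_const_lt (sub_lt_self _ hε)]
    with p hp hp1 hp2 hp3 hD0 hDε hpr hcount
  intro F _ _ _ _ N hF hN hn U V hU hV
  subst hU hV
  classical
  have := Fintype.ofFinite (genGroup (addPart F p m) (mulPart F m a p))
  have hap := hp.2
  have hpR : (0 : ℝ) < p := by exact_mod_cast hp.1.pos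
  have hcardU := card_addPart (F := F) hF ((Dvd.intro _ rfl).trans hN) (show 0 < m by omega)
  have hcardV := card_mulPart (F := F) (m := m) hap hF hN
  have hcardA := card_genGroup (F := F) (m := m) (by omega) hap hF hN
  have hexp := isExpander_coset (F := F) (m := m) (by omega) hap hF hN
  have hσ0 : 0 ≤ sigmaBound m a p := Real.sqrt_nonneg _
  have hσ := sigmaBound_le hm ha0 hp hγ hε hp1
  have hσε : sigmaBound m a p ≤ ε := by
    refine hσ.trans ?_
    have hs0 : 0 < √(p : ℝ) := Real.sqrt_pos.2 hpR
    rw [div_le_iff₀ hs0]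
    have h1 : (1 + ε) / ε ≤ √(p : ℝ) := hp2
    rw [div_le_iff₀ hε] at h1
    linarith
  have hεp : 1 ≤ ε * p := by
    rw [div_le_iff₀ hε] at hp3
    linarith
  have hpU : p ≤ Nat.card (addPart F p m) := by
    rw [hcardU]
    exact Nat.le_self_pow (by omega) p
  have hpV : p ≤ Nat.card (mulPart F m a p) := by
    rw [hcardV]
    exact (Nat.le_self_pow (by omega) p).trans
      (pow_lt_mulOrder (m := m) (by omega) hp.1.one_lt hap).le
  have hεU : 1 ≤ ε * Nat.card (addPart F p m) := hεp.trans (by gcongr)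
  have hεV : 1 ≤ ε * Nat.card (mulPart F m a p) := hεp.trans (by gcongr)
  have hDp := hD p hp
  -- Since ρ > 0, D is eventually positive and the code is nonzero, as the distance bound requires.
  have hDpos : 0 < D p := by
    rcases Nat.eq_zero_or_pos (D p) with h | h
    · simp [h] at hD0
    · exact h
  refine ⟨hcardU, ?_, hcardA, exists_hasTrivialStabilizer (by omega) hap hF hN hn,
    card_leftEnd_fibre, card_rightEnd_fibre, ?_, fun α hα => ⟨hα.bijective,
    hα.card_evalSet.trans hcardA, edgeCode_le_cosetTannerCode r (D p) α, fun hDn => ?_,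
    leftLocalCode_bounds hr0 hε hεU hα, rightLocalCode_bounds hr0 hε hεV hα, ?_, ?_⟩⟩
  · rw [hcardV, cast_mulOrder hp ha0, hγ]
  · exact (hexp.sigmaTwo_le hσ0 Nat.card_pos Nat.card_pos).trans hσ
  · refine le_antisymm (edgeCode_le_cosetTannerCode r (D p) α) ?_
    rw [hDn, ← hcardA]
    exact cosetTannerCode_le_edgeCode hr1.le hα
  · refine le_trans ?_ (max_le_relDist_code hexp hσ0 hr0 hr1 hα hDpos)
    rw [hcardA, sub_le_iff_le_add]
    refine max_le ?_ ?_
    · linarith [le_max_left (1 - (D p : ℝ) / blockLength m a p)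
        ((1 - r) ^ 2 - sigmaBound m a p * (1 - r))]
    · have h1 : sigmaBound m a p * (1 - r) ≤ ε := by nlinarith
      linarith [le_max_right (1 - (D p : ℝ) / blockLength m a p)
        ((1 - r) ^ 2 - sigmaBound m a p * (1 - r))]
  · rw [rate, finrank_code hα (hDp.trans hcardA.ge), hα.card_evalSet, hcardA]
    have hpr' : 4 ≤ r * (p : ℝ) ^ (m - 1) := by
      rw [div_le_iff₀ hr0] at hpr
      linarith
    have h1 := monomialCount_le_finrank (F := F) hm ha hap hF hN hr0 hr1 hDp hpr'
    calc _ ≤ monomialCount m a r D p / blockLength m a p :=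
          (sub_le_sub_right hconst ε).trans hcount.le
      _ ≤ _ := by gcongr
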